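/- An \emph{extended group} $G$ is a sequence of groups $G_1,G_2,G_3,\dots$, each at most countable, such that $G_k$ is abelian for all $k>1$ and there is $N$ with $G_k$ trivial for all $k>N$. For non-negative integers $n$ and positive integers $k$ let $[n\!:\!k]$ be the set of $k$-element subsets $\{q_1<\dots<q_k\}$ of $\{1,\dots,n\}$. For a group $H$ and $0\le j\le n$ define $\partial_j:H^{[n:k]}\to H^{[n-1:k]}$ ($n\geq 1$) and $s_j:H^{[n:k]}\to H^{[n+1:k]}$ by $$(\partial_j h)_{q_1,\dots,q_k}=\begin{cases}h_{q_1,\dots,q_i,q_{i+1}+1,\dots,q_k+1}, & q_i<j<q_{i+1},\\ h_{q_1,\dots,q_i,q_{i+1}+1,\dots,q_k+1}\;h_{q_1,\dots,q_{i-1},q_i+1,q_{i+1}+1,\dots,q_k+1}, & q_i=j,\end{cases}$$ $$(s_j h)_{q_1,\dots,q_k}=\begin{cases}h_{q_1,\dots,q_i,q_{i+1}-1,\dots,q_k-1}, & q_i<j+1<q_{i+1},\\ 1, & j+1\in\{q_1,\dots,q_k\},\end{cases}$$ where $q_0=-\infty$ and $q_{k+1}=+\infty$. For a positive integer $m$ and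 a group $H$, abelian if $m>1$, let $\mathcal K(H,m)$ be the simplicial set with $\mathcal K(H,m)_n=H^{[n:m]}$ (one point if $n<m$), face maps $\partial_j$ and degeneracy maps $s_j$, and let $|\mathcal K(H,m)|$ be its geometric realization. For an abelian group $M$, written additively, let $C^n(G,M)$ be the group of all maps $\prod_{k=1}^n G_k^{[n:k]}\to M$ (so $C^0(G,M)=M$), and let $\mathrm d_n:C^n(G,M)\to C^{n+1}(G,M)$ be $$(\mathrm d_n c)(g^{(1)},\dots,g^{(n+1)})=\sum_{j=0}^{n+1}(-1)^j\,c(\partial_j g^{(1)},\dots,\partial_j g^{(n)}),\qquad g^{(k)}\in G_k^{[n+1:k]}$$ (so $\mathrm d_0=0$). This is a cochain complex; let $H^n(G,M)=\ker \mathrm d_n/\operatorname{im}\mathrm d_{n-1}$, where $\operatorname{im}\mathrm d_{-1}=0$. \textbf{Theorem.} Let $G$ be an extended group and $M$ an abelian group. Then for each non-negative integer $n$ there is a group isomorphism $$H^n(G,M)\;\cong\;H^n\Bigl(\prod_{k=1}^{\infty}|\mathcal K(G_k,k)|,\,M\Bigr),$$ where the right-hand side is the singular cohomology, with coefficients in $M$,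 of the product space (with the product topology). -/

import Mathlib

open CategoryTheory Opposite Simplicial

universe u v

/-- The set `[n:k]` of all `k`-element subsets of `{1, 2, ..., n}`; a subset is recorded by the
increasing list `1 ≤ q₁ < ... < qₖ ≤ n` of its elements. -/
@[ext]
structure MultiIndex (n k : ℕ) where
  toFun : Fin k → ℕ
  strictMono : StrictMono toFun
  one_le : ∀ i, 1 ≤ toFun i
  le : ∀ i, toFun i ≤ n

namespace MultiIndex

variable {n n' n'' k : ℕ}

instance : CoeFun (MultiIndex n k) (fun _ => Fin k → ℕ) := ⟨toFun⟩

theorem toFun_injective : Function.Injective (toFun : MultiIndex n k → Fin k → ℕ) :=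
  fun _ _ h => MultiIndex.ext h

instance : Finite (MultiIndex n k) := by
  refine Finite.of_injective
    (fun (q : MultiIndex n k) (i : Fin k) => (⟨q i, Nat.lt_succ_of_le (q.le i)⟩ : Fin (n + 1))) ?_
  intro q r h
  ext i
  exact congrArg Fin.val (congrFun h i)

noncomputable instance : Fintype (MultiIndex n k) := Fintype.ofFinite _

/-- The lexicographic order. -/
noncomputable instance : LinearOrder (MultiIndex n k) :=
  LinearOrder.lift' (fun q => toLex q.toFun) (fun _ _ h => toFun_injective (toLex.injective h))

/-- Add `1` to all entries that are at least `c`, and keep the others. -/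
def raise (c : ℕ) (q : MultiIndex n k) : MultiIndex (n + 1) k where
  toFun i := if q i < c then q i else q i + 1
  strictMono i j hij := by
    have h := q.strictMono hij
    dsimp only
    split_ifs <;> omega
  one_le i := by
    have h := q.one_le i
    split_ifs <;> omega
  le i := by
    have h := q.le i
    split_ifs <;> omega

/-- For a monotone map `α : {0, ..., n'} → {0, ..., n}` and `q ∈ [n':k]`, the set of all `r ∈ [n:k]`
with `α (qᵢ - 1) < rᵢ ≤ α (qᵢ)` for all `i`. -/
noncomputable def block (α : Fin (n' + 1) →o Fin (n + 1)) (q : MultiIndex n' k) :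
    Finset (MultiIndex n k) :=
  Finset.univ.filter fun r => ∀ i,
    (α ⟨q i - 1, lt_of_le_of_lt (Nat.sub_le _ _) (Nat.lt_succ_of_le (q.le i))⟩ : ℕ) < r i ∧
      r i ≤ (α ⟨q i, Nat.lt_succ_of_le (q.le i)⟩ : ℕ)

end MultiIndex

/-- The face maps `∂ⱼ : H^[n+1:k] → H^[n:k]`, `0 ≤ j ≤ n + 1`: the entry at `(q₁, ..., qₖ)` is
the entry of `h` at the index obtained by raising by one all entries that exceed `j`; if some
entry equals `j`, this is multiplied by the entry of `h` at the index where that entry is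
raised too. -/
noncomputable def faceMap {H : Type u} [Group H] {n k : ℕ} (j : Fin (n + 2))
    (h : MultiIndex (n + 1) k → H) : MultiIndex n k → H :=
  open Classical in
  fun q =>
    if ∃ i, q i = j then h (q.raise (j + 1)) * h (q.raise j) else h (q.raise (j + 1))

namespace MultiIndex

variable {H : Type u} [Group H] {n n' n'' k : ℕ}

/-- The action of a monotone map `α : {0, ..., n'} → {0, ..., n}` on families indexed by `[n:k]`:
`(pull α h) q` is the product of the `h r`, over all `r` in `block α q` in lexicographic order.
(The order matters only for noncommutative `H`, hence only for `k = 1`.) -/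
noncomputable def pull (α : Fin (n' + 1) →o Fin (n + 1)) (h : MultiIndex n k → H) :
    MultiIndex n' k → H :=
  fun q => (((block α q).sort).map h).prod

theorem mem_block {α : Fin (n' + 1) →o Fin (n + 1)} {q : MultiIndex n' k} {r : MultiIndex n k} :
    r ∈ block α q ↔ ∀ i,
    (α ⟨q i - 1, lt_of_le_of_lt (Nat.sub_le _ _) (Nat.lt_succ_of_le (q.le i))⟩ : ℕ) < r i ∧
      r i ≤ (α ⟨q i, Nat.lt_succ_of_le (q.le i)⟩ : ℕ) := by
  simp [block]

theorem apply_le (α : Fin (n' + 1) →o Fin (n + 1)) {a b : ℕ} (ha : a < n' + 1) (hb : b < n' + 1)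
    (hab : a ≤ b) : (α ⟨a, ha⟩ : ℕ) ≤ α ⟨b, hb⟩ :=
  α.monotone (show (⟨a, ha⟩ : Fin (n' + 1)) ≤ ⟨b, hb⟩ from hab)

theorem eq_of_mem_block {α : Fin (n' + 1) →o Fin (n + 1)} {q q' : MultiIndex n' k}
    {r : MultiIndex n k} (h : r ∈ block α q) (h' : r ∈ block α q') : q = q' := by
  rw [mem_block] at h h'
  ext i
  have hq := q.one_le i
  have hq' := q'.one_le i
  have l := q.le i
  have l' := q'.le i
  obtain ⟨h1, h2⟩ := h i
  obtain ⟨h3, h4⟩ := h' i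
  by_contra hne
  rcases Nat.lt_or_gt_of_ne hne with hlt | hlt
  · have := apply_le α (a := q i) (b := q' i - 1) (by omega) (by omega) (by omega)
    omega
  · have := apply_le α (a := q' i) (b := q i - 1) (by omega) (by omega) (by omega)
    omega

theorem mem_block_comp {α : Fin (n'' + 1) →o Fin (n' + 1)} {β : Fin (n' + 1) →o Fin (n + 1)}
    {q : MultiIndex n'' k} {s : MultiIndex n k} :
    s ∈ block (β.comp α) q ↔ ∃ r ∈ block α q, s ∈ block β r := by
  constructor
  · intro h
    rw [mem_block] at h
    have ex : ∀ i, ∃ r, ∃ hr : r < n' + 1, s i ≤ (β ⟨r, hr⟩ : ℕ) := fun i =>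
      ⟨_, (α ⟨q i, Nat.lt_succ_of_le (q.le i)⟩).isLt, (h i).2⟩
    classical
    let f : Fin k → ℕ := fun i => Nat.find (ex i)
    have f1 : ∀ i, ∃ hr : f i < n' + 1, s i ≤ (β ⟨f i, hr⟩ : ℕ) := fun i => Nat.find_spec (ex i)
    have f2 : ∀ i m (hm : m < n' + 1), m < f i → (β ⟨m, hm⟩ : ℕ) < s i := by
      intro i m hm hlt
      by_contra hc
      exact Nat.find_min (ex i) hlt ⟨hm, not_lt.mp hc⟩
    have f3 : ∀ i, f i ≤ (α ⟨q i, Nat.lt_succ_of_le (q.le i)⟩ : ℕ) := fun i =>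
      Nat.find_min' (ex i) ⟨(α ⟨q i, Nat.lt_succ_of_le (q.le i)⟩).isLt, (h i).2⟩
    have f4 : ∀ i, (α ⟨q i - 1,
        lt_of_le_of_lt (Nat.sub_le _ _) (Nat.lt_succ_of_le (q.le i))⟩ : ℕ) < f i := by
      intro i
      by_contra hc
      obtain ⟨hr, hs⟩ := f1 i
      have h1 := (h i).1
      have h2 := apply_le β hr (α ⟨q i - 1,
        lt_of_le_of_lt (Nat.sub_le _ _) (Nat.lt_succ_of_le (q.le i))⟩).isLt (not_lt.mp hc)
      simp only [OrderHom.comp_coe, Function.comp_apply, Fin.eta] at h1 h2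
      omega
    refine ⟨⟨f, ?_, ?_, ?_⟩, ?_, ?_⟩
    · intro i j hij
      have hq := q.strictMono hij
      have l1 := q.le i
      have l2 := q.le j
      have h1 := f3 i
      have h2 := f4 j
      have h3 := apply_le α (a := q i) (b := q j - 1) (by omega) (by omega) (by omega)
      omega
    · intro i
      have := f4 i
      omega
    · intro i
      obtain ⟨hr, -⟩ := f1 i
      omega
    · rw [mem_block]
      exact fun i => ⟨f4 i, f3 i⟩
    · rw [mem_block]
      intro i
      obtain ⟨hr, hs⟩ := f1 i
      have := f4 i
      exact ⟨f2 i _ _ (by dsimp only; omega), hs⟩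
  · rintro ⟨r, hr, hs⟩
    rw [mem_block] at hr hs ⊢
    intro i
    obtain ⟨h1, h2⟩ := hr i
    obtain ⟨h3, h4⟩ := hs i
    have h5 := β.monotone (show α ⟨q i - 1, lt_of_le_of_lt (Nat.sub_le _ _)
      (Nat.lt_succ_of_le (q.le i))⟩ ≤ ⟨r i - 1, lt_of_le_of_lt (Nat.sub_le _ _)
      (Nat.lt_succ_of_le (r.le i))⟩ from Nat.le_sub_one_of_lt h1)
    have h6 := β.monotone (show ⟨r i, Nat.lt_succ_of_le (r.le i)⟩ ≤
      α ⟨q i, Nat.lt_succ_of_le (q.le i)⟩ from h2)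
    rw [Fin.le_def] at h5 h6
    simp only [OrderHom.comp_coe, Function.comp_apply]
    omega

theorem pull_id (h : MultiIndex n k → H) : pull OrderHom.id h = h := by
  funext q
  have : block OrderHom.id q = {q} := by
    ext r
    rw [mem_block, Finset.mem_singleton]
    constructor
    · intro hr
      ext i
      have := hr i
      have := q.one_le i
      simp only [OrderHom.id_coe, id_eq] at *
      omega
    · rintro rfl i
      have := r.one_le i
      simp only [OrderHom.id_coe, id_eq]
      omega
  simp [pull, this]

theorem prod_map_flatMap {A B : Type*} (l : List A) (f : A → List B) (h : B → H) :
    ((l.flatMap f).map h).prod = (l.map fun a => ((f a).map h).prod).prod := by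
  induction l with
  | nil => simp
  | cons a l ih => simp [ih]

theorem pull_comp (hH : 1 < k → ∀ a b : H, a * b = b * a)
    (α : Fin (n'' + 1) →o Fin (n' + 1)) (β : Fin (n' + 1) →o Fin (n + 1))
    (h : MultiIndex n k → H) : pull (β.comp α) h = pull α (pull β h) := by
  funext q
  unfold pull
  rw [← prod_map_flatMap]
  have perm : ((block (β.comp α) q).sort).Perm
      (((block α q).sort).flatMap fun r => (block β r).sort) := by
    rw [List.perm_ext_iff_of_nodup (Finset.sort_nodup _ _)]
    · intro s
      simp [mem_block_comp]
    · rw [List.nodup_flatMap]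
      refine ⟨fun r _ => Finset.sort_nodup _ _, ?_⟩
      refine List.Pairwise.imp ?_ (Finset.sort_nodup (block α q) (· ≤ ·))
      intro a b hab s hs hs'
      rw [Finset.mem_sort] at hs hs'
      exact hab (eq_of_mem_block hs hs')
  by_cases hk : 1 < k
  · refine List.Perm.prod_eq' (perm.map h) ?_
    exact List.pairwise_of_forall fun a b => hH hk a b
  · congr 2
    refine List.Perm.eq_of_pairwise' (r := (· ≤ ·)) (Finset.pairwise_sort _ _) ?_ perm
    rw [List.pairwise_flatMap]
    refine ⟨fun r _ => Finset.pairwise_sort _ _, ?_⟩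
    refine List.Pairwise.imp ?_ (Finset.sortedLT_sort (block α q)).pairwise
    intro a b hab s hs t ht
    rw [Finset.mem_sort, mem_block] at hs ht
    change toLex a.toFun < toLex b.toFun at hab
    change toLex s.toFun ≤ toLex t.toFun
    obtain ⟨i, -, hi⟩ := hab
    refine le_of_lt ⟨i, fun j hj => ?_, ?_⟩
    · have := i.isLt
      have : (j : ℕ) < i := hj
      omega
    · have h1 := (hs i).2
      have h2 := (ht i).1
      have hi' : a i < b i := hi
      have l1 := a.le i
      have l2 := b.le i
      have h3 := apply_le β (a := a i) (b := b i - 1) (by omega) (by omega) (by omega)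
      change s i < t i
      omega

end MultiIndex

/-- The simplicial set `𝒦(H, m)`. Its set of `n`-simplices is `H^[n:m]` (a single point if
`n < m`); for its face and degeneracy maps see `simplicialK_δ`, `simplicialK_σ_of_mem` and
`simplicialK_σ_of_notMem`. -/
noncomputable def simplicialK (H : Type u) [Group H] (m : ℕ)
    (hH : 1 < m → ∀ a b : H, a * b = b * a) : SSet.{u} where
  obj S := MultiIndex S.unop.len m → H
  map f := ↾(fun h => MultiIndex.pull f.unop.toOrderHom h)
  map_id S := by
    ext h
    exact congrFun (MultiIndex.pull_id h) _
  map_comp f g := by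
    ext h
    exact congrFun (MultiIndex.pull_comp hH g.unop.toOrderHom f.unop.toOrderHom h) _

section simplicialK

variable {H : Type u} [Group H] {n m : ℕ} (hH : 1 < m → ∀ a b : H, a * b = b * a)

theorem MultiIndex.pull_δ (j : Fin (n + 2)) (h : MultiIndex (n + 1) m → H) :
    MultiIndex.pull (SimplexCategory.δ j).toOrderHom h = faceMap j h := by
  have val : ∀ (x : ℕ) (hx : x < n + 1),
      ((SimplexCategory.δ j).toOrderHom ⟨x, hx⟩ : ℕ) = if x < j then x else x + 1 := by
    intro x hx
    change ((j.succAbove ⟨x, hx⟩ : Fin (n + 2)) : ℕ) = _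
    unfold Fin.succAbove
    simp only [Fin.lt_def]
    split_ifs <;> simp_all
  funext q
  have key : ∀ r : MultiIndex (n + 1) m, r ∈ MultiIndex.block (SimplexCategory.δ j).toOrderHom q ↔
      ∀ i, (if q i - 1 < j then q i - 1 else q i - 1 + 1) < r i ∧
        r i ≤ if q i < j then q i else q i + 1 := by
    intro r
    rw [MultiIndex.mem_block]
    exact forall_congr' fun i => by rw [val, val]
  by_cases hq : ∃ i, q i = j
  · obtain ⟨i₀, hi₀⟩ := hq
    have hlt : q.raise (j + 1) < q.raise j := by
      change toLex (q.raise (j + 1)).toFun < toLex (q.raise j).toFun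
      refine ⟨i₀, fun i hi => ?_, ?_⟩
      · have := q.strictMono hi
        simp only [MultiIndex.raise, Pi.toLex_apply]
        split_ifs <;> omega
      · simp only [MultiIndex.raise, Pi.toLex_apply]
        split_ifs <;> omega
    have hb : MultiIndex.block (SimplexCategory.δ j).toOrderHom q =
        {q.raise (j + 1), q.raise j} := by
      ext r
      rw [key, Finset.mem_insert, Finset.mem_singleton]
      constructor
      · intro hr
        by_cases h0 : r i₀ = j
        · left
          ext i
          have h1 := hr i
          have h2 := q.one_le i
          simp only [MultiIndex.raise]
          by_cases hi : i = i₀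
          · subst hi
            split_ifs <;> omega
          · have : q i ≠ q i₀ := fun h => hi (q.strictMono.injective h)
            split_ifs at h1 ⊢ <;> omega
        · right
          ext i
          have h1 := hr i
          have h2 := q.one_le i
          simp only [MultiIndex.raise]
          by_cases hi : i = i₀
          · subst hi
            split_ifs at h1 ⊢ <;> omega
          · have : q i ≠ q i₀ := fun h => hi (q.strictMono.injective h)
            split_ifs at h1 ⊢ <;> omega
      · rintro (rfl | rfl) i
        · have h2 := q.one_le i
          simp only [MultiIndex.raise]
          split_ifs <;> omega
        · have h2 := q.one_le i
          simp only [MultiIndex.raise]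
          split_ifs <;> omega
    rw [MultiIndex.pull, hb, Finset.sort_insert, Finset.sort_singleton]
    · simp only [faceMap, if_pos (⟨i₀, hi₀⟩ : ∃ i, q i = j)]
      simp
    · intro b hb
      rw [Finset.mem_singleton] at hb
      exact hb ▸ hlt.le
    · rw [Finset.mem_singleton]
      exact hlt.ne
  · have hb : MultiIndex.block (SimplexCategory.δ j).toOrderHom q = {q.raise (j + 1)} := by
      ext r
      rw [key, Finset.mem_singleton]
      constructor
      · intro hr
        ext i
        have h1 := hr i
        have h2 := q.one_le i
        have h3 : q i ≠ j := fun h => hq ⟨i, h⟩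
        simp only [MultiIndex.raise]
        split_ifs at h1 ⊢ <;> omega
      · rintro rfl i
        have h2 := q.one_le i
        simp only [MultiIndex.raise]
        split_ifs <;> omega
    simp only [faceMap, if_neg hq]
    simp [MultiIndex.pull, hb]

/-- The face maps of `𝒦(H, m)` are the maps `∂ⱼ`. -/
theorem simplicialK_δ (j : Fin (n + 2)) (h : MultiIndex (n + 1) m → H) :
    (simplicialK H m hH).δ j h = faceMap j h :=
  MultiIndex.pull_δ j h

theorem σ_val (j : Fin (n + 1)) (x : ℕ) (hx : x < n + 2) :
    ((SimplexCategory.σ j).toOrderHom ⟨x, hx⟩ : ℕ) = if x ≤ j then x else x - 1 := by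
  change ((Fin.predAbove j ⟨x, hx⟩ : Fin (n + 1)) : ℕ) = _
  unfold Fin.predAbove
  simp only [Fin.lt_def, Fin.val_castSucc]
  split_ifs <;> simp_all
  omega

/-- Degeneracies of `𝒦(H, m)`: the entry of `σⱼ h` at an index that contains `j + 1` is `1`. -/
theorem simplicialK_σ_of_mem (j : Fin (n + 1)) (h : MultiIndex n m → H)
    (q : MultiIndex (n + 1) m) (hq : ∃ i, q i = j + 1) :
    ((simplicialK H m hH).σ j h : MultiIndex (n + 1) m → H) q = 1 := by
  change MultiIndex.pull (SimplexCategory.σ j).toOrderHom h q = 1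
  obtain ⟨i, hi⟩ := hq
  have hb : MultiIndex.block (SimplexCategory.σ j).toOrderHom q = ∅ := by
    ext r
    rw [MultiIndex.mem_block]
    simp only [Finset.notMem_empty, iff_false, not_forall]
    refine ⟨i, ?_⟩
    rw [σ_val, σ_val, hi]
    split_ifs <;> omega
  simp [MultiIndex.pull, hb]

/-- Degeneracies of `𝒦(H, m)`: the entry of `σⱼ h` at an index `q` that does not contain `j + 1` is
the entry of `h` at the index obtained by lowering by one all entries that exceed `j + 1`. -/
theorem simplicialK_σ_of_notMem (j : Fin (n + 1)) (h : MultiIndex n m → H)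
    (q : MultiIndex (n + 1) m) (hq : ∀ i, q i ≠ j + 1) (r : MultiIndex n m)
    (hr : ∀ i, r i = if q i < j + 1 then q i else q i - 1) :
    ((simplicialK H m hH).σ j h : MultiIndex (n + 1) m → H) q = h r := by
  change MultiIndex.pull (SimplexCategory.σ j).toOrderHom h q = h r
  have hb : MultiIndex.block (SimplexCategory.σ j).toOrderHom q = {r} := by
    ext s
    rw [MultiIndex.mem_block, Finset.mem_singleton]
    constructor
    · intro hs
      ext i
      have h1 := hs i
      have h2 := hr i
      have h3 := hq i
      have h4 := q.one_le i
      rw [σ_val, σ_val] at h1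
      split_ifs at h1 h2 <;> omega
    · rintro rfl i
      have h2 := hr i
      have h3 := hq i
      have h4 := q.one_le i
      rw [σ_val, σ_val]
      split_ifs at h2 ⊢ <;> omega
  simp [MultiIndex.pull, hb]

end simplicialK

theorem faceMap_comm {H : Type u} [Group H] {n m : ℕ}
    (hH : 1 < m → ∀ a b : H, a * b = b * a) {i j : Fin (n + 2)} (hij : i ≤ j) (h : MultiIndex (n + 2) m → H) :
    faceMap i (faceMap j.succ h) = faceMap j (faceMap i.castSucc h) := by
  have key : ∀ (a b : Fin (n + 2)) (c e : Fin (n + 3)),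
      SimplexCategory.δ a ≫ SimplexCategory.δ c = SimplexCategory.δ b ≫ SimplexCategory.δ e →
      faceMap a (faceMap c h) = faceMap b (faceMap e h) := by
    intro a b c e hδ
    have h1 := MultiIndex.pull_comp hH (SimplexCategory.δ a).toOrderHom
      (SimplexCategory.δ c).toOrderHom h
    have h2 := MultiIndex.pull_comp hH (SimplexCategory.δ b).toOrderHom
      (SimplexCategory.δ e).toOrderHom h
    have h3 : (SimplexCategory.δ c).toOrderHom.comp (SimplexCategory.δ a).toOrderHom =
        (SimplexCategory.δ e).toOrderHom.comp (SimplexCategory.δ b).toOrderHom :=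
      congrArg SimplexCategory.Hom.toOrderHom hδ
    rw [← MultiIndex.pull_δ a, ← MultiIndex.pull_δ b, ← MultiIndex.pull_δ c, ← MultiIndex.pull_δ e]
    exact h1.symm.trans ((congrArg (fun f => MultiIndex.pull f h) h3).trans h2)
  exact key i j j.succ i.castSucc (SimplexCategory.δ_comp_δ hij)

section cochains

variable {X : ℕ → Type u} (d : ∀ n, Fin (n + 2) → X (n + 1) → X n) (M : Type v) [AddCommGroup M]

/-- The alternating sum `c ↦ ∑ⱼ (-1)ʲ c ∘ dⱼ` on `M`-valued functions. -/
def altCoboundary (n : ℕ) : (X n → M) →+ (X (n + 1) → M) where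
  toFun c x := ∑ j : Fin (n + 2), (-1 : ℤ) ^ (j : ℕ) • c (d n j x)
  map_zero' := by
    funext x
    simp
  map_add' a b := by
    funext x
    simp [Finset.sum_add_distrib]

theorem altCoboundary_comp
    (hd : ∀ n (i j : Fin (n + 2)), i ≤ j → ∀ x : X (n + 2),
      d n i (d (n + 1) j.succ x) = d n j (d (n + 1) i.castSucc x))
    (n : ℕ) (c : X n → M) : altCoboundary d M (n + 1) (altCoboundary d M n c) = 0 := by
  funext x
  change ∑ j : Fin (n + 3), (-1 : ℤ) ^ (j : ℕ) •
    ∑ i : Fin (n + 2), (-1 : ℤ) ^ (i : ℕ) • c (d n i (d (n + 1) j x)) = 0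
  simp only [Finset.smul_sum, smul_smul]
  rw [Finset.sum_comm, ← Finset.sum_product']
  let P := Fin (n + 2) × Fin (n + 3)
  let S : Finset P := Finset.univ.filter fun ij : P => (ij.2 : ℕ) ≤ (ij.1 : ℕ)
  rw [Finset.univ_product_univ, ← Finset.sum_add_sum_compl S, ← eq_neg_iff_add_eq_zero,
    ← Finset.sum_neg_distrib]
  let φ : ∀ ij : P, ij ∈ S → P := fun ij hij =>
    (Fin.castLT ij.2 (lt_of_le_of_lt (Finset.mem_filter.mp hij).right (Fin.is_lt ij.1)), ij.1.succ)
  apply Finset.sum_bij φ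
  · intro ij hij
    simp_rw [S, φ, Finset.compl_filter, Finset.mem_filter_univ, Fin.val_succ,
      Fin.val_castLT] at hij ⊢
    omega
  · rintro ⟨i, j⟩ hij ⟨i', j'⟩ hij' h
    rw [Prod.mk_inj]
    exact ⟨by simpa [φ] using! congr_arg Prod.snd h,
      by simpa [φ, Fin.castSucc_castLT] using! congr_arg Fin.castSucc (congr_arg Prod.fst h)⟩
  · rintro ⟨i', j'⟩ hij'
    simp_rw [S, Finset.compl_filter, Finset.mem_filter_univ, not_le] at hij'
    refine ⟨(j'.pred <| ?_, Fin.castSucc i'), ?_, ?_⟩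
    · rintro rfl
      simp only [Fin.val_zero, not_lt_zero] at hij'
    · simpa [S] using! Nat.le_sub_one_of_lt hij'
    · simp only [φ, Fin.castLT_castSucc, Fin.succ_pred]
  · rintro ⟨i, j⟩ hij
    have hij' : (j : ℕ) ≤ i := by simpa [S] using hij
    have h1 := hd n (Fin.castLT j (lt_of_le_of_lt hij' i.isLt)) i hij' x
    rw [Fin.castSucc_castLT] at h1
    simp only [φ]
    rw [h1, ← neg_smul]
    congr 1
    simp only [Fin.val_succ, Fin.val_castLT]
    ring

/-- The cochain complex of `M`-valued functions `(X₀ → M) ⟶ (X₁ → M) ⟶ (X₂ → M) ⟶ ⋯` attached to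
a sequence of sets `Xₙ` with face maps. -/
noncomputable def functionCochainComplex
    (hd : ∀ n (i j : Fin (n + 2)), i ≤ j → ∀ x : X (n + 2),
      d n i (d (n + 1) j.succ x) = d n j (d (n + 1) i.castSucc x)) :
    CochainComplex AddCommGrpCat.{max u v} ℕ :=
  CochainComplex.of (fun n => AddCommGrpCat.of (X n → M))
    (fun n => AddCommGrpCat.ofHom (altCoboundary d M n)) (fun n => by
      ext c : 2
      exact altCoboundary_comp d M hd n c)

end cochains

/-- The singular cochain complex of a topological space: `n`-cochains are the `M`-valued functions
on the set of singular `n`-simplices, with the alternating sum of faces as differential. -/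
noncomputable def singularCochainComplex (T : TopCat.{u}) (M : Type v) [AddCommGroup M] :
    CochainComplex AddCommGrpCat.{max u v} ℕ :=
  functionCochainComplex (X := fun n => (TopCat.toSSet.obj T) _⦋n⦌)
    (fun _ j x => (TopCat.toSSet.obj T).δ j x) M
    (fun _ _ _ hij x => ConcreteCategory.congr_hom ((TopCat.toSSet.obj T).δ_comp_δ hij) x)

/-- Singular cohomology `Hⁿ(T, M)`. -/
noncomputable def singularCohomology (T : TopCat.{u}) (M : Type v) [AddCommGroup M] (n : ℕ) :
    AddCommGrpCat.{max u v} :=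
  (singularCochainComplex T M).homology n

/-- An extended group: a sequence of groups `G₁, G₂, G₃, ...`, each at most countable, abelian in
degrees `k > 1` and trivial in all sufficiently large degrees. -/
structure ExtendedGroup where
  carrier : ℕ+ → Type u
  [group : ∀ k, Group (carrier k)]
  mul_comm : ∀ k : ℕ+, 1 < (k : ℕ) → ∀ a b : carrier k, a * b = b * a
  bounded : ∃ N : ℕ, ∀ k : ℕ+, N < (k : ℕ) → Subsingleton (carrier k)
  countable : ∀ k, Countable (carrier k)

namespace ExtendedGroup

attribute [instance] ExtendedGroup.group

variable (G : ExtendedGroup.{u})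

/-- The arguments `(g⁽¹⁾ ‖ ... ‖ g⁽ⁿ⁾)` of an `n`-cochain: the product of the `G_k^[n:k]`,
`1 ≤ k ≤ n`. -/
abbrev Arg (n : ℕ) : Type u := ∀ k : ℕ+, (k : ℕ) ≤ n → MultiIndex n k → G.carrier k

/-- `(g⁽¹⁾ ‖ ... ‖ g⁽ⁿ⁺¹⁾) ↦ (∂ⱼ g⁽¹⁾ ‖ ... ‖ ∂ⱼ g⁽ⁿ⁾)`. -/
noncomputable def argFace (n : ℕ) (j : Fin (n + 2)) (g : G.Arg (n + 1)) : G.Arg n :=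
  fun k hk => faceMap j (g k (hk.trans n.le_succ))

/-- The cochain complex of an extended group: `n`-cochains are the functions
`∏_{k = 1}^n G_k^[n:k] → M`, with differential `∑ⱼ (-1)ʲ c (∂ⱼ g⁽¹⁾ ‖ ... ‖ ∂ⱼ g⁽ⁿ⁾)`. In degree `0`
these are the functions on a point, that is, the elements of `M`. -/
noncomputable def cochainComplex (M : Type v) [AddCommGroup M] :
    CochainComplex AddCommGrpCat.{max u v} ℕ :=
  functionCochainComplex (X := G.Arg) G.argFace M (fun n _ _ hij g => by
    funext k hk
    exact faceMap_comm (G.mul_comm k) hij _)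

/-- The differential out of degree `0` is trivial. -/
theorem altCoboundary_zero (M : Type v) [AddCommGroup M] :
    altCoboundary G.argFace M 0 = 0 := by
  ext c g
  have h : G.argFace 0 0 g = G.argFace 0 1 g := by
    funext k hk
    exact absurd k.pos (by omega)
  simp [altCoboundary, Fin.sum_univ_two, h]

/-- The cohomology `Hⁿ(G, M)` of an extended group. -/
noncomputable def cohomology (M : Type v) [AddCommGroup M] (n : ℕ) :
    AddCommGrpCat.{max u v} :=
  (G.cochainComplex M).homology n

/-- The product space `∏_{k ≥ 1} |𝒦(G_k, k)|`, with the product topology. -/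
noncomputable def productSpace : TopCat.{u} :=
  TopCat.of (∀ k : ℕ+, SSet.toTop.obj (simplicialK (G.carrier k) k (G.mul_comm k)))

end ExtendedGroup

/-! The `n`-cochains of `G` are the `M`-valued functions on the `n`-simplices of `P = ∏ₖ 𝒦(G_k, k)`,
because the factors with `k > n` have only one `n`-simplex. So `Hⁿ(G, M)` is the simplicial
cohomology of `P`. Maps into a product space are families of maps, so `Sing (∏ₖ |𝒦(G_k, k)|) = ∏ₖ
Sing |𝒦(G_k, k)|`; no cell structure on the product space is needed. What remains is that the
product of the units `𝒦(G_k, k) ⟶ Sing |𝒦(G_k, k)|` induces an isomorphism on cohomology.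

The units are treated in integral homology. (1) For every simplicial set `X` the unit `X ⟶ Sing |X|`
is a homology isomorphism (`SSet.homologyIso_unit`). (2) Homology isomorphisms are stable under
product with a fixed simplicial set (`SSet.homologyIso_whiskerRight`), hence under products in which
all but finitely many factors are isomorphisms (`SSet.homologyIso_piMap`). Where `G_k` is trivial,
`𝒦(G_k, k)` is a point and its unit is an isomorphism. (3) A quasi-isomorphism between nonnegatively
graded complexes of free modules is a homotopy equivalence, so it survives `Hom(-, M)`
(`SSet.nonempty_homology_cochains`).

Both (1) and (2) follow from one cellular induction, `SSet.homologyIso_app_of_stdSimplex`: a natural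
transformation between functors that respect coproducts, cell attachments (up to excision) and the
skeletal filtration is a homology isomorphism everywhere once it is one on all `Δ[d]`. On `Δ[d]`
contractibility settles the matter. For (2) the functors are `A ⊗ -` and `B ⊗ -`. For (1) they are
the identity and `Sing |-|`, and the work lies in `TopCat.isCellular_toTop`. Excision there rests on
barycentric subdivision (`TopCat.homologyIso_singularIn_sup`) and on a collar of `∂Δ[d]` that is
transported along disjoint unions and pushouts (`TopCat.Collar.excisive`); exhaustion by skeleta is
a compactness argument. -/

open Limits

/-! ### Integral chains of simplicial sets and homology isomorphisms. -/

/-- The free abelian group functor, with values in `ℤ`-modules. -/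
noncomputable def freeInt : Type u ⥤ ModuleCat.{u} ℤ where
  obj X := ModuleCat.of ℤ (X →₀ ℤ)
  map f := ModuleCat.ofHom (Finsupp.lmapDomain ℤ ℤ f)
  map_id _ := ModuleCat.hom_ext (Finsupp.lmapDomain_id ℤ ℤ)
  map_comp f g := ModuleCat.hom_ext (Finsupp.lmapDomain_comp ℤ ℤ f g)

lemma Finsupp.lift_single_one {R X M : Type*} [Semiring R] [AddCommMonoid M] [Module R M]
    (f : X → M) (x : X) : Finsupp.lift M R X f (Finsupp.single x 1) = f x := by
  simp [Finsupp.lift_apply]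

/-- The free functor is left adjoint to the forgetful functor. -/
noncomputable def freeIntAdj : freeInt.{u} ⊣ forget (ModuleCat.{u} ℤ) :=
  Adjunction.mkOfHomEquiv
    { homEquiv X M :=
        { toFun φ := ↾fun x => φ.hom (Finsupp.single x 1 : X →₀ ℤ)
          invFun ψ := ModuleCat.ofHom (Finsupp.lift M ℤ X ψ)
          left_inv φ := by
            apply ModuleCat.hom_ext
            refine Finsupp.lhom_ext' fun x => LinearMap.ext_ring ?_
            exact Finsupp.lift_single_one _ _
          right_inv ψ := by
            ext x
            exact Finsupp.lift_single_one _ _ }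
      homEquiv_naturality_left_symm {X Y M} f g := by
        apply ModuleCat.hom_ext
        refine Finsupp.lhom_ext' fun x => LinearMap.ext_ring ?_
        change Finsupp.lift M ℤ _ _ (Finsupp.single x 1) =
          Finsupp.lift M ℤ _ _ (Finsupp.mapDomain f (Finsupp.single x 1))
        rw [Finsupp.mapDomain_single, Finsupp.lift_single_one, Finsupp.lift_single_one]
        rfl
      homEquiv_naturality_right f g := rfl }

instance : PreservesColimitsOfSize.{0, 0} freeInt.{u} :=
  have := freeIntAdj.{u}.leftAdjoint_preservesColimits
  inferInstance

namespace SSet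

/-- The functor of integral simplicial chains. -/
noncomputable def freeChains : SSet.{u} ⥤ ChainComplex (ModuleCat.{u} ℤ) ℕ :=
  (SimplicialObject.whiskering _ _).obj freeInt ⋙
    AlgebraicTopology.alternatingFaceMapComplex _

/-- Chains are finitely supported functions. -/
noncomputable def chainsEquiv (X : SSet.{u}) (n : ℕ) :
    (freeChains.obj X).X n ≃ₗ[ℤ] (X _⦋n⦌ →₀ ℤ) :=
  LinearEquiv.refl _ _

/-- Projectivity is what finally turns quasi-isomorphisms of chains into homotopy equivalences,
which can be dualized. -/
instance (X : SSet.{u}) (n : ℕ) : Projective ((freeChains.obj X).X n) :=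
  ModuleCat.projective_of_free (Module.Basis.ofRepr (chainsEquiv X n))

instance {X Y : SSet.{u}} (f : X ⟶ Y) [Mono f] : Mono (freeChains.map f) := by
  have (n : ℕ) : Mono ((freeChains.map f).f n) := by
    have : Mono (f.app (op ⦋n⦌)) := inferInstance
    exact (ModuleCat.mono_iff_injective _).2
      (Finsupp.mapDomain_injective ((mono_iff_injective _).1 this))
  exact HomologicalComplex.mono_of_mono_f _ this

/-- Chains in a given degree. -/
noncomputable def freeChainsEval (n : ℕ) :
    freeChains.{u} ⋙ HomologicalComplex.eval _ _ n ≅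
      (evaluation _ _).obj (op ⦋n⦌) ⋙ freeInt :=
  NatIso.ofComponents (fun _ => Iso.refl _)

/-- Colimits of simplicial sets and of complexes are both computed degreewise, and in each degree
the free functor is a left adjoint. -/
instance : PreservesColimitsOfShape WalkingSpan freeChains.{u} :=
  HomologicalComplex.preservesColimitsOfShape_of_eval _ fun n =>
    preservesColimitsOfShape_of_natIso (freeChainsEval n).symm

/-- The boundary map on finitely supported functions. -/
noncomputable def boundaryLin (X : SSet.{u}) (n : ℕ) : (X _⦋n + 1⦌ →₀ ℤ) →ₗ[ℤ] (X _⦋n⦌ →₀ ℤ) :=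
  ∑ i : Fin (n + 2), (-1 : ℤ) ^ (i : ℕ) • Finsupp.lmapDomain ℤ ℤ (X.δ i)

lemma freeChains_d (X : SSet.{u}) (n : ℕ) :
    (freeChains.obj X).d (n + 1) n =
      (ModuleCat.ofHom (boundaryLin X n) : freeInt.obj (X _⦋n + 1⦌) ⟶ freeInt.obj (X _⦋n⦌)) := by
  refine (AlgebraicTopology.AlternatingFaceMapComplex.obj_d_eq _ n).trans ?_
  apply ModuleCat.hom_ext
  exact (ModuleCat.hom_sum _ _).trans (Finset.sum_congr rfl fun i _ => ModuleCat.hom_zsmul _ _)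

lemma boundaryLin_single (X : SSet.{u}) {n : ℕ} (x : X _⦋n + 1⦌) :
    boundaryLin X n (Finsupp.single x 1) =
      ∑ i : Fin (n + 2), (-1 : ℤ) ^ (i : ℕ) • Finsupp.single (X.δ i x) 1 := by
  simp only [boundaryLin, LinearMap.sum_apply, LinearMap.smul_apply, Finsupp.lmapDomain_apply,
    Finsupp.mapDomain_single]

lemma chainsEquiv_d (X : SSet.{u}) (n : ℕ) (c : (freeChains.obj X).X (n + 1)) :
    chainsEquiv X n ((freeChains.obj X).d (n + 1) n c) =
      boundaryLin X n (chainsEquiv X (n + 1) c) := by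
  rw [freeChains_d]; rfl

/-- Maps of simplicial sets that induce isomorphisms on integral homology. -/
def homologyIso : MorphismProperty SSet.{u} :=
  (HomologicalComplex.quasiIso (ModuleCat.{u} ℤ) (ComplexShape.down ℕ)).inverseImage freeChains

instance : homologyIso.{u}.HasTwoOutOfThreeProperty := by
  unfold homologyIso; infer_instance

instance : homologyIso.{u}.RespectsIso := by
  unfold homologyIso; infer_instance

lemma homologyIso_iff {X Y : SSet.{u}} (f : X ⟶ Y) :
    homologyIso f ↔ QuasiIso (freeChains.map f) := Iff.rfl

lemma homologyIso_of_isIso {X Y : SSet.{u}} (f : X ⟶ Y) [IsIso f] : homologyIso f := by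
  rw [homologyIso_iff]; infer_instance

/-- Homotopic maps induce homotopic maps on chains. -/
noncomputable def freeChainsHomotopy {X Y : SSet.{u}} {f g : X ⟶ Y} (H : SSet.Homotopy f g) :
    _root_.Homotopy (freeChains.map f) (freeChains.map g) :=
  (H.toSimplicialObjectHomotopy.whiskerRight freeInt).toChainHomotopy

lemma homologyIso_of_homotopy {X Y : SSet.{u}} {f : X ⟶ Y} {g : Y ⟶ X}
    (H : SSet.Homotopy (f ≫ g) (𝟙 X)) (H' : SSet.Homotopy (g ≫ f) (𝟙 Y)) : homologyIso f := by
  let e : HomotopyEquiv (freeChains.obj X) (freeChains.obj Y) :=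
    { hom := freeChains.map f
      inv := freeChains.map g
      homotopyHomInvId := (Homotopy.ofEq (by simp)).trans
        ((freeChainsHomotopy H).trans (Homotopy.ofEq (by simp)))
      homotopyInvHomId := (Homotopy.ofEq (by simp)).trans
        ((freeChainsHomotopy H').trans (Homotopy.ofEq (by simp))) }
  exact e.quasiIso_hom

end SSet

/-! ### Quasi-isomorphisms of complexes of modules in terms of elements. -/

namespace HomologicalComplex

variable {R : Type*} [Ring R] {ι : Type*} {c : ComplexShape ι}
  {K L : HomologicalComplex (ModuleCat.{v} R) c}

lemma exists_cycle (K : HomologicalComplex (ModuleCat.{v} R) c) {i : ι} (x : K.X i)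
    (hx : ∀ j, K.d i j x = 0) : ∃ z : K.cycles i, K.iCycles i z = x := by
  have h : (ShortComplex.mk (K.iCycles i) (K.d i (c.next i)) (by simp)).Exact :=
    ShortComplex.exact_of_f_is_kernel _ (K.cyclesIsKernel i _ rfl)
  exact (ShortComplex.moduleCat_exact_iff _).1 h x (hx _)

lemma d_iCycles_apply (K : HomologicalComplex (ModuleCat.{v} R) c) {i : ι} (z : K.cycles i)
    (j : ι) : K.d i j (K.iCycles i z) = 0 := by
  rw [← ConcreteCategory.comp_apply, K.iCycles_d]
  rfl

lemma homologyπ_eq_zero_iff (K : HomologicalComplex (ModuleCat.{v} R) c) {h i : ι}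
    (hi : c.prev i = h) (z : K.cycles i) :
    K.homologyπ i z = 0 ↔ ∃ y : K.X h, K.d h i y = K.iCycles i z := by
  have h : (ShortComplex.mk (K.toCycles h i) (K.homologyπ i) (by simp)).Exact :=
    ShortComplex.exact_of_g_is_cokernel _ (K.homologyIsCokernel h i hi)
  have hinj : Function.Injective (K.iCycles i) := (ModuleCat.mono_iff_injective _).1 inferInstance
  constructor
  · intro hz
    obtain ⟨y, hy⟩ := (ShortComplex.moduleCat_exact_iff _).1 h z hz
    refine ⟨y, ?_⟩
    rw [← hy, ← ConcreteCategory.comp_apply]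
    simp
  · rintro ⟨y, hy⟩
    have : z = K.toCycles _ i y := hinj (by
      rw [← hy, ← ConcreteCategory.comp_apply]
      simp)
    rw [this, ← ConcreteCategory.comp_apply, toCycles_comp_homologyπ]
    rfl

lemma homologyπ_surjective (K : HomologicalComplex (ModuleCat.{v} R) c) (i : ι) :
    Function.Surjective (K.homologyπ i) :=
  (ModuleCat.epi_iff_surjective _).1 inferInstance

/-- Elementwise description of quasi-isomorphisms of complexes of modules. -/
lemma quasiIsoAt_iff_elementwise (f : K ⟶ L) {h i : ι} (hi : c.prev i = h) :
    QuasiIsoAt f i ↔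
      (∀ x : K.X i, (∀ j, K.d i j x = 0) → ∀ y : L.X h, L.d h i y = f.f i x →
        ∃ w : K.X h, K.d h i w = x) ∧
      (∀ y : L.X i, (∀ j, L.d i j y = 0) → ∃ x : K.X i, (∀ j, K.d i j x = 0) ∧
        ∃ w : L.X h, L.d h i w = y - f.f i x) := by
  have hinj : Function.Injective (L.iCycles i) := (ModuleCat.mono_iff_injective _).1 inferInstance
  have hcyc (z : K.cycles i) : L.iCycles i (cyclesMap f i z) = f.f i (K.iCycles i z) := by
    rw [← ConcreteCategory.comp_apply, ← ConcreteCategory.comp_apply, cyclesMap_i]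
  have hhom (z : K.cycles i) :
      homologyMap f i (K.homologyπ i z) = L.homologyπ i (cyclesMap f i z) := by
    rw [← ConcreteCategory.comp_apply, ← ConcreteCategory.comp_apply, homologyπ_naturality]
  rw [quasiIsoAt_iff_isIso_homologyMap, ConcreteCategory.isIso_iff_bijective]
  refine and_congr ⟨fun H x hx y hy => ?_, fun H => ?_⟩ ⟨fun H y hy => ?_, fun H => ?_⟩
  · obtain ⟨z, rfl⟩ := K.exists_cycle x hx
    refine (K.homologyπ_eq_zero_iff hi z).1 (H ?_)
    rw [hhom, map_zero, homologyπ_eq_zero_iff _ hi]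
    exact ⟨y, by rw [hy, hcyc]⟩
  · refine (injective_iff_map_eq_zero (homologyMap f i).hom).2 fun x hx => ?_
    obtain ⟨z, rfl⟩ := K.homologyπ_surjective i x
    have hx' : L.homologyπ i (cyclesMap f i z) = 0 := (hhom z).symm.trans hx
    obtain ⟨y, hy⟩ := (L.homologyπ_eq_zero_iff hi _).1 hx'
    exact (K.homologyπ_eq_zero_iff hi z).2
      (H _ (K.d_iCycles_apply z) y (hy.trans (hcyc z)))
  · obtain ⟨z, rfl⟩ := L.exists_cycle y hy
    obtain ⟨x, hx⟩ := H (L.homologyπ i z)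
    obtain ⟨z', rfl⟩ := K.homologyπ_surjective i x
    refine ⟨K.iCycles i z', K.d_iCycles_apply z', ?_⟩
    rw [hhom] at hx
    obtain ⟨w, hw⟩ := (L.homologyπ_eq_zero_iff hi (z - cyclesMap f i z')).1
      (by rw [map_sub, hx, sub_self])
    exact ⟨w, by rw [hw, map_sub, hcyc]⟩
  · intro y
    obtain ⟨z, rfl⟩ := L.homologyπ_surjective i y
    obtain ⟨x, hx, w, hw⟩ := H _ (L.d_iCycles_apply z)
    obtain ⟨z', rfl⟩ := K.exists_cycle x hx
    refine ⟨K.homologyπ i z', ?_⟩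
    rw [hhom]
    have := (L.homologyπ_eq_zero_iff hi (z - cyclesMap f i z')).2
      ⟨w, by rw [hw, map_sub, hcyc]⟩
    rw [map_sub, sub_eq_zero] at this
    exact this.symm

end HomologicalComplex

/-! ### Five lemmas for short exact sequences of chain complexes. -/

namespace CategoryTheory

variable {C : Type*} [Category C] [Abelian C]

-- The two four lemmas, applied to segments of the long exact homology sequence, give injectivity
-- and surjectivity separately.
open HomologicalComplex in
lemma quasiIso_τ₂_of_shortExact {S₁ S₂ : ShortComplex (ChainComplex C ℕ)} (φ : S₁ ⟶ S₂)
    (h₁ : S₁.ShortExact) (h₂ : S₂.ShortExact) (ha : QuasiIso φ.τ₁) (hc : QuasiIso φ.τ₃) :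
    QuasiIso φ.τ₂ := by
  have w₁₂ (i : ℕ) : homologyMap S₁.f i ≫ homologyMap φ.τ₂ i =
      homologyMap φ.τ₁ i ≫ homologyMap S₂.f i := by
    simp only [← homologyMap_comp, φ.comm₁₂]
  have w₂₃ (i : ℕ) : homologyMap S₁.g i ≫ homologyMap φ.τ₃ i =
      homologyMap φ.τ₂ i ≫ homologyMap S₂.g i := by
    simp only [← homologyMap_comp, φ.comm₂₃]
  rw [quasiIso_iff]
  intro i
  rw [quasiIsoAt_iff_isIso_homologyMap]
  have hm : Mono (homologyMap φ.τ₂ i) := by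
    let R (S : ShortComplex (ChainComplex C ℕ)) (h : S.ShortExact) : ComposableArrows C 3 :=
      ComposableArrows.mk₃ (h.δ (i + 1) i rfl) (homologyMap S.f i) (homologyMap S.g i)
    have hR (S : ShortComplex (ChainComplex C ℕ)) (h : S.ShortExact) : (R S h).Exact :=
      ComposableArrows.exact_of_δ₀ (h.homology_exact₁ (i + 1) i rfl).exact_toComposableArrows
        (h.homology_exact₂ i).exact_toComposableArrows
    let ψ : R S₁ h₁ ⟶ R S₂ h₂ := ComposableArrows.homMk₃ (homologyMap φ.τ₃ (i + 1))
      (homologyMap φ.τ₁ i) (homologyMap φ.τ₂ i) (homologyMap φ.τ₃ i)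
      (HomologySequence.δ_naturality φ h₁ h₂ _ _ rfl) (w₁₂ i) (w₂₃ i)
    exact Abelian.mono_of_epi_of_mono_of_mono ψ (hR _ _) (hR _ _)
      (inferInstanceAs (Epi (homologyMap φ.τ₃ (i + 1))))
      (inferInstanceAs (Mono (homologyMap φ.τ₁ i)))
      (inferInstanceAs (Mono (homologyMap φ.τ₃ i)))
  have he : Epi (homologyMap φ.τ₂ i) := by
    -- In degree zero no connecting map leaves the homology of the quotient; surjectivity of `S₁.g`
    -- on `H₀` takes its place.
    obtain _ | j := i
    · have := h₁.epi_g
      have := epi_homologyMap_of_epi_of_not_rel S₁.g 0 (by simp)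
      let R (S : ShortComplex (ChainComplex C ℕ)) : ShortComplex C :=
        ShortComplex.mk (homologyMap S.f 0) (homologyMap S.g 0)
          ((homologyMap_comp _ _ _).symm.trans
            ((congrArg (homologyMap · 0) S.zero).trans (homologyMap_zero _ _ _)))
      let ψ : R S₁ ⟶ R S₂ := ShortComplex.Hom.mk (homologyMap φ.τ₁ 0) (homologyMap φ.τ₂ 0)
        (homologyMap φ.τ₃ 0) (w₁₂ 0).symm (w₂₃ 0).symm
      exact ShortComplex.epi_of_epi_of_epi_of_epi ψ (h₂.homology_exact₂ 0) this
        (inferInstanceAs (Epi (homologyMap φ.τ₁ 0))) (inferInstanceAs (Epi (homologyMap φ.τ₃ 0)))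
    · let R (S : ShortComplex (ChainComplex C ℕ)) (h : S.ShortExact) : ComposableArrows C 3 :=
        ComposableArrows.mk₃ (homologyMap S.f (j + 1)) (homologyMap S.g (j + 1))
          (h.δ (j + 1) j rfl)
      have hR (S : ShortComplex (ChainComplex C ℕ)) (h : S.ShortExact) : (R S h).Exact :=
        ComposableArrows.exact_of_δ₀ (h.homology_exact₂ (j + 1)).exact_toComposableArrows
          (h.homology_exact₃ (j + 1) j rfl).exact_toComposableArrows
      let ψ : R S₁ h₁ ⟶ R S₂ h₂ := ComposableArrows.homMk₃ (homologyMap φ.τ₁ (j + 1))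
        (homologyMap φ.τ₂ (j + 1)) (homologyMap φ.τ₃ (j + 1)) (homologyMap φ.τ₁ j)
        (w₁₂ _) (w₂₃ _) (HomologySequence.δ_naturality φ h₁ h₂ _ _ rfl)
      exact Abelian.epi_of_epi_of_epi_of_mono ψ (hR _ _) (hR _ _)
        (inferInstanceAs (Epi (homologyMap φ.τ₁ (j + 1))))
        (inferInstanceAs (Epi (homologyMap φ.τ₃ (j + 1))))
        (inferInstanceAs (Mono (homologyMap φ.τ₁ j)))
  exact isIso_of_mono_of_epi _

/-- A map between monomorphisms of complexes that is a quasi-isomorphism on sources and on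
cokernels is a quasi-isomorphism on targets. -/
lemma quasiIso_of_cokernel {A B A' B' : ChainComplex C ℕ} {i : A ⟶ B} {i' : A' ⟶ B'}
    [Mono i] [Mono i'] (a : A ⟶ A') (b : B ⟶ B') (w : i ≫ b = a ≫ i') (ha : QuasiIso a)
    (hq : QuasiIso (cokernel.map i i' a b w)) : QuasiIso b := by
  let S₁ := ShortComplex.mk i (cokernel.π i) (by simp)
  let S₂ := ShortComplex.mk i' (cokernel.π i') (by simp)
  have h₁ : S₁.ShortExact := { exact := ShortComplex.exact_of_g_is_cokernel _ (cokernelIsCokernel i) }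
  have h₂ : S₂.ShortExact := { exact := ShortComplex.exact_of_g_is_cokernel _ (cokernelIsCokernel i') }
  exact quasiIso_τ₂_of_shortExact
    (ShortComplex.Hom.mk a b (cokernel.map i i' a b w) w.symm (by simp [S₁, S₂]) : S₁ ⟶ S₂)
    h₁ h₂ ha hq

/-- A map between monomorphisms of complexes that is a quasi-isomorphism on sources and on
targets is a quasi-isomorphism on cokernels. -/
lemma quasiIso_cokernel {A B A' B' : ChainComplex C ℕ} {i : A ⟶ B} {i' : A' ⟶ B'}
    [Mono i] [Mono i'] (a : A ⟶ A') (b : B ⟶ B') (w : i ≫ b = a ≫ i') (ha : QuasiIso a)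
    (hb : QuasiIso b) : QuasiIso (cokernel.map i i' a b w) := by
  let S₁ := ShortComplex.mk i (cokernel.π i) (by simp)
  let S₂ := ShortComplex.mk i' (cokernel.π i') (by simp)
  have h₁ : S₁.ShortExact := { exact := ShortComplex.exact_of_g_is_cokernel _ (cokernelIsCokernel i) }
  have h₂ : S₂.ShortExact := { exact := ShortComplex.exact_of_g_is_cokernel _ (cokernelIsCokernel i') }
  exact HomologicalComplex.HomologySequence.quasiIso_τ₃
    (ShortComplex.Hom.mk a b (cokernel.map i i' a b w) w.symm (by simp [S₁, S₂]) : S₁ ⟶ S₂) h₁ h₂ ha hb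

end CategoryTheory
-- Relative homology, excisive squares and gluing.
namespace SSet

variable {A B X Y : SSet.{u}} {t : A ⟶ X} {l : A ⟶ B} {r : X ⟶ Y} {b : B ⟶ Y}

/-- The map induced on relative chains by a commutative square. -/
noncomputable def relMap (sq : CommSq t l r b) :
    cokernel (freeChains.map l) ⟶ cokernel (freeChains.map r) :=
  cokernel.map _ _ (freeChains.map t) (freeChains.map b)
    (by rw [← freeChains.map_comp, ← freeChains.map_comp, sq.w])

/-- A commutative square is excisive if it induces an isomorphism between the relative homology
of its vertical maps. -/
def Excisive (sq : CommSq t l r b) : Prop := QuasiIso (relMap sq)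

lemma relMap_comp {X' Y' : SSet.{u}} {t' : X ⟶ X'} {r' : X' ⟶ Y'} {b' : Y ⟶ Y'}
    (sq : CommSq t l r b) (sq' : CommSq t' r r' b') :
    relMap sq ≫ relMap sq' = relMap (sq.horiz_comp sq') := by
  rw [← cancel_epi (cokernel.π _)]
  simp [relMap]

section

variable {X' Y' : SSet.{u}} {t' : X ⟶ X'} {r' : X' ⟶ Y'} {b' : Y ⟶ Y'}
    {sq : CommSq t l r b} {sq' : CommSq t' r r' b'}

lemma excisive_comp (h : Excisive sq) (h' : Excisive sq') : Excisive (sq.horiz_comp sq') := by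
  have : QuasiIso (relMap sq) := h
  have : QuasiIso (relMap sq') := h'
  unfold Excisive
  rw [← relMap_comp sq sq']
  infer_instance

lemma excisive_of_comp_left (h : Excisive sq) (h' : Excisive (sq.horiz_comp sq')) :
    Excisive sq' := by
  have : QuasiIso (relMap sq) := h
  have : QuasiIso (relMap sq ≫ relMap sq') := by rwa [relMap_comp]
  exact quasiIso_of_comp_left (relMap sq) (relMap sq')

lemma excisive_of_comp_right (h : Excisive sq') (h' : Excisive (sq.horiz_comp sq')) :
    Excisive sq := by
  have : QuasiIso (relMap sq') := h
  have : QuasiIso (relMap sq ≫ relMap sq') := by rwa [relMap_comp]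
  exact quasiIso_of_comp_right (relMap sq) (relMap sq')

end

lemma Excisive.congr {t₁ : A ⟶ X} {b₁ : B ⟶ Y} {sq : CommSq t l r b} (h : Excisive sq)
    (sq₁ : CommSq t₁ l r b₁) (ht : t = t₁) (hb : b = b₁) : Excisive sq₁ := by
  subst ht hb
  exact h

/-- Chains preserve pushouts, and parallel maps in a pushout square have isomorphic cokernels. -/
lemma excisive_of_isPushout (sq : IsPushout t l r b) : Excisive sq.toCommSq := by
  have := isIso_cokernel_map_of_isPushout (sq.flip.map freeChains)
  unfold Excisive relMap
  infer_instance

lemma excisive_of_homologyIso [Mono l] [Mono r] (sq : CommSq t l r b) (ht : homologyIso t)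
    (hb : homologyIso b) : Excisive sq :=
  quasiIso_cokernel _ _ (sq.map freeChains).w.symm ht hb

lemma homologyIso_of_excisive [Mono l] [Mono r] {sq : CommSq t l r b} (h : Excisive sq)
    (ht : homologyIso t) : homologyIso b :=
  quasiIso_of_cokernel _ _ (sq.map freeChains).w.symm ht h

/-- The gluing lemma. -/
lemma homologyIso_of_cube [Mono l] [Mono r] {A' B' X' Y' : SSet.{u}} {t' : A' ⟶ X'} {l' : A' ⟶ B'}
    {r' : X' ⟶ Y'} {b' : B' ⟶ Y'} [Mono l'] [Mono r'] {sq : CommSq t l r b}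
    {sq' : CommSq t' l' r' b'} (h : Excisive sq) (h' : Excisive sq') {fA : A ⟶ A'} {fB : B ⟶ B'}
    {fX : X ⟶ X'} {fY : Y ⟶ Y'} (wl : CommSq fA l l' fB) (wr : CommSq fX r r' fY)
    (wt : t ≫ fX = fA ≫ t') (wb : b ≫ fY = fB ≫ b')
    (hA : homologyIso fA) (hB : homologyIso fB) (hX : homologyIso fX) : homologyIso fY := by
  -- The composite of `sq` and `wr` equals the composite of `wl` and `sq'`. The latter is excisive,
  -- so cancelling `sq` makes `wr` excisive.
  refine homologyIso_of_excisive (sq := wr) (excisive_of_comp_left h ?_) hX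
  exact (excisive_comp (excisive_of_homologyIso wl hA hB) h').congr _ wt.symm wb.symm

end SSet

/-! ### Homology of increasing unions and of disjoint unions. -/

namespace SSet

/-- Elementwise criterion for homology isomorphisms. -/
lemma homologyIso_iff_elementwise {X Y : SSet.{u}} (f : X ⟶ Y) :
    homologyIso f ↔ ∀ n,
      (∀ x : (freeChains.obj X).X n, (∀ j, (freeChains.obj X).d n j x = 0) →
        ∀ y, (freeChains.obj Y).d (n + 1) n y = (freeChains.map f).f n x →
        ∃ w, (freeChains.obj X).d (n + 1) n w = x) ∧
      (∀ y : (freeChains.obj Y).X n, (∀ j, (freeChains.obj Y).d n j y = 0) →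
        ∃ x, (∀ j, (freeChains.obj X).d n j x = 0) ∧
        ∃ w, (freeChains.obj Y).d (n + 1) n w = y - (freeChains.map f).f n x) := by
  rw [homologyIso_iff, quasiIso_iff]
  exact forall_congr' fun n => HomologicalComplex.quasiIsoAt_iff_elementwise _ (by simp)

lemma freeChains_map_d {X Y : SSet.{u}} (f : X ⟶ Y) (i j : ℕ) (x : (freeChains.obj X).X i) :
    (freeChains.map f).f j ((freeChains.obj X).d i j x) =
      (freeChains.obj Y).d i j ((freeChains.map f).f i x) := by
  rw [← ConcreteCategory.comp_apply, ← ConcreteCategory.comp_apply, HomologicalComplex.Hom.comm]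

lemma freeChains_map_comp_apply {X Y Z : SSet.{u}} (f : X ⟶ Y) (g : Y ⟶ Z) (n : ℕ)
    (x : (freeChains.obj X).X n) :
    (freeChains.map (f ≫ g)).f n x = (freeChains.map g).f n ((freeChains.map f).f n x) := by
  rw [freeChains.map_comp]; rfl

lemma freeChains_map_injective {X Y : SSet.{u}} (f : X ⟶ Y) [Mono f] (n : ℕ) :
    Function.Injective ((freeChains.map f).f n) :=
  Finsupp.mapDomain_injective ((mono_iff_injective (f.app (op ⦋n⦌))).1 inferInstance)

section filtration

/-- `X` is the increasing union of the images of the monomorphisms `i d : F d ⟶ X`. -/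
structure IsFiltration {X : SSet.{u}} {F : ℕ → SSet.{u}} (i : ∀ d, F d ⟶ X) : Prop where
  mono : ∀ d, Mono (i d)
  succ : ∀ d, ∃ j : F d ⟶ F (d + 1), j ≫ i (d + 1) = i d
  exists_simplex : ∀ n (x : X _⦋n⦌), ∃ d y, (i d).app _ y = x

variable {X Y : SSet.{u}} {F G : ℕ → SSet.{u}} {i : ∀ d, F d ⟶ X} {k : ∀ d, G d ⟶ Y}

lemma IsFiltration.exists_le (h : IsFiltration i) {d e : ℕ} (hde : d ≤ e) :
    ∃ j : F d ⟶ F e, j ≫ i e = i d := by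
  induction e, hde using Nat.le_induction with
  | base => exact ⟨𝟙 _, Category.id_comp _⟩
  | succ e _ ih =>
    obtain ⟨j, hj⟩ := ih
    obtain ⟨j', hj'⟩ := h.succ e
    exact ⟨j ≫ j', by rw [Category.assoc, hj', hj]⟩

lemma IsFiltration.exists_chain_le (h : IsFiltration i) {n : ℕ} {d e : ℕ} (hde : d ≤ e)
    {x : (freeChains.obj X).X n} (hx : ∃ y, (freeChains.map (i d)).f n y = x) :
    ∃ y, (freeChains.map (i e)).f n y = x := by
  obtain ⟨y, rfl⟩ := hx
  obtain ⟨j, hj⟩ := h.exists_le hde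
  exact ⟨(freeChains.map j).f n y, by rw [← freeChains_map_comp_apply, hj]⟩

lemma IsFiltration.exists_chain (h : IsFiltration i) {n : ℕ} (x : (freeChains.obj X).X n) :
    ∃ d y, (freeChains.map (i d)).f n y = x := by
  refine Finsupp.induction_linear
    (motive := fun x : (X _⦋n⦌ →₀ ℤ) => ∃ d y, (freeChains.map (i d)).f n y = x) x
    ⟨0, 0, map_zero _⟩ ?_ ?_
  · rintro _ _ ⟨d, hx⟩ ⟨e, hy⟩
    obtain ⟨x, rfl⟩ := h.exists_chain_le (le_max_left d e) hx
    obtain ⟨y, rfl⟩ := h.exists_chain_le (le_max_right d e) hy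
    exact ⟨_, x + y, map_add _ _ _⟩
  · intro x m
    obtain ⟨d, y, rfl⟩ := h.exists_simplex n x
    exact ⟨d, (chainsEquiv _ n).symm (Finsupp.single y m), Finsupp.mapDomain_single⟩

/-- A map that is a homology isomorphism on each step of a filtration is a homology
isomorphism. -/
lemma IsFiltration.homologyIso (hi : IsFiltration i) (hk : IsFiltration k) {f : X ⟶ Y}
    {g : ∀ d, F d ⟶ G d} (w : ∀ d, i d ≫ f = g d ≫ k d) (hg : ∀ d, homologyIso (g d)) :
    homologyIso f := by
  have hw (d n : ℕ) (x : (freeChains.obj (F d)).X n) : (freeChains.map f).f n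
      ((freeChains.map (i d)).f n x) = (freeChains.map (k d)).f n ((freeChains.map (g d)).f n x) := by
    rw [← freeChains_map_comp_apply, w, freeChains_map_comp_apply]
  have ii (d n : ℕ) := have := hi.mono d; freeChains_map_injective (i d) n
  have ik (d n : ℕ) := have := hk.mono d; freeChains_map_injective (k d) n
  rw [homologyIso_iff_elementwise]
  intro n
  constructor
  · intro x hx y hy
    obtain ⟨d, hx'⟩ := hi.exists_chain x
    obtain ⟨e, hy'⟩ := hk.exists_chain y
    obtain ⟨x, rfl⟩ := hi.exists_chain_le (le_max_left d e) hx'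
    obtain ⟨y, rfl⟩ := hk.exists_chain_le (le_max_right d e) hy'
    -- The cycle and the chain that bounds its image are moved to a common stage; injectivity of
    -- chains of the stages into chains of the unions carries both equations there.
    obtain ⟨v, hv⟩ := (((homologyIso_iff_elementwise _).1 (hg (max d e))) n).1 x
      (fun j => ii _ _ (by rw [freeChains_map_d, hx, map_zero])) y
      (ik _ _ (by rw [freeChains_map_d, hy, hw]))
    exact ⟨(freeChains.map (i _)).f _ v, by rw [← freeChains_map_d, hv]⟩
  · intro y hy
    obtain ⟨d, y, rfl⟩ := hk.exists_chain y
    obtain ⟨x, hx, v, hv⟩ := (((homologyIso_iff_elementwise _).1 (hg d)) n).2 y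
      (fun j => ik _ _ (by rw [freeChains_map_d, hy, map_zero]))
    refine ⟨(freeChains.map (i d)).f n x, fun j => ?_, (freeChains.map (k d)).f _ v, ?_⟩
    · rw [← freeChains_map_d, hx, map_zero]
    · rw [← freeChains_map_d, hv, map_sub, hw]

end filtration

section coproduct

/-- `X` is the disjoint union of the images of the maps `i a : F a ⟶ X`, which are
monomorphisms. -/
def IsDisjointUnion {I : Type*} {X : SSet.{u}} {F : I → SSet.{u}} (i : ∀ a, F a ⟶ X) : Prop :=
  ∀ n, Function.Bijective fun p : (Σ a, F a _⦋n⦌) => (i p.1).app _ p.2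

variable {I : Type*} {X Y : SSet.{u}} {F G : I → SSet.{u}} {i : ∀ a, F a ⟶ X} {k : ∀ a, G a ⟶ Y}

lemma IsDisjointUnion.injective (h : IsDisjointUnion i) (a : I) (n : ℕ) :
    Function.Injective ((i a).app (op ⦋n⦌)) := fun x y hxy => by
  simpa using (h n).1 (a₁ := ⟨a, x⟩) (a₂ := ⟨a, y⟩) hxy

/-- The projection of chains of a disjoint union to the chains of a summand. -/
noncomputable def IsDisjointUnion.proj (h : IsDisjointUnion i) (a : I) (n : ℕ) :
    (X _⦋n⦌ →₀ ℤ) →ₗ[ℤ] (F a _⦋n⦌ →₀ ℤ) :=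
  Finsupp.lcomapDomain ((i a).app (op ⦋n⦌)) (h.injective a n)

lemma IsDisjointUnion.proj_single_same (h : IsDisjointUnion i) (a : I) (n : ℕ) (x : F a _⦋n⦌)
    (m : ℤ) : h.proj a n (Finsupp.single ((i a).app _ x) m) = Finsupp.single x m := by
  ext y
  classical
  simp [proj, Finsupp.single_apply]

lemma IsDisjointUnion.proj_single_of_ne (h : IsDisjointUnion i) {a b : I} (hab : a ≠ b) (n : ℕ)
    (x : F b _⦋n⦌) (m : ℤ) : h.proj a n (Finsupp.single ((i b).app _ x) m) = 0 := by
  ext y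
  classical
  simp only [proj, Finsupp.lcomapDomain_apply, Finsupp.comapDomain_apply, Finsupp.single_apply,
    Finsupp.coe_zero, Pi.zero_apply, ite_eq_right_iff]
  intro hy
  exact absurd (congrArg Sigma.fst ((h n).1 (a₁ := ⟨b, x⟩) (a₂ := ⟨a, y⟩) hy)).symm hab

lemma IsDisjointUnion.lhom_ext (h : IsDisjointUnion i) {n : ℕ} {M : Type*} [AddCommGroup M]
    {φ ψ : (X _⦋n⦌ →₀ ℤ) →ₗ[ℤ] M}
    (H : ∀ a (x : F a _⦋n⦌), φ (Finsupp.single ((i a).app _ x) 1) =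
      ψ (Finsupp.single ((i a).app _ x) 1)) : φ = ψ := by
  refine Finsupp.lhom_ext' fun x => LinearMap.ext_ring ?_
  obtain ⟨⟨a, x⟩, rfl⟩ := (h n).2 x
  exact H a x

lemma IsDisjointUnion.proj_d (h : IsDisjointUnion i) (a : I) (n : ℕ) (x : X _⦋n + 1⦌ →₀ ℤ) :
    h.proj a n (boundaryLin X n x) = boundaryLin (F a) n (h.proj a (n + 1) x) := by
  refine LinearMap.congr_fun (f := h.proj a n ∘ₗ boundaryLin X n)
    (g := boundaryLin (F a) n ∘ₗ h.proj a (n + 1)) (h.lhom_ext fun b x => ?_) x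
  have hδ (j : Fin (n + 2)) : X.δ j ((i b).app _ x) = (i b).app _ ((F b).δ j x) :=
    (ConcreteCategory.congr_hom (SimplicialObject.δ_naturality (i b) j) x).symm
  simp only [LinearMap.comp_apply, boundaryLin_single, map_sum, map_smul, hδ]
  by_cases hab : a = b
  · subst hab
    simp only [h.proj_single_same, boundaryLin_single]
  · simp only [h.proj_single_of_ne hab, smul_zero, Finset.sum_const_zero, map_zero]

lemma IsDisjointUnion.exists_sum (h : IsDisjointUnion i) (n : ℕ) (x : X _⦋n⦌ →₀ ℤ) :
    ∃ s : Finset I, ∑ a ∈ s, (h.proj a n x).mapDomain ((i a).app (op ⦋n⦌)) = x := by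
  classical
  let e := Equiv.ofBijective _ (h n)
  have key (y : X _⦋n⦌) (m : ℤ) (s : Finset I) (hs : (e.symm y).1 ∈ s) :
      ∑ a ∈ s, (h.proj a n (Finsupp.single y m)).mapDomain ((i a).app (op ⦋n⦌)) =
        Finsupp.single y m := by
    obtain ⟨⟨b, z⟩, rfl⟩ := e.surjective y
    rw [e.symm_apply_apply] at hs
    rw [Finset.sum_eq_single b]
    · exact (congrArg _ (h.proj_single_same b n z m)).trans Finsupp.mapDomain_single
    · intro a _ hab
      exact (congrArg _ (h.proj_single_of_ne hab n z m)).trans Finsupp.mapDomain_zero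
    · exact fun hb => absurd hs hb
  refine ⟨x.support.image fun y => (e.symm y).1, ?_⟩
  conv_rhs => rw [← Finsupp.sum_single x, Finsupp.sum]
  conv_lhs =>
    enter [2, a]
    rw [← Finsupp.sum_single x, Finsupp.sum, map_sum, Finsupp.mapDomain_finsetSum]
  rw [Finset.sum_comm]
  exact Finset.sum_congr rfl fun y hy => key y _ _ (Finset.mem_image_of_mem _ hy)

/-- The projection of chains of a disjoint union to the chains of a summand. -/
noncomputable def IsDisjointUnion.chainProj (h : IsDisjointUnion i) (a : I) (n : ℕ) :
    (freeChains.obj X).X n →ₗ[ℤ] (freeChains.obj (F a)).X n :=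
  (chainsEquiv _ n).symm.toLinearMap ∘ₗ h.proj a n ∘ₗ (chainsEquiv _ n).toLinearMap

lemma IsDisjointUnion.chainProj_d (h : IsDisjointUnion i) (a : I) (n m : ℕ)
    (x : (freeChains.obj X).X n) : h.chainProj a m ((freeChains.obj X).d n m x) =
      (freeChains.obj (F a)).d n m (h.chainProj a n x) := by
  by_cases hnm : m + 1 = n
  · subst hnm
    apply (chainsEquiv (F a) m).injective
    rw [chainsEquiv_d]
    exact (congrArg (h.proj a m) (chainsEquiv_d X m x)).trans (h.proj_d a m _)
  · rw [HomologicalComplex.shape _ _ _ hnm, HomologicalComplex.shape _ _ _ hnm]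
    exact map_zero (h.chainProj a m)

lemma IsDisjointUnion.exists_chain_sum (h : IsDisjointUnion i) (n : ℕ)
    (x : (freeChains.obj X).X n) :
    ∃ s : Finset I, ∑ a ∈ s, (freeChains.map (i a)).f n (h.chainProj a n x) = x :=
  h.exists_sum n x

lemma IsDisjointUnion.chainProj_map (hi : IsDisjointUnion i) (hk : IsDisjointUnion k) {f : X ⟶ Y}
    {g : ∀ a, F a ⟶ G a} (w : ∀ a, i a ≫ f = g a ≫ k a) (a : I) (n : ℕ)
    (x : (freeChains.obj X).X n) :
    hk.chainProj a n ((freeChains.map f).f n x) =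
      (freeChains.map (g a)).f n (hi.chainProj a n x) := by
  refine LinearMap.congr_fun (f := hk.proj a n ∘ₗ Finsupp.lmapDomain ℤ ℤ (f.app (op ⦋n⦌)))
    (g := Finsupp.lmapDomain ℤ ℤ ((g a).app (op ⦋n⦌)) ∘ₗ hi.proj a n)
    (hi.lhom_ext fun b x => ?_) x
  have hw : f.app (op ⦋n⦌) ((i b).app _ x) = (k b).app _ ((g b).app _ x) :=
    ConcreteCategory.congr_hom (NatTrans.congr_app (w b) (op ⦋n⦌)) x
  simp only [LinearMap.comp_apply, Finsupp.lmapDomain_apply, Finsupp.mapDomain_single, hw]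
  by_cases hab : a = b
  · subst hab
    rw [hi.proj_single_same, hk.proj_single_same, Finsupp.mapDomain_single]
  · rw [hi.proj_single_of_ne hab, hk.proj_single_of_ne hab, Finsupp.mapDomain_zero]

/-- A disjoint union of homology isomorphisms is a homology isomorphism. -/
lemma IsDisjointUnion.homologyIso (hi : IsDisjointUnion i) (hk : IsDisjointUnion k) {f : X ⟶ Y}
    {g : ∀ a, F a ⟶ G a} (w : ∀ a, i a ≫ f = g a ≫ k a) (hg : ∀ a, homologyIso (g a)) :
    homologyIso f := by
  have hw (a : I) (n : ℕ) (x : (freeChains.obj (F a)).X n) : (freeChains.map f).f n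
      ((freeChains.map (i a)).f n x) = (freeChains.map (k a)).f n ((freeChains.map (g a)).f n x) := by
    rw [← freeChains_map_comp_apply, w, freeChains_map_comp_apply]
  simp only [homologyIso_iff_elementwise] at hg ⊢
  intro n
  constructor
  · intro x hx y hy
    obtain ⟨s, hs⟩ := hi.exists_chain_sum n x
    -- Each component of `y` yields a filling in its summand. Only those over the finite set `s`
    -- carrying `x` are added; `y` may have further components, which are discarded.
    choose v hv using fun a => (hg a n).1 (hi.chainProj a n x)
      (fun j => by rw [← hi.chainProj_d, hx, map_zero]) (hk.chainProj a _ y)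
      (by rw [← hk.chainProj_d, hy, hi.chainProj_map hk w])
    refine ⟨∑ a ∈ s, (freeChains.map (i a)).f _ (v a), ?_⟩
    rw [map_sum]
    refine Eq.trans (Finset.sum_congr rfl fun a _ => ?_) hs
    rw [← freeChains_map_d, hv]
  · intro y hy
    obtain ⟨s, hs⟩ := hk.exists_chain_sum n y
    choose x hx v hv using fun a => (hg a n).2 (hk.chainProj a n y)
      (fun j => by rw [← hk.chainProj_d, hy, map_zero])
    refine ⟨∑ a ∈ s, (freeChains.map (i a)).f _ (x a), fun j => ?_,
      ∑ a ∈ s, (freeChains.map (k a)).f _ (v a), ?_⟩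
    · rw [map_sum]
      exact Finset.sum_eq_zero fun a _ => by rw [← freeChains_map_d, hx, map_zero]
    · rw [map_sum, map_sum]
      refine Eq.trans ?_ (congrArg (· - _) hs)
      refine Eq.trans (Finset.sum_congr rfl fun a _ => ?_) (Finset.sum_sub_distrib _ _)
      rw [← freeChains_map_d, hv, map_sub, hw]

end coproduct

end SSet

/-! ### Cellular induction. -/

namespace SSet

open MonoidalCategory CartesianMonoidalCategory

section cellular

open relativeCellComplexOfMono

/-- Functors that are compatible with the cellular structure of simplicial sets. -/
structure IsCellular (T : SSet.{u} ⥤ SSet.{u}) : Prop where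
  isDisjointUnion : ∀ {I : Type u} (F : I → SSet.{u}),
    IsDisjointUnion fun a => T.map (Sigma.ι F a)
  mono_l : ∀ (Y : SSet.{u}) (d : ℕ), Mono (T.map (l (⊥ : Y.Subcomplex).ι d))
  mono_r : ∀ (Y : SSet.{u}) (d : ℕ), Mono (T.map (r (⊥ : Y.Subcomplex).ι d))
  excisive : ∀ (Y : SSet.{u}) (d : ℕ),
    Excisive ((isPushout (⊥ : Y.Subcomplex).ι d).toCommSq.map T)
  isFiltration : ∀ Y : SSet.{u},
    IsFiltration fun d => T.map (skeletonOfMono (⊥ : Y.Subcomplex).ι d).ι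

variable {T T' : SSet.{u} ⥤ SSet.{u}}

lemma homologyIso_app_iff (φ : T ⟶ T') {X Y : SSet.{u}} (e : X ≅ Y) :
    homologyIso (φ.app X) ↔ homologyIso (φ.app Y) :=
  homologyIso.arrow_mk_iso_iff
    (Arrow.isoMk (T.mapIso e) (T'.mapIso e) (φ.naturality e.hom))

lemma homologyIso_app_sigma (φ : T ⟶ T') (hT : IsCellular T) (hT' : IsCellular T') {I : Type u}
    (F : I → SSet.{u}) (h : ∀ a, homologyIso (φ.app (F a))) : homologyIso (φ.app (∐ F)) :=
  (hT.isDisjointUnion F).homologyIso (hT'.isDisjointUnion F)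
    (fun _ => φ.naturality _) h

/-- Two functors that are compatible with the cellular structure agree up to homology isomorphism
if they do so on the standard simplices. -/
lemma homologyIso_app_of_stdSimplex (φ : T ⟶ T') (hT : IsCellular T) (hT' : IsCellular T')
    (h : ∀ d : ℕ, homologyIso (φ.app Δ[d])) (Y : SSet.{u}) : homologyIso (φ.app Y) := by
  -- All `Y` are treated at once, since attaching cells to `Y` uses the statement for `∂Δ[d]`. Stage
  -- `d` is generated by the simplices of dimension less than `d`.
  have key (d : ℕ) : ∀ Y : SSet.{u},
      homologyIso (φ.app (skeletonOfMono (⊥ : Y.Subcomplex).ι d : SSet.{u})) := by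
    induction d with
    | zero =>
      intro Y
      -- Stage zero is empty, so it is covered by compatibility with the empty coproduct.
      have e : (skeletonOfMono (⊥ : Y.Subcomplex).ι 0 : SSet.{u}) ≅ ∐ fun a : PEmpty => a.elim := by
        refine IsInitial.uniqueUpToIso ?_ ?_
        · have : skeletonOfMono (⊥ : Y.Subcomplex).ι 0 = ⊥ := by simp
          rw [this]
          exact Subcomplex.isInitialBot
        · exact IsInitial.ofUniqueHom (fun X => Sigma.desc fun a => a.elim)
            (fun X m => Sigma.hom_ext _ _ fun a => a.elim)
      exact (homologyIso_app_iff φ e).2 (homologyIso_app_sigma φ hT hT' _ fun a => a.elim)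
    | succ d ih =>
      intro Y
      have := hT.mono_l Y d
      have := hT'.mono_l Y d
      have := hT.mono_r Y d
      have := hT'.mono_r Y d
      refine homologyIso_of_cube (hT.excisive Y d) (hT'.excisive Y d)
        (fA := φ.app _) (fB := φ.app _) (fX := φ.app _)
        ⟨(φ.naturality _).symm⟩ ⟨(φ.naturality _).symm⟩ (φ.naturality _) (φ.naturality _) ?_ ?_ (ih Y)
      · refine homologyIso_app_sigma φ hT hT' _ fun _ => ?_
        -- `∂Δ[d]` has dimension less than `d`, hence equals stage `d` of its own filtration, and
        -- the induction hypothesis applies to it.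
        have e : (skeletonOfMono (⊥ : (∂Δ[d] : SSet.{u}).Subcomplex).ι d : SSet.{u}) ≅ ∂Δ[d] := by
          refine Subcomplex.eqToIso ?_ ≪≫ Subcomplex.topIso _
          rw [Subcomplex.eq_top_iff_of_hasDimensionLT _ d]
          intro i hi
          have := skeletonOfMono_obj_eq_top (⊥ : (∂Δ[d] : SSet.{u}).Subcomplex).ι hi
          rw [this]
          exact fun _ _ => trivial
        exact (homologyIso_app_iff φ e).1 (ih _)
      · exact homologyIso_app_sigma φ hT hT' _ fun _ => h d
  exact (hT.isFiltration Y).homologyIso (hT'.isFiltration Y) (fun d => φ.naturality _)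
    fun d => key d Y

lemma skeleton_isFiltration (Y : SSet.{u}) :
    IsFiltration fun d => (skeletonOfMono (⊥ : Y.Subcomplex).ι d).ι where
  mono d := inferInstance
  succ d := ⟨r _ d, rfl⟩
  exists_simplex n x := ⟨n + 1, ⟨x, by
    rw [skeletonOfMono_obj_eq_top _ (Nat.lt_succ_self n)]; trivial⟩, rfl⟩

lemma sigma_isDisjointUnion {I : Type u} (F : I → SSet.{u}) :
    IsDisjointUnion fun a => Sigma.ι F a := by
  intro n
  have hc : IsColimit (Cofan.mk ((∐ F) _⦋n⦌) fun a => (Sigma.ι F a).app (op ⦋n⦌)) :=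
    isColimitCofanMkObjOfIsColimit ((CategoryTheory.evaluation _ _).obj (op ⦋n⦌)) _ _
      (coproductIsCoproduct F)
  exact (Cofan.nonempty_isColimit_iff_bijective_fromSigma _).1 ⟨hc⟩

lemma isCellular_id : IsCellular (𝟭 SSet.{u}) where
  isDisjointUnion F := sigma_isDisjointUnion F
  mono_l Y d := by
    change Mono (l _ d)
    rw [NatTrans.mono_iff_mono_app]
    rintro ⟨n⟩
    rw [mono_iff_injective]
    have hl (a) (x : (∂Δ[d] : SSet.{u}).obj (op n)) :
        (l (⊥ : Y.Subcomplex).ι d).app _ ((Cell.ιSigmaBoundary a).app _ x) =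
          (Cell.ιSigmaStdSimplex a).app _ (∂Δ[d].ι.app _ x) :=
      ConcreteCategory.congr_hom (NatTrans.congr_app (Cell.ι_l a) (op n)) x
    intro x y h
    obtain ⟨⟨a, x⟩, rfl⟩ := (sigma_isDisjointUnion _ n.len).2 x
    obtain ⟨⟨b, y⟩, rfl⟩ := (sigma_isDisjointUnion _ n.len).2 y
    have h := (hl a x).symm.trans (h.trans (hl b y))
    have h := (sigma_isDisjointUnion (fun _ : Cell (⊥ : Y.Subcomplex).ι d => Δ[d]) n.len).1
      (a₁ := ⟨a, ∂Δ[d].ι.app _ x⟩)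
      (a₂ := ⟨b, ∂Δ[d].ι.app _ y⟩) h
    obtain rfl := congrArg Sigma.fst h
    simp only [Sigma.mk.injEq, heq_eq_eq, true_and] at h
    rw [Subtype.ext h]
  mono_r Y d := inferInstanceAs (Mono (r _ d))
  excisive Y d := excisive_of_isPushout (isPushout _ d)
  isFiltration Y := skeleton_isFiltration Y

instance (A : SSet.{u}) {X Y : SSet.{u}} (f : X ⟶ Y) [Mono f] : Mono (A ◁ f) := by
  rw [NatTrans.mono_iff_mono_app]
  intro n
  rw [mono_iff_injective]
  have : Function.Injective (f.app n) := (mono_iff_injective _).1 inferInstance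
  rintro ⟨a, x⟩ ⟨b, y⟩ h
  obtain ⟨rfl, h⟩ := Prod.ext_iff.1 h
  exact Prod.ext rfl (this h)

/-- `A ⊗ -` preserves pushouts; the remaining conditions are checked on the second component of a
simplex. -/
lemma isCellular_tensorLeft (A : SSet.{u}) : IsCellular (tensorLeft A) where
  isDisjointUnion F n := by
    refine ⟨?_, ?_⟩
    · rintro ⟨a, x⟩ ⟨b, y⟩ h
      obtain ⟨h₁, h₂⟩ := Prod.ext_iff.1 h
      have := (sigma_isDisjointUnion F n).1 (a₁ := ⟨a, x.2⟩) (a₂ := ⟨b, y.2⟩) h₂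
      obtain rfl := congrArg Sigma.fst this
      simp only [Sigma.mk.injEq, heq_eq_eq, true_and] at this
      exact congrArg _ (Prod.ext h₁ this)
    · rintro ⟨x, y⟩
      obtain ⟨⟨a, y⟩, rfl⟩ := (sigma_isDisjointUnion F n).2 y
      exact ⟨⟨a, (x, y)⟩, rfl⟩
  mono_l Y d := have := isCellular_id.mono_l Y d; inferInstanceAs (Mono (A ◁ l _ d))
  mono_r Y d := inferInstanceAs (Mono (A ◁ r _ d))
  excisive Y d := excisive_of_isPushout ((isPushout _ d).map (tensorLeft A))
  isFiltration Y :=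
    { mono := fun d => inferInstanceAs (Mono (A ◁ (skeletonOfMono (⊥ : Y.Subcomplex).ι d).ι))
      succ := fun d => by
        obtain ⟨j, hj⟩ := (skeleton_isFiltration Y).succ d
        exact ⟨(tensorLeft A).map j, by rw [← Functor.map_comp, hj]⟩
      exists_simplex := fun n x => by
        obtain ⟨d, y, hy⟩ := (skeleton_isFiltration Y).exists_simplex n x.2
        exact ⟨d, (x.1, y), Prod.ext rfl hy⟩ }

end cellular

/-! ### Products with a fixed simplicial set. -/

/-- The straight-line contraction of `Δ[d]` to its initial vertex. -/
noncomputable def stdSimplexContraction (d : ℕ) : (Δ[d] ⊗ Δ[1] : SSet.{u}) ⟶ Δ[d] where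
  app S := ↾fun p => stdSimplex.objMk
    ⟨fun i => if (stdSimplex.objEquiv p.2).toOrderHom i = 0 then 0 else
      (stdSimplex.objEquiv p.1).toOrderHom i, fun i j hij => by
        have h₁ := (stdSimplex.objEquiv p.1).toOrderHom.monotone hij
        have h₂ := (stdSimplex.objEquiv p.2).toOrderHom.monotone hij
        dsimp only
        split_ifs with h h'
        · exact le_rfl
        · exact Fin.zero_le _
        · exact absurd (le_antisymm (h₂.trans_eq ‹_›) (Fin.zero_le _)) h
        · exact h₁⟩
  naturality _ _ _ := rfl

/-- The homotopy inverse inserts the initial vertex of `Δ[d]`; the contraction of `Δ[d]` supplies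
one homotopy, and the other is constant. -/
lemma homologyIso_fst_stdSimplex (A : SSet.{u}) (d : ℕ) :
    homologyIso (fst A (Δ[d] : SSet.{u})) := by
  refine homologyIso_of_homotopy
    (g := lift (𝟙 A) (const (stdSimplex.obj₀Equiv.{u}.symm 0))) ?_ ?_
  · exact
      { h := (α_ _ _ _).hom ≫ A ◁ stdSimplexContraction d
        h₀ := rfl
        h₁ := by
          refine NatTrans.ext (funext fun n => ?_)
          ext x
          refine Prod.ext rfl (stdSimplex.objEquiv.injective ?_)
          ext i : 3
          exact if_neg (t := (0 : Fin (d + 1))) (e := (stdSimplex.objEquiv x.2).toOrderHom i)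
            (one_ne_zero (α := Fin 2))
        rel := NatTrans.ext (by ext n x; exact x.1.2.elim) }
  · exact
      { h := fst _ _
        rel := NatTrans.ext (by ext n x; exact x.1.2.elim) }

/-- This replaces the Künneth theorem. It is cellular induction on `Z`: for `Z = Δ[d]` the
projections to `A` and `B` are homology isomorphisms, and two out of three applies. -/
lemma homologyIso_whiskerRight {A B : SSet.{u}} {f : A ⟶ B} (hf : homologyIso f) (Z : SSet.{u}) :
    homologyIso (f ▷ Z) := by
  refine homologyIso_app_of_stdSimplex ((curriedTensor SSet.{u}).map f)
    (isCellular_tensorLeft A) (isCellular_tensorLeft B) (fun d => ?_) Z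
  refine homologyIso.of_postcomp _ (fst B _) (homologyIso_fst_stdSimplex B d) ?_
  have : f ▷ Δ[d] ≫ fst B _ = fst A _ ≫ f := rfl
  change homologyIso (f ▷ Δ[d] ≫ fst B _)
  rw [this]
  exact homologyIso.comp_mem _ _ (homologyIso_fst_stdSimplex A d) hf

end SSet

/-! ### Barycentric subdivision of formal simplices. -/

namespace SSet

/-- The simplicial set whose `n`-simplices are all `(n + 1)`-tuples of elements of `A`. -/
def tuples (A : Type u) : SSet.{u} where
  obj S := Fin (S.unop.len + 1) → A
  map f := ↾fun p => p ∘ f.unop.toOrderHom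

/-- `φ` and `φ'` need not belong to a map of simplicial sets, and the universes may differ: below,
`X` consists of tuples of points of a simplex and `Y` of singular simplices. -/
lemma boundaryLin_mapDomain {X : SSet.{u}} {Y : SSet.{v}} {n : ℕ} (φ : X _⦋n⦌ → Y _⦋n⦌)
    (φ' : X _⦋n + 1⦌ → Y _⦋n + 1⦌) (h : ∀ i x, Y.δ i (φ' x) = φ (X.δ i x))
    (c : X _⦋n + 1⦌ →₀ ℤ) :
    boundaryLin Y n (c.mapDomain φ') = (boundaryLin X n c).mapDomain φ := by
  refine LinearMap.congr_fun (f := boundaryLin Y n ∘ₗ Finsupp.lmapDomain ℤ ℤ φ')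
    (g := Finsupp.lmapDomain ℤ ℤ φ ∘ₗ boundaryLin X n)
    (Finsupp.lhom_ext' fun x => LinearMap.ext_ring ?_) c
  change boundaryLin Y n (Finsupp.mapDomain _ (Finsupp.single x 1)) =
    Finsupp.lmapDomain ℤ ℤ φ (boundaryLin X n (Finsupp.single x 1))
  rw [Finsupp.mapDomain_single, boundaryLin_single, boundaryLin_single, map_sum]
  refine Finset.sum_congr rfl fun i _ => ?_
  rw [map_zsmul, Finsupp.lmapDomain_apply, Finsupp.mapDomain_single, h]

lemma boundaryLin_boundaryLin (X : SSet.{u}) (n : ℕ) (c : X _⦋n + 2⦌ →₀ ℤ) :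
    boundaryLin X n (boundaryLin X (n + 1) c) = 0 := by
  have h := ConcreteCategory.congr_hom ((freeChains.obj X).d_comp_d (n + 2) (n + 1) n)
    ((chainsEquiv X _).symm c)
  have h₁ := chainsEquiv_d X (n + 1) ((chainsEquiv X _).symm c)
  have h₂ := chainsEquiv_d X n ((freeChains.obj X).d _ _ ((chainsEquiv X _).symm c))
  rw [h₁] at h₂
  exact h₂.symm.trans h

namespace tuples

variable {A B : Type u} {n : ℕ}

/-- Prepending an entry to a tuple. -/
def cons (b : A) (p : tuples A _⦋n⦌) : tuples A _⦋n + 1⦌ := (Fin.cons b p : Fin (n + 2) → A)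

/-- The constant tuple. -/
def const (n : ℕ) (b : A) : tuples A _⦋n⦌ := fun _ => b

/-- The cone operator on chains of tuples. -/
noncomputable def cone (b : A) : (tuples A _⦋n⦌ →₀ ℤ) →ₗ[ℤ] (tuples A _⦋n + 1⦌ →₀ ℤ) :=
  Finsupp.lmapDomain ℤ ℤ (cons b)

lemma cone_single (b : A) (p : tuples A _⦋n⦌) (m : ℤ) :
    cone b (Finsupp.single p m) = Finsupp.single (cons b p) m :=
  Finsupp.mapDomain_single

lemma δ_zero_cons (b : A) (p : tuples A _⦋n⦌) :
    (tuples A).δ 0 (cons b p) = p := rfl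

lemma δ_succ_cons (b : A) (p : tuples A _⦋n + 1⦌) (j : Fin (n + 2)) :
    (tuples A).δ j.succ (cons b p) = cons b ((tuples A).δ j p) := by
  funext k
  refine Fin.cases ?_ (fun k => ?_) k
  · exact congrArg (Fin.cons b p : Fin (n + 3) → A) (Fin.succ_succAbove_zero j)
  · exact congrArg (Fin.cons b p : Fin (n + 3) → A) (Fin.succ_succAbove_succ j k)

/-- The face opposite the apex is the base; every other face is a cone over a face of the base, with
its sign shifted by one. -/
lemma boundary_cone (b : A) (c : tuples A _⦋n + 1⦌ →₀ ℤ) :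
    boundaryLin _ (n + 1) (cone b c) = c - cone b (boundaryLin _ n c) := by
  refine LinearMap.congr_fun (f := boundaryLin _ (n + 1) ∘ₗ cone b)
    (g := LinearMap.id - cone b ∘ₗ boundaryLin _ n)
    (Finsupp.lhom_ext' fun p => LinearMap.ext_ring ?_) c
  change boundaryLin _ (n + 1) (cone b (Finsupp.single p 1)) =
    Finsupp.single p 1 - cone b (boundaryLin _ n (Finsupp.single p 1))
  rw [cone_single, boundaryLin_single, boundaryLin_single, Fin.sum_univ_succ, map_sum,
    sub_eq_add_neg, ← Finset.sum_neg_distrib, δ_zero_cons]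
  refine congrArg₂ _ (by simp) (Finset.sum_congr rfl fun j _ => ?_)
  rw [δ_succ_cons, map_zsmul, cone_single, Fin.val_succ, pow_succ, mul_neg_one, neg_smul]

/-- Over a point, the face other than the base is the apex itself instead of a cone. -/
lemma boundary_cone_zero (b : A) (p : tuples A _⦋0⦌) :
    boundaryLin _ 0 (cone b (Finsupp.single p 1)) =
      Finsupp.single p 1 - Finsupp.single (const 0 b) 1 := by
  rw [cone_single, boundaryLin_single, Fin.sum_univ_two, δ_zero_cons, sub_eq_add_neg]
  have : (tuples A).δ 1 (cons b p) = const 0 b := by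
    funext k
    obtain rfl : k = 0 := Subsingleton.elim (α := Fin 1) k 0
    rfl
  rw [this]
  simp

variable (bar : ∀ n : ℕ, tuples A _⦋n⦌ → A)

/-- Barycentric subdivision of chains of tuples, for a given notion of barycenter. -/
noncomputable def sd (n : ℕ) : (tuples A _⦋n⦌ →₀ ℤ) →ₗ[ℤ] (tuples A _⦋n⦌ →₀ ℤ) :=
  Nat.rec LinearMap.id (fun n sd => Finsupp.lift _ ℤ _ fun p : tuples A _⦋n + 1⦌ =>
    cone (bar (n + 1) p) (sd (boundaryLin _ n (Finsupp.single p 1)))) n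

/-- The homotopy between the identity and barycentric subdivision. -/
noncomputable def sdHomotopy (n : ℕ) : (tuples A _⦋n⦌ →₀ ℤ) →ₗ[ℤ] (tuples A _⦋n + 1⦌ →₀ ℤ) :=
  Nat.rec 0 (fun n D => Finsupp.lift _ ℤ _ fun p : tuples A _⦋n + 1⦌ => cone (bar (n + 1) p)
    (Finsupp.single p 1 - D (boundaryLin _ n (Finsupp.single p 1)))) n

lemma sd_single (p : tuples A _⦋n + 1⦌) : sd bar (n + 1) (Finsupp.single p 1) =
    cone (bar _ p) (sd bar n (boundaryLin _ n (Finsupp.single p 1))) :=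
  Finsupp.lift_single_one _ _

lemma sdHomotopy_single (p : tuples A _⦋n + 1⦌) : sdHomotopy bar (n + 1) (Finsupp.single p 1) =
    cone (bar _ p)
      (Finsupp.single p 1 - sdHomotopy bar n (boundaryLin _ n (Finsupp.single p 1))) :=
  Finsupp.lift_single_one _ _

/-- With `b` the barycenter of `p`, `∂(b * sd ∂p) = sd ∂p - b * ∂ sd ∂p`, and by induction the last
term is `b * sd ∂∂p = 0`. In the lowest degree the two apex terms cancel instead. -/
lemma boundary_sd (n : ℕ) (c : tuples A _⦋n + 1⦌ →₀ ℤ) :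
    boundaryLin _ n (sd bar (n + 1) c) = sd bar n (boundaryLin _ n c) := by
  induction n with
  | zero =>
    refine LinearMap.congr_fun (f := boundaryLin _ 0 ∘ₗ sd bar 1)
      (g := sd bar 0 ∘ₗ boundaryLin _ 0) (Finsupp.lhom_ext' fun p => LinearMap.ext_ring ?_) c
    change boundaryLin _ 0 (sd bar 1 (Finsupp.single p 1)) =
      boundaryLin _ 0 (Finsupp.single p 1)
    rw [sd_single]
    change boundaryLin _ 0 (cone _ (boundaryLin _ 0 (Finsupp.single p 1))) = _
    rw [boundaryLin_single, Fin.sum_univ_two]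
    simp only [Fin.coe_ofNat_eq_mod, Nat.zero_mod, pow_zero, one_smul, Nat.mod_succ, pow_one,
      neg_smul, map_add, map_neg, boundary_cone_zero]
    abel
  | succ n ih =>
    refine LinearMap.congr_fun (f := boundaryLin _ (n + 1) ∘ₗ sd bar (n + 2))
      (g := sd bar (n + 1) ∘ₗ boundaryLin _ (n + 1))
      (Finsupp.lhom_ext' fun p => LinearMap.ext_ring ?_) c
    change boundaryLin _ (n + 1) (sd bar (n + 2) (Finsupp.single p 1)) =
      sd bar (n + 1) (boundaryLin _ (n + 1) (Finsupp.single p 1))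
    rw [sd_single, boundary_cone, ih, boundaryLin_boundaryLin, map_zero, map_zero, sub_zero]

lemma boundary_sdHomotopy_zero (c : tuples A _⦋0⦌ →₀ ℤ) :
    boundaryLin _ 0 (sdHomotopy bar 0 c) = c - sd bar 0 c :=
  (map_zero _).trans (sub_self c).symm

/-- Write `D` for the homotopy. Then `∂(b * (p - D ∂p)) = p - D ∂p - b * (∂p - ∂D ∂p)`, and by
induction `∂p - ∂D ∂p = sd ∂p`, so the last term is `sd p`. -/
lemma boundary_sdHomotopy (n : ℕ) (c : tuples A _⦋n + 1⦌ →₀ ℤ) :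
    boundaryLin _ (n + 1) (sdHomotopy bar (n + 1) c) =
      c - sd bar (n + 1) c - sdHomotopy bar n (boundaryLin _ n c) := by
  refine LinearMap.congr_fun (f := boundaryLin _ (n + 1) ∘ₗ sdHomotopy bar (n + 1))
    (g := LinearMap.id - sd bar (n + 1) - sdHomotopy bar n ∘ₗ boundaryLin _ n)
    (Finsupp.lhom_ext' fun p => LinearMap.ext_ring ?_) c
  change boundaryLin _ (n + 1) (sdHomotopy bar (n + 1) (Finsupp.single p 1)) =
    Finsupp.single p 1 - sd bar (n + 1) (Finsupp.single p 1) -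
      sdHomotopy bar n (boundaryLin _ n (Finsupp.single p 1))
  have h : boundaryLin _ n (sdHomotopy bar n (boundaryLin _ n (Finsupp.single p 1))) =
      boundaryLin _ n (Finsupp.single p 1) - sd bar n (boundaryLin _ n (Finsupp.single p 1)) := by
    cases n with
    | zero => exact boundary_sdHomotopy_zero bar _
    | succ n =>
      rw [boundary_sdHomotopy n, boundaryLin_boundaryLin, map_zero, sub_zero]
  rw [sdHomotopy_single, sd_single, boundary_cone, map_sub, h, sub_sub_cancel]
  abel

section naturality

variable {bar} {bar' : ∀ n : ℕ, tuples B _⦋n⦌ → B} (f : A → B)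

/-- The map on tuples induced by a map. -/
def map (n : ℕ) (p : tuples A _⦋n⦌) : tuples B _⦋n⦌ := f ∘ p

lemma boundary_map (c : tuples A _⦋n + 1⦌ →₀ ℤ) :
    boundaryLin _ n (c.mapDomain (map f (n + 1))) = (boundaryLin _ n c).mapDomain (map f n) :=
  boundaryLin_mapDomain _ _ (fun _ _ => rfl) c

lemma cone_map (b : A) (c : tuples A _⦋n⦌ →₀ ℤ) :
    cone (f b) (c.mapDomain (map f n)) = (cone b c).mapDomain (map f (n + 1)) := by
  rw [cone, cone, Finsupp.lmapDomain_apply, Finsupp.lmapDomain_apply, ← Finsupp.mapDomain_comp,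
    ← Finsupp.mapDomain_comp]
  congr 1
  funext p
  exact (Fin.comp_cons f b p).symm

/-- Naturality for maps that preserve barycenters; it is applied to affine maps. -/
lemma sd_map
    (hf : ∀ (n : ℕ) (p : tuples A _⦋n⦌), f (bar n p) = bar' n (map f n p))
    (n : ℕ) (c : tuples A _⦋n⦌ →₀ ℤ) :
    sd bar' n (c.mapDomain (map f n)) = (sd bar n c).mapDomain (map f n) := by
  induction n with
  | zero => rfl
  | succ n ih =>
    refine LinearMap.congr_fun (f := sd bar' (n + 1) ∘ₗ Finsupp.lmapDomain ℤ ℤ (map f (n + 1)))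
      (g := Finsupp.lmapDomain ℤ ℤ (map f (n + 1)) ∘ₗ sd bar (n + 1))
      (Finsupp.lhom_ext' fun p => LinearMap.ext_ring ?_) c
    change sd bar' (n + 1) (Finsupp.mapDomain _ (Finsupp.single p 1)) =
      Finsupp.mapDomain _ (sd bar (n + 1) (Finsupp.single p 1))
    rw [sd_single, ← cone_map, ← ih, ← boundary_map, hf, Finsupp.mapDomain_single, sd_single]

lemma sdHomotopy_map
    (hf : ∀ (n : ℕ) (p : tuples A _⦋n⦌), f (bar n p) = bar' n (map f n p))
    (n : ℕ) (c : tuples A _⦋n⦌ →₀ ℤ) :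
    sdHomotopy bar' n (c.mapDomain (map f n)) = (sdHomotopy bar n c).mapDomain (map f (n + 1)) := by
  induction n with
  | zero => exact Finsupp.mapDomain_zero.symm
  | succ n ih =>
    refine LinearMap.congr_fun
      (f := sdHomotopy bar' (n + 1) ∘ₗ Finsupp.lmapDomain ℤ ℤ (map f (n + 1)))
      (g := Finsupp.lmapDomain ℤ ℤ (map f (n + 2)) ∘ₗ sdHomotopy bar (n + 1))
      (Finsupp.lhom_ext' fun p => LinearMap.ext_ring ?_) c
    change sdHomotopy bar' (n + 1) (Finsupp.mapDomain _ (Finsupp.single p 1)) =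
      Finsupp.mapDomain _ (sdHomotopy bar (n + 1) (Finsupp.single p 1))
    rw [sdHomotopy_single, ← cone_map]
    refine Eq.trans ?_ (congrArg (cone _) (map_sub (Finsupp.lmapDomain ℤ ℤ (map f (n + 1))) _ _)).symm
    rw [Finsupp.lmapDomain_apply, Finsupp.lmapDomain_apply, ← ih, ← boundary_map, hf,
      Finsupp.mapDomain_single, sdHomotopy_single]

end naturality

end tuples

end SSet

/-! ### Subcomplexes that absorb chains under iterated subdivision. -/

namespace SSet

section subdivision

variable {X : SSet.{u}} (A : X.Subcomplex)

lemma exists_map_ι_iff {n : ℕ} (x : X _⦋n⦌ →₀ ℤ) :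
    (∃ y : (freeChains.obj (A : SSet.{u})).X n, (freeChains.map A.ι).f n y = x) ↔
      x ∈ Finsupp.supported ℤ ℤ (A.obj (op ⦋n⦌)) := by
  have h := Finsupp.lmapDomain_supported ℤ ℤ (A.ι.app (op ⦋n⦌)) Set.univ
  rw [Finsupp.supported_univ, Submodule.map_top] at h
  have h' : A.ι.app (op ⦋n⦌) '' Set.univ = A.obj (op ⦋n⦌) := by
    rw [Set.image_univ]
    exact Subtype.range_coe
  rw [h'] at h
  rw [← h]
  exact Iff.rfl

variable {A} (sd : ∀ n, (X _⦋n⦌ →₀ ℤ) →ₗ[ℤ] (X _⦋n⦌ →₀ ℤ))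
  (D : ∀ n, (X _⦋n⦌ →₀ ℤ) →ₗ[ℤ] (X _⦋n + 1⦌ →₀ ℤ))

/-- An inclusion of a subcomplex is a homology isomorphism if there is a subdivision operator,
chain homotopic to the identity, that takes every chain to a chain of the subcomplex after
finitely many steps. -/
lemma homologyIso_of_subdivision
    (hsd : ∀ n c, boundaryLin X n (sd (n + 1) c) = sd n (boundaryLin X n c))
    (hD₀ : ∀ c, boundaryLin X 0 (D 0 c) = c - sd 0 c)
    (hD : ∀ n c, boundaryLin X (n + 1) (D (n + 1) c) =
      c - sd (n + 1) c - D n (boundaryLin X n c))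
    (hsdA : ∀ n, ∀ c ∈ Finsupp.supported ℤ ℤ (A.obj (op ⦋n⦌)),
      sd n c ∈ Finsupp.supported ℤ ℤ (A.obj (op ⦋n⦌)))
    (hDA : ∀ n, ∀ c ∈ Finsupp.supported ℤ ℤ (A.obj (op ⦋n⦌)),
      D n c ∈ Finsupp.supported ℤ ℤ (A.obj (op ⦋n + 1⦌)))
    (hA : ∀ n c, ∃ k : ℕ, (sd n)^[k] c ∈ Finsupp.supported ℤ ℤ (A.obj (op ⦋n⦌))) :
    homologyIso A.ι := by
  have hcyc (n : ℕ) (c : X _⦋n⦌ →₀ ℤ)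
      (hc : ∀ j, (freeChains.obj X).d n j ((chainsEquiv X n).symm c) = 0) :
      boundaryLin X n (D n c) = c - sd n c := by
    cases n with
    | zero => exact hD₀ c
    | succ n =>
      have : boundaryLin X n c = 0 := (chainsEquiv_d X n _).symm.trans (hc n)
      rw [hD, this, map_zero, sub_zero]
  have hsdcyc (n : ℕ) (c : X _⦋n⦌ →₀ ℤ)
      (hc : ∀ j, (freeChains.obj X).d n j ((chainsEquiv X n).symm c) = 0) (j : ℕ) :
      (freeChains.obj X).d n j ((chainsEquiv X n).symm (sd n c)) = 0 := by
    by_cases hj : j + 1 = n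
    · subst hj
      have : boundaryLin X j c = 0 := (chainsEquiv_d X j _).symm.trans (hc j)
      refine (chainsEquiv_d X j ((chainsEquiv X _).symm (sd _ c))).trans ?_
      refine (hsd j c).trans ?_
      rw [this, map_zero]
      rfl
    · rw [(freeChains.obj X).shape _ _ hj]
      rfl
  -- The homotopy for `k` subdivisions of a cycle `c` is `∑_{i < k} D (sdⁱ c)`; it stays in `A` if
  -- `c` lies in `A`.
  have hiter (n k : ℕ) (c : X _⦋n⦌ →₀ ℤ)
      (hc : ∀ j, (freeChains.obj X).d n j ((chainsEquiv X n).symm c) = 0) :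
      (∀ j, (freeChains.obj X).d n j ((chainsEquiv X n).symm ((sd n)^[k] c)) = 0) ∧
      ∃ w, boundaryLin X n w = c - (sd n)^[k] c ∧
        (c ∈ Finsupp.supported ℤ ℤ (A.obj (op ⦋n⦌)) →
          w ∈ Finsupp.supported ℤ ℤ (A.obj (op ⦋n + 1⦌))) := by
    induction k generalizing c with
    | zero => exact ⟨hc, 0, by simp, fun _ => Submodule.zero_mem _⟩
    | succ k ih =>
      obtain ⟨h, w, hw, hw'⟩ := ih (sd n c) (hsdcyc n c hc)
      refine ⟨h, D n c + w, ?_, fun h => Submodule.add_mem _ (hDA n c h) (hw' (hsdA n c h))⟩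
      rw [map_add, hcyc n c hc, hw, Function.iterate_succ_apply]
      abel
  have hbd (n k : ℕ) (c : X _⦋n + 1⦌ →₀ ℤ) :
      boundaryLin X n ((sd (n + 1))^[k] c) = (sd n)^[k] (boundaryLin X n c) := by
    induction k generalizing c with
    | zero => rfl
    | succ k ih => rw [Function.iterate_succ_apply, Function.iterate_succ_apply, ih, hsd]
  have hinj := freeChains_map_injective A.ι
  rw [homologyIso_iff_elementwise]
  refine fun n => ⟨fun x hx y hy => ?_, fun y hy => ?_⟩
  · obtain ⟨k, hk⟩ := hA (n + 1) (chainsEquiv X _ y)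
    obtain ⟨-, w, hw, hw'⟩ := hiter n k (chainsEquiv X n ((freeChains.map A.ι).f n x))
      (fun j => by
        refine (freeChains_map_d A.ι n j x).symm.trans ?_
        rw [hx, map_zero])
    -- If `x = ∂y` with `y` in `X`, then `sdᵏ y` lies in `A` and bounds `sdᵏ x`, while `w` lies in
    -- `A` and bounds `x - sdᵏ x`. Their sum bounds `x` within `A`.
    obtain ⟨z, hz⟩ := (exists_map_ι_iff A _).2
      (Submodule.add_mem _ hk (hw' ((exists_map_ι_iff A _).1 ⟨x, rfl⟩)))
    refine ⟨z, hinj n ?_⟩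
    rw [freeChains_map_d, hz]
    refine (chainsEquiv_d X n _).trans ?_
    refine (map_add (boundaryLin X n) _ _).trans ?_
    rw [hw, hbd, ← chainsEquiv_d, hy, add_sub_cancel]
    rfl
  · obtain ⟨k, hk⟩ := hA n (chainsEquiv X _ y)
    obtain ⟨hc, w, hw, -⟩ := hiter n k (chainsEquiv X _ y) hy
    obtain ⟨x, hx⟩ := (exists_map_ι_iff A _).2 hk
    refine ⟨x, fun j => hinj j ?_, (chainsEquiv X _).symm w, ?_⟩
    · rw [freeChains_map_d, hx, map_zero]
      exact hc j
    · rw [hx]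
      exact (chainsEquiv_d X n _).trans hw

end subdivision

end SSet

/-! ### Affine simplices and the mesh of their subdivisions. -/

/-- The standard topological simplex. -/
abbrev TopSimplex (n : ℕ) : Type := stdSimplex ℝ (Fin (n + 1))

namespace TopSimplex

open SSet

variable {n m N : ℕ}

/-- The affine map with given values at the vertices. -/
noncomputable def comb (p : tuples (TopSimplex N) _⦋n⦌) : C(TopSimplex n, TopSimplex N) where
  toFun t := ⟨fun k => ∑ i : Fin (n + 1), t i * (p i : TopSimplex N) k,
    fun k => Finset.sum_nonneg fun i _ => mul_nonneg (t.2.1 i) ((p i).2.1 k), by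
      rw [Finset.sum_comm]
      simp_rw [← Finset.mul_sum]
      exact (Finset.sum_congr rfl fun i _ => by rw [stdSimplex.sum_eq_one, mul_one]; rfl).trans t.2.2⟩
  continuous_toFun := by
    refine Continuous.subtype_mk (continuous_pi fun k => continuous_finsetSum _ fun i _ => ?_) _
    exact ((continuous_apply i).comp continuous_subtype_val).mul continuous_const

lemma comb_apply (p : tuples (TopSimplex N) _⦋n⦌) (t : TopSimplex n) (k : Fin (N + 1)) :
    comb p t k = ∑ i : Fin (n + 1), t i * (p i : TopSimplex N) k := rfl

/-- The tuple of all vertices. -/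
noncomputable def vertices (n : ℕ) : tuples (TopSimplex n) _⦋n⦌ :=
  fun i => ⟨Pi.single i 1, single_mem_stdSimplex ℝ i⟩

lemma comb_vertices : comb (vertices n) = ContinuousMap.id _ := by
  ext t k
  refine (comb_apply _ _ _).trans ?_
  change ∑ i : Fin (n + 1), t i * (Pi.single i 1 : Fin (n + 1) → ℝ) k = t k
  simp [Pi.single_apply]

lemma comb_apply_vertices (p : tuples (TopSimplex N) _⦋n⦌) :
    tuples.map (comb p) n (vertices n) = p := by
  funext i
  ext k
  refine (comb_apply _ _ _).trans ?_
  change ∑ j : Fin (n + 1), (Pi.single i 1 : Fin (n + 1) → ℝ) j * (p j : TopSimplex N) k = (p i : TopSimplex N) k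
  simp [Pi.single_apply]

lemma comb_map (q : tuples (TopSimplex N) _⦋m⦌) (p : tuples (TopSimplex m) _⦋n⦌) :
    comb (tuples.map (comb q) n p) = (comb q).comp (comb p) := by
  ext t k
  change ∑ i : Fin (n + 1), t i * ∑ j : Fin (m + 1), (p i : TopSimplex m) j * (q j : TopSimplex N) k =
    ∑ j : Fin (m + 1), (∑ i : Fin (n + 1), t i * (p i : TopSimplex m) j) * (q j : TopSimplex N) k
  simp_rw [Finset.mul_sum, Finset.sum_mul, mul_assoc]
  exact Finset.sum_comm

lemma comb_comp (p : tuples (TopSimplex N) _⦋n⦌) (f : ⦋m⦌ ⟶ ⦋n⦌) :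
    comb ((tuples _).map f.op p) = (comb p).comp ⟨_, stdSimplex.continuous_map f⟩ := by
  ext t k
  change ∑ i : Fin (m + 1), t i * (p (f i) : TopSimplex N) k =
    ∑ j : Fin (n + 1), FunOnFinite.linearMap ℝ ℝ f t j * (p j : TopSimplex N) k
  simp_rw [FunOnFinite.linearMap_apply_apply, Finset.sum_mul]
  rw [← Finset.sum_fiberwise (s := Finset.univ) (g := f)]
  refine Finset.sum_congr rfl fun j _ => Finset.sum_congr rfl fun i hi => ?_
  rw [(Finset.mem_filter.1 hi).2]

/-- The barycenter of a tuple of points. -/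
noncomputable def bar (n : ℕ) (p : tuples (TopSimplex N) _⦋n⦌) : TopSimplex N :=
  comb p stdSimplex.barycenter

lemma comb_bar (q : tuples (TopSimplex N) _⦋m⦌) (n : ℕ) (p : tuples (TopSimplex m) _⦋n⦌) :
    comb q (bar n p) = bar n (tuples.map (comb q) n p) := by
  rw [bar, bar, comb_map]
  rfl

lemma dist_comb_le (p : tuples (TopSimplex N) _⦋n⦌) (t : TopSimplex n) (x : TopSimplex N) :
    dist (comb p t) x ≤ ∑ i : Fin (n + 1), t i * dist (p i : TopSimplex N) x := by
  have hd (a b : TopSimplex N) : dist a b = ‖a.1 - b.1‖ := by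
    rw [Subtype.dist_eq, dist_eq_norm]
  have h : (comb p t).1 - x.1 = ∑ i : Fin (n + 1), t i • ((p i : TopSimplex N).1 - x.1) := by
    simp_rw [smul_sub, Finset.sum_sub_distrib, ← Finset.sum_smul, stdSimplex.sum_eq_one, one_smul]
    congr 1
    funext k
    simp [Finset.sum_apply]
    rfl
  rw [hd, h]
  refine (norm_sum_le _ _).trans (Finset.sum_le_sum fun i _ => ?_)
  rw [norm_smul, hd]
  exact (congrArg (· * _) (Real.norm_of_nonneg (t.2.1 i))).le

lemma dist_comb_le_of_forall (p : tuples (TopSimplex N) _⦋n⦌) (t : TopSimplex n)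
    (x : TopSimplex N) (r : ℝ) (h : ∀ i : Fin (n + 1), dist (p i : TopSimplex N) x ≤ r) :
    dist (comb p t) x ≤ r := by
  refine (dist_comb_le p t x).trans ?_
  refine (Finset.sum_le_sum fun i _ => mul_le_mul_of_nonneg_left (h i) (t.2.1 i)).trans ?_
  rw [← Finset.sum_mul]
  exact ((congrArg (· * r) t.2.2).trans (one_mul r)).le

/-- Of the `n + 1` equally weighted vertices, one is `p j` itself and contributes nothing; the other
`n` contribute at most `r` each. -/
lemma dist_bar_le (p : tuples (TopSimplex N) _⦋n⦌) (r : ℝ)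
    (h : ∀ i j : Fin (n + 1), dist (p i : TopSimplex N) (p j) ≤ r) (j : Fin (n + 1)) :
    dist (bar n p) (p j) ≤ n / (n + 1) * r := by
  refine (dist_comb_le p _ _).trans ?_
  have hb (i : Fin (n + 1)) : (stdSimplex.barycenter : TopSimplex n) i = ((n : ℝ) + 1)⁻¹ := by
    refine (stdSimplex.barycenter_apply i).trans ?_
    simp
  simp_rw [hb, ← Finset.mul_sum]
  rw [← Finset.add_sum_erase _ _ (Finset.mem_univ j), dist_self, zero_add, div_eq_inv_mul, mul_assoc]
  refine mul_le_mul_of_nonneg_left ?_ (by positivity)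
  refine (Finset.sum_le_card_nsmul _ _ r fun i _ => h i j).trans ?_
  simp

end TopSimplex

namespace TopSimplex

open SSet

variable {n N : ℕ}

/-- The tuples of diameter at most `r`. -/
def meshLE (N n : ℕ) (r : ℝ) : Set (tuples (TopSimplex N) _⦋n⦌) :=
  {p | ∀ i j : Fin (n + 1), dist (p i : TopSimplex N) (p j) ≤ r}

/-- The tuples of points in the closed balls that contain the tuple `p`. -/
def ballHull (n : ℕ) {m : ℕ} (p : tuples (TopSimplex N) _⦋m⦌) : Set (tuples (TopSimplex N) _⦋n⦌) :=
  {q | ∀ (x : TopSimplex N) (r : ℝ), (∀ i : Fin (m + 1), dist (p i : TopSimplex N) x ≤ r) →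
    ∀ j : Fin (n + 1), dist (q j : TopSimplex N) x ≤ r}

lemma cone_mem_supported {A : Type u} (b : A) {S : Set (tuples A _⦋n⦌)}
    {S' : Set (tuples A _⦋n + 1⦌)} (h : ∀ p ∈ S, tuples.cons b p ∈ S') {c : tuples A _⦋n⦌ →₀ ℤ}
    (hc : c ∈ Finsupp.supported ℤ ℤ S) : tuples.cone b c ∈ Finsupp.supported ℤ ℤ S' := by
  have h₁ := Submodule.mem_map_of_mem (f := tuples.cone b) hc
  have h₂ := Finsupp.lmapDomain_supported ℤ ℤ (tuples.cons b) S
  rw [tuples.cone, h₂] at h₁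
  exact Finsupp.supported_mono (Set.image_subset_iff.2 h) h₁

/-- The diameter bound needs to know where the vertices lie, so both are proved together. A vertex
from a subdivided face stays in every closed ball containing `p`, in particular in the one around
the barycenter given by `dist_bar_le`. Two vertices in a face are close by induction, as `n / (n +
1)` increases with `n`. -/
lemma sd_single_mem (n : ℕ) (p : tuples (TopSimplex N) _⦋n⦌) (r : ℝ) (hp : p ∈ meshLE N n r) :
    tuples.sd bar n (Finsupp.single p 1) ∈
      Finsupp.supported ℤ ℤ (meshLE N n (n / (n + 1) * r) ∩ ballHull n p) := by
  induction n with
  | zero =>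
    refine Finsupp.single_mem_supported ℤ _ ⟨fun i j => ?_, fun x r h j => h j⟩
    obtain rfl := Subsingleton.elim (α := Fin 1) i j
    simp
  | succ n ih =>
    have hr : 0 ≤ r := dist_nonneg.trans (hp 0 0)
    rw [tuples.sd_single, boundaryLin_single, map_sum, map_sum]
    refine Submodule.sum_mem _ fun i _ => ?_
    rw [map_zsmul, map_zsmul]
    refine Submodule.smul_mem _ _ (cone_mem_supported _ ?_ (ih ((tuples _).δ i p)
      (fun a b => hp (i.succAbove a) (i.succAbove b))))
    rintro q ⟨hq, hq'⟩
    have hq'' (x : TopSimplex N) (r : ℝ) (h : ∀ i : Fin (n + 2), dist (p i : TopSimplex N) x ≤ r)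
        (j : Fin (n + 1)) : dist (q j : TopSimplex N) x ≤ r := hq' x r (fun a => h (i.succAbove a)) j
    have hb (j : Fin (n + 1)) : dist (q j : TopSimplex N) (bar (n + 1) p) ≤
        ((n + 1 : ℕ) : ℝ) / ((n + 1 : ℕ) + 1) * r :=
      hq'' _ _ (fun k => by rw [dist_comm]; exact dist_bar_le p r hp k) j
    have hle : (n : ℝ) / (n + 1) * r ≤ ((n + 1 : ℕ) : ℝ) / ((n + 1 : ℕ) + 1) * r := by
      refine mul_le_mul_of_nonneg_right ?_ hr
      rw [div_le_div_iff₀ (by positivity) (by positivity)]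
      push_cast
      nlinarith
    refine ⟨fun a b => ?_, fun x r h j => ?_⟩
    · refine Fin.cases ?_ (fun a => ?_) a <;> refine Fin.cases ?_ (fun b => ?_) b
      · exact (dist_self _).trans_le (by positivity)
      · exact (dist_comm _ _).trans_le (hb b)
      · exact hb a
      · exact (hq a b).trans hle
    · refine Fin.cases ?_ (fun j => ?_) j
      · exact dist_comb_le_of_forall _ _ _ _ h
      · exact hq'' x r h j

lemma sd_mem_meshLE (n : ℕ) {c : tuples (TopSimplex N) _⦋n⦌ →₀ ℤ} {r : ℝ}
    (hc : c ∈ Finsupp.supported ℤ ℤ (meshLE N n r)) :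
    tuples.sd bar n c ∈ Finsupp.supported ℤ ℤ (meshLE N n (n / (n + 1) * r)) := by
  rw [← Finsupp.sum_single c, Finsupp.sum, map_sum]
  refine Submodule.sum_mem _ fun p hp => ?_
  rw [← mul_one (c p), ← smul_eq_mul (α := ℤ), ← Finsupp.smul_single, map_zsmul]
  exact Submodule.smul_mem _ _ (Finsupp.supported_mono Set.inter_subset_left
    (sd_single_mem n p r (hc hp)))

lemma sd_iterate_mem_meshLE (n k : ℕ) {c : tuples (TopSimplex N) _⦋n⦌ →₀ ℤ} {r : ℝ}
    (hc : c ∈ Finsupp.supported ℤ ℤ (meshLE N n r)) :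
    (tuples.sd bar n)^[k] c ∈ Finsupp.supported ℤ ℤ (meshLE N n ((n / (n + 1)) ^ k * r)) := by
  induction k with
  | zero => simpa using hc
  | succ k ih =>
    rw [Function.iterate_succ_apply', pow_succ', mul_assoc]
    exact sd_mem_meshLE n ih

lemma vertices_mem_meshLE (n : ℕ) : vertices n ∈ meshLE n n 1 := by
  intro i j
  rw [Subtype.dist_eq, dist_pi_le_iff zero_le_one]
  intro k
  have h₁ := mem_Icc_of_mem_stdSimplex (vertices n i : TopSimplex n).2 k
  have h₂ := mem_Icc_of_mem_stdSimplex (vertices n j : TopSimplex n).2 k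
  rw [Real.dist_eq, abs_le]
  constructor <;> linarith [h₁.1, h₁.2, h₂.1, h₂.2]

end TopSimplex

/-! ### Subdivision of singular chains and small simplices. -/

namespace TopCat

open SSet TopSimplex

variable (T : TopCat.{u}) {n N : ℕ}

/-- Singular simplices are continuous maps. -/
noncomputable def simplexEquiv (n : ℕ) : (toSSet.obj T) _⦋n⦌ ≃ C(TopSimplex n, T) :=
  toSSetObjEquiv T (op ⦋n⦌)

variable {T}

lemma simplexEquiv_map {m : ℕ} (s : (toSSet.obj T) _⦋n⦌) (f : ⦋m⦌ ⟶ ⦋n⦌) :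
    simplexEquiv T m ((toSSet.obj T).map f.op s) =
      (simplexEquiv T n s).comp ⟨_, stdSimplex.continuous_map f⟩ := rfl

lemma simplexEquiv_toSSet_map {T' : TopCat.{u}} (f : T ⟶ T') (s : (toSSet.obj T) _⦋n⦌) :
    simplexEquiv T' n ((toSSet.map f).app _ s) = f.hom.comp (simplexEquiv T n s) := rfl

/-- The singular simplices obtained from tuples of points by composition with affine maps. -/
noncomputable def push (s : (toSSet.obj T) _⦋N⦌) (n : ℕ) (p : tuples (TopSimplex N) _⦋n⦌) :
    (toSSet.obj T) _⦋n⦌ :=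
  (simplexEquiv T n).symm ((simplexEquiv T N s).comp (comb p))

lemma simplexEquiv_push (s : (toSSet.obj T) _⦋N⦌) (n : ℕ) (p : tuples (TopSimplex N) _⦋n⦌) :
    simplexEquiv T n (push s n p) = (simplexEquiv T N s).comp (comb p) :=
  Equiv.apply_symm_apply _ _

lemma δ_push (s : (toSSet.obj T) _⦋N⦌) (n : ℕ) (i : Fin (n + 2))
    (p : tuples (TopSimplex N) _⦋n + 1⦌) :
    (toSSet.obj T).δ i (push s (n + 1) p) = push s n ((tuples _).δ i p) := by
  apply (simplexEquiv T n).injective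
  refine (simplexEquiv_map _ _).trans ?_
  rw [simplexEquiv_push, simplexEquiv_push, ContinuousMap.comp_assoc, ← comb_comp]
  rfl

lemma push_vertices (s : (toSSet.obj T) _⦋n⦌) : push s n (vertices n) = s := by
  rw [push, comb_vertices, ContinuousMap.comp_id, Equiv.symm_apply_apply]

lemma push_map {m : ℕ} (s : (toSSet.obj T) _⦋N⦌) (q : tuples (TopSimplex N) _⦋m⦌)
    (p : tuples (TopSimplex m) _⦋n⦌) :
    push s n (tuples.map (comb q) n p) = push (push s m q) n p := by
  apply (simplexEquiv T n).injective
  rw [simplexEquiv_push, simplexEquiv_push, simplexEquiv_push, comb_map, ContinuousMap.comp_assoc]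

lemma boundaryLin_push (s : (toSSet.obj T) _⦋N⦌) (c : tuples (TopSimplex N) _⦋n + 1⦌ →₀ ℤ) :
    boundaryLin _ n (c.mapDomain (push s (n + 1))) = (boundaryLin _ n c).mapDomain (push s n) :=
  boundaryLin_mapDomain _ _ (δ_push s n) c

variable (T) in
/-- Barycentric subdivision of singular chains. -/
noncomputable def singularSd (n : ℕ) :
    ((toSSet.obj T) _⦋n⦌ →₀ ℤ) →ₗ[ℤ] ((toSSet.obj T) _⦋n⦌ →₀ ℤ) :=
  Finsupp.lift _ ℤ _ fun s =>
    Finsupp.mapDomain (push s n) (tuples.sd bar n (Finsupp.single (vertices n) 1))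

variable (T) in
/-- The homotopy between the identity and barycentric subdivision. -/
noncomputable def singularSdHomotopy (n : ℕ) :
    ((toSSet.obj T) _⦋n⦌ →₀ ℤ) →ₗ[ℤ] ((toSSet.obj T) _⦋n + 1⦌ →₀ ℤ) :=
  Finsupp.lift _ ℤ _ fun s =>
    Finsupp.mapDomain (push s (n + 1)) (tuples.sdHomotopy bar n (Finsupp.single (vertices n) 1))

/-- Together with `single_eq_push` this reduces identities for singular subdivision to those for
tuples. It holds because `p` is the image of the vertices under the affine map `comb p`, for which
subdivision is natural. -/
lemma singularSd_push (s : (toSSet.obj T) _⦋N⦌) (c : tuples (TopSimplex N) _⦋n⦌ →₀ ℤ) :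
    singularSd T n (c.mapDomain (push s n)) = (tuples.sd bar n c).mapDomain (push s n) := by
  refine LinearMap.congr_fun (f := singularSd T n ∘ₗ Finsupp.lmapDomain ℤ ℤ (push s n))
    (g := Finsupp.lmapDomain ℤ ℤ (push s n) ∘ₗ tuples.sd bar n)
    (Finsupp.lhom_ext' fun p => LinearMap.ext_ring ?_) c
  change singularSd T n (Finsupp.mapDomain _ (Finsupp.single p 1)) =
    Finsupp.mapDomain _ (tuples.sd bar n (Finsupp.single p 1))
  rw [Finsupp.mapDomain_single, singularSd, Finsupp.lift_single_one]
  have h : Finsupp.single p (1 : ℤ) =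
      (Finsupp.single (vertices n) 1).mapDomain (tuples.map (comb p) n) := by
    rw [Finsupp.mapDomain_single, comb_apply_vertices]
  rw [h, tuples.sd_map (comb p) (comb_bar p), ← Finsupp.mapDomain_comp]
  congr 1
  funext q
  exact (push_map s p q).symm

lemma singularSdHomotopy_push (s : (toSSet.obj T) _⦋N⦌)
    (c : tuples (TopSimplex N) _⦋n⦌ →₀ ℤ) :
    singularSdHomotopy T n (c.mapDomain (push s n)) =
      (tuples.sdHomotopy bar n c).mapDomain (push s (n + 1)) := by
  refine LinearMap.congr_fun (f := singularSdHomotopy T n ∘ₗ Finsupp.lmapDomain ℤ ℤ (push s n))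
    (g := Finsupp.lmapDomain ℤ ℤ (push s (n + 1)) ∘ₗ tuples.sdHomotopy bar n)
    (Finsupp.lhom_ext' fun p => LinearMap.ext_ring ?_) c
  change singularSdHomotopy T n (Finsupp.mapDomain _ (Finsupp.single p 1)) =
    Finsupp.mapDomain _ (tuples.sdHomotopy bar n (Finsupp.single p 1))
  rw [Finsupp.mapDomain_single, singularSdHomotopy, Finsupp.lift_single_one]
  have h : Finsupp.single p (1 : ℤ) =
      (Finsupp.single (vertices n) 1).mapDomain (tuples.map (comb p) n) := by
    rw [Finsupp.mapDomain_single, comb_apply_vertices]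
  rw [h, tuples.sdHomotopy_map (comb p) (comb_bar p), ← Finsupp.mapDomain_comp]
  congr 1
  funext q
  exact (push_map s p q).symm

lemma single_eq_push (s : (toSSet.obj T) _⦋n⦌) :
    Finsupp.single s (1 : ℤ) = (Finsupp.single (vertices n) 1).mapDomain (push s n) := by
  rw [Finsupp.mapDomain_single, push_vertices]

lemma boundaryLin_singularSd (n : ℕ) (c : (toSSet.obj T) _⦋n + 1⦌ →₀ ℤ) :
    boundaryLin _ n (singularSd T (n + 1) c) = singularSd T n (boundaryLin _ n c) := by
  refine LinearMap.congr_fun (f := boundaryLin _ n ∘ₗ singularSd T (n + 1))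
    (g := singularSd T n ∘ₗ boundaryLin _ n)
    (Finsupp.lhom_ext' fun s => LinearMap.ext_ring ?_) c
  change boundaryLin _ n (singularSd T (n + 1) (Finsupp.single s 1)) =
    singularSd T n (boundaryLin _ n (Finsupp.single s 1))
  rw [single_eq_push, singularSd_push, boundaryLin_push, boundaryLin_push, singularSd_push,
    tuples.boundary_sd]

lemma boundaryLin_singularSdHomotopy_zero (c : (toSSet.obj T) _⦋0⦌ →₀ ℤ) :
    boundaryLin _ 0 (singularSdHomotopy T 0 c) = c - singularSd T 0 c := by
  refine LinearMap.congr_fun (f := boundaryLin _ 0 ∘ₗ singularSdHomotopy T 0)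
    (g := LinearMap.id - singularSd T 0) (Finsupp.lhom_ext' fun s => LinearMap.ext_ring ?_) c
  change boundaryLin _ 0 (singularSdHomotopy T 0 (Finsupp.single s 1)) =
    Finsupp.single s 1 - singularSd T 0 (Finsupp.single s 1)
  rw [single_eq_push, singularSd_push, singularSdHomotopy_push, boundaryLin_push,
    tuples.boundary_sdHomotopy_zero]
  exact map_sub (Finsupp.lmapDomain ℤ ℤ (push s 0)) _ _

lemma boundaryLin_singularSdHomotopy (n : ℕ) (c : (toSSet.obj T) _⦋n + 1⦌ →₀ ℤ) :
    boundaryLin _ (n + 1) (singularSdHomotopy T (n + 1) c) =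
      c - singularSd T (n + 1) c - singularSdHomotopy T n (boundaryLin _ n c) := by
  refine LinearMap.congr_fun (f := boundaryLin _ (n + 1) ∘ₗ singularSdHomotopy T (n + 1))
    (g := LinearMap.id - singularSd T (n + 1) - singularSdHomotopy T n ∘ₗ boundaryLin _ n)
    (Finsupp.lhom_ext' fun s => LinearMap.ext_ring ?_) c
  change boundaryLin _ (n + 1) (singularSdHomotopy T (n + 1) (Finsupp.single s 1)) =
    Finsupp.single s 1 - singularSd T (n + 1) (Finsupp.single s 1) -
      singularSdHomotopy T n (boundaryLin _ n (Finsupp.single s 1))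
  rw [single_eq_push, singularSd_push, singularSdHomotopy_push, boundaryLin_push, boundaryLin_push,
    singularSdHomotopy_push, tuples.boundary_sdHomotopy]
  refine (map_sub (Finsupp.lmapDomain ℤ ℤ (push s (n + 1))) _ _).trans ?_
  exact congrArg (· - _) (map_sub (Finsupp.lmapDomain ℤ ℤ (push s (n + 1))) _ _)

variable (T) in
/-- The singular simplices with values in a given set. -/
noncomputable def singularIn (U : Set T) : (toSSet.obj T).Subcomplex where
  obj S := {s | ∀ t, toSSetObjEquiv T S s t ∈ U}
  map _ _ hs _ := hs _

lemma push_mem_singularIn {U : Set T} {s : (toSSet.obj T) _⦋N⦌}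
    (hs : s ∈ (singularIn T U).obj (op ⦋N⦌)) (p : tuples (TopSimplex N) _⦋n⦌) :
    push s n p ∈ (singularIn T U).obj (op ⦋n⦌) := by
  intro t
  have h : simplexEquiv T n (push s n p) t ∈ U := by
    rw [simplexEquiv_push]
    exact hs _
  exact h

lemma mapDomain_push_mem {S : Set ((toSSet.obj T) _⦋n⦌)} {s : (toSSet.obj T) _⦋N⦌}
    {S' : Set (tuples (TopSimplex N) _⦋n⦌)} (h : ∀ p ∈ S', push s n p ∈ S)
    {c : tuples (TopSimplex N) _⦋n⦌ →₀ ℤ} (hc : c ∈ Finsupp.supported ℤ ℤ S') :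
    c.mapDomain (push s n) ∈ Finsupp.supported ℤ ℤ S := by
  have h₁ := Submodule.mem_map_of_mem (f := Finsupp.lmapDomain ℤ ℤ (push s n)) hc
  rw [Finsupp.lmapDomain_supported] at h₁
  exact Finsupp.supported_mono (Set.image_subset_iff.2 h) h₁

/-- The theorem of small simplices. -/
theorem homologyIso_singularIn_sup {U V : Set T} (hU : IsOpen U) (hV : IsOpen V)
    (h : U ∪ V = Set.univ) : homologyIso (singularIn T U ⊔ singularIn T V).ι := by
  have hpush (N n : ℕ) (s : (toSSet.obj T) _⦋N⦌)
      (hs : s ∈ (singularIn T U ⊔ singularIn T V).obj (op ⦋N⦌)) (p : tuples (TopSimplex N) _⦋n⦌) :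
      push s n p ∈ (singularIn T U ⊔ singularIn T V).obj (op ⦋n⦌) :=
    hs.imp (fun hs => push_mem_singularIn hs p) fun hs => push_mem_singularIn hs p
  have hlin (n m : ℕ) (f : ((toSSet.obj T) _⦋n⦌ →₀ ℤ) →ₗ[ℤ] ((toSSet.obj T) _⦋m⦌ →₀ ℤ))
      (hf : ∀ s ∈ (singularIn T U ⊔ singularIn T V).obj (op ⦋n⦌), f (Finsupp.single s 1) ∈
        Finsupp.supported ℤ ℤ ((singularIn T U ⊔ singularIn T V).obj (op ⦋m⦌))) :
      ∀ c ∈ Finsupp.supported ℤ ℤ ((singularIn T U ⊔ singularIn T V).obj (op ⦋n⦌)),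
      f c ∈ Finsupp.supported ℤ ℤ ((singularIn T U ⊔ singularIn T V).obj (op ⦋m⦌)) := by
    intro c hc
    rw [Finsupp.supported_eq_span_single] at hc
    refine Submodule.span_induction (p := fun c _ => f c ∈ _) ?_ ?_ ?_ ?_ hc
    · rintro _ ⟨s, hs, rfl⟩
      exact hf s hs
    · rw [map_zero]
      exact Submodule.zero_mem _
    · intro x y _ _ hx hy
      rw [map_add]
      exact Submodule.add_mem _ hx hy
    · intro a x _ hx
      rw [map_smul]
      exact Submodule.smul_mem _ _ hx
  have hsd (n : ℕ) := hlin n n (singularSd T n) (fun s hs => by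
    rw [single_eq_push, singularSd_push]
    exact mapDomain_push_mem (S' := Set.univ) (fun p _ => hpush _ _ s hs p)
      (by rw [Finsupp.supported_univ]; trivial))
  refine homologyIso_of_subdivision (singularSd T) (singularSdHomotopy T) boundaryLin_singularSd
    boundaryLin_singularSdHomotopy_zero boundaryLin_singularSdHomotopy hsd
    (fun n => hlin n _ _ fun s hs => ?_) ?_
  · rw [single_eq_push, singularSdHomotopy_push]
    exact mapDomain_push_mem (S' := Set.univ) (fun p _ => hpush _ _ s hs p)
      (by rw [Finsupp.supported_univ]; trivial)
  · intro n c
    have hmono (c : (toSSet.obj T) _⦋n⦌ →₀ ℤ) (k l : ℕ) (hc : (singularSd T n)^[k] c ∈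
        Finsupp.supported ℤ ℤ ((singularIn T U ⊔ singularIn T V).obj (op ⦋n⦌))) :
        (singularSd T n)^[l + k] c ∈
          Finsupp.supported ℤ ℤ ((singularIn T U ⊔ singularIn T V).obj (op ⦋n⦌)) := by
      induction l with
      | zero => rwa [zero_add]
      | succ l ih =>
        rw [add_right_comm, Function.iterate_succ_apply']
        exact hsd n _ ih
    have hlinIter (k : ℕ) : (⇑(singularSd T n))^[k] = ⇑((singularSd T n) ^ k) :=
      (Module.End.coe_pow _ _).symm
    induction c using Finsupp.induction_linear with
    | zero => exact ⟨0, Submodule.zero_mem _⟩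
    | add x y hx hy =>
      obtain ⟨k, hk⟩ := hx
      obtain ⟨l, hl⟩ := hy
      -- Further subdivision keeps chains small, so a common number of steps works for both
      -- summands.
      refine ⟨k + l, ?_⟩
      rw [hlinIter, map_add, ← hlinIter]
      exact Submodule.add_mem _ (add_comm k l ▸ hmono x k l hk) (hmono y l k hl)
    | single s m =>
      let σ := simplexEquiv T n s
      have hcover : (Set.univ : Set (TopSimplex n)) ⊆
          ⋃ b : Bool, σ ⁻¹' (if b then U else V) := by
        intro t _
        have ht : σ t ∈ U ∪ V := h ▸ Set.mem_univ _
        rw [Set.mem_iUnion]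
        exact ht.elim (fun h => ⟨true, h⟩) fun h => ⟨false, h⟩
      -- `δ` is a Lebesgue number of the cover pulled back to the simplex. The vertices start at
      -- mutual distance at most `1`, and each step shrinks this by `n / (n + 1)`.
      obtain ⟨δ, hδ, H⟩ := lebesgue_number_lemma_of_metric (isCompact_univ (X := TopSimplex n))
        (fun b => by cases b; exacts [hV.preimage σ.continuous, hU.preimage σ.continuous]) hcover
      obtain ⟨k, hk⟩ := exists_pow_lt_of_lt_one hδ
        (show (n : ℝ) / (n + 1) < 1 by rw [div_lt_one (by positivity)]; linarith)
      refine ⟨k, ?_⟩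
      rw [← mul_one m, ← smul_eq_mul (α := ℤ), ← Finsupp.smul_single, hlinIter, map_smul, ← hlinIter]
      refine Submodule.smul_mem _ _ ?_
      have hit : ∀ c, (singularSd T n)^[k] (Finsupp.mapDomain (push s n) c) =
          Finsupp.mapDomain (push s n) ((tuples.sd bar n)^[k] c) :=
        fun c => (Function.Semiconj.iterate_right (f := Finsupp.mapDomain (push s n))
          (ga := tuples.sd bar n) (gb := singularSd T n)
          (fun c => (singularSd_push s c).symm) k c).symm
      rw [single_eq_push, hit]
      refine mapDomain_push_mem ?_ (sd_iterate_mem_meshLE n k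
        (Finsupp.single_mem_supported ℤ _ (vertices_mem_meshLE n)))
      intro p hp
      -- A simplex of mesh below `δ` lies in the ball of radius `δ` around its first vertex, since
      -- balls are convex.
      obtain ⟨b, hb⟩ := H (p (0 : Fin (n + 1))) (Set.mem_univ _)
      have hp' (t : TopSimplex n) : simplexEquiv T n (push s n p) t ∈ if b then U else V := by
        rw [simplexEquiv_push]
        refine hb (Metric.mem_ball.2 (lt_of_le_of_lt (dist_comb_le_of_forall p t _ _
          (fun i => hp i 0)) ?_))
        rwa [mul_one]
      cases b
      · exact Or.inr hp'
      · exact Or.inl hp'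

end TopCat

/-! ### Excision for open covers, and collars. -/

namespace TopCat

open SSet Topology

section singularIn

variable {S T : TopCat.{u}}

/-- The map between singular simplicial sets of subsets that is induced by a continuous map. -/
noncomputable def singularInMap (f : S ⟶ T) {P : Set S} {Q : Set T} (h : ∀ x ∈ P, f x ∈ Q) :
    (singularIn S P : SSet.{u}) ⟶ singularIn T Q where
  app _ := ↾fun s => ⟨(toSSet.map f).app _ s.1, fun t => h _ (s.2 t)⟩
  naturality _ _ _ := rfl

lemma singularInMap_ι (f : S ⟶ T) {P : Set S} {Q : Set T} (h : ∀ x ∈ P, f x ∈ Q) :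
    singularInMap f h ≫ (singularIn T Q).ι = (singularIn S P).ι ≫ toSSet.map f := rfl

lemma isIso_of_bijective {X Y : SSet.{u}} (f : X ⟶ Y)
    (h : ∀ n : ℕ, Function.Bijective (f.app (op ⦋n⦌))) : IsIso f := by
  rw [NatTrans.isIso_iff_isIso_app]
  rintro ⟨n⟩
  exact (isIso_iff_bijective _).2 (h n.len)

/-- The map from singular simplices of a space to those of a subset containing the image. -/
noncomputable def singularLift (f : S ⟶ T) {Q : Set T} (h : ∀ x, f x ∈ Q) :
    toSSet.obj S ⟶ (singularIn T Q : SSet.{u}) where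
  app _ := ↾fun s => ⟨(toSSet.map f).app _ s, fun _ => h _⟩
  naturality _ _ _ := rfl

lemma singularLift_ι (f : S ⟶ T) {Q : Set T} (h : ∀ x, f x ∈ Q) :
    singularLift f h ≫ (singularIn T Q).ι = toSSet.map f := rfl

lemma singularLift_ι_assoc (f : S ⟶ T) {Q : Set T} (h : ∀ x, f x ∈ Q) {Z : SSet.{u}}
    (g : toSSet.obj T ⟶ Z) :
    singularLift f h ≫ (singularIn T Q).ι ≫ g = toSSet.map f ≫ g := rfl

lemma isIso_singularLift (f : S ⟶ T) {Q : Set T} (h : ∀ x, f x ∈ Q) (hf : IsEmbedding f)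
    (hQ : Q ⊆ Set.range f) : IsIso (singularLift f h) := by
  refine isIso_of_bijective _ fun n => ⟨fun s s' hs => ?_, ?_⟩
  · refine (simplexEquiv S n).injective (ContinuousMap.ext fun t => hf.injective ?_)
    exact congrArg (fun s => simplexEquiv T n s t) (congrArg Subtype.val hs)
  · rintro ⟨s, hs⟩
    let g : C(TopSimplex n, Set.range f) :=
      ⟨fun t => ⟨simplexEquiv T n s t, hQ (hs t)⟩, by fun_prop⟩
    refine ⟨(simplexEquiv S n).symm ⟨fun t => hf.toHomeomorph.symm (g t), by fun_prop⟩, ?_⟩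
    refine Subtype.ext ((simplexEquiv T n).injective (ContinuousMap.ext fun t => ?_))
    exact congrArg Subtype.val (hf.toHomeomorph.apply_symm_apply (g t))

/-- The inclusion of a subspace. -/
def inclusion (P : Set S) : TopCat.of P ⟶ S := TopCat.ofHom ⟨Subtype.val, continuous_subtype_val⟩

lemma inclusion_mem (P : Set S) (x : TopCat.of P) : inclusion P x ∈ P := Subtype.prop x

lemma isIso_singularLift_inclusion (P : Set S) :
    IsIso (singularLift (inclusion P) (inclusion_mem P)) :=
  isIso_singularLift _ _ IsEmbedding.subtypeVal fun x hx => ⟨⟨x, hx⟩, rfl⟩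

lemma isIso_singularInMap (f : S ⟶ T) {P : Set S} {Q : Set T} (h : ∀ x ∈ P, f x ∈ Q)
    (hf : IsEmbedding fun x : P => f x) (hQ : Q ⊆ f '' P) : IsIso (singularInMap f h) := by
  have := isIso_singularLift_inclusion P
  have : IsIso (singularLift (inclusion P) (inclusion_mem P) ≫
      singularInMap f h) :=
    isIso_singularLift (inclusion P ≫ f) (fun x => h _ (Subtype.prop x)) hf (by
      rintro y hy
      obtain ⟨x, hx, rfl⟩ := hQ hy
      exact ⟨⟨x, hx⟩, rfl⟩)
  exact IsIso.of_isIso_comp_left (singularLift (inclusion P) (inclusion_mem P)) _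

lemma singularIn_mono {P Q : Set T} (h : P ⊆ Q) : singularIn T P ≤ singularIn T Q :=
  fun _ _ hs t => h (hs t)

/-- Excision for a cover by two open sets. -/
lemma excisive_of_isOpen {U V : Set T} (hU : IsOpen U) (hV : IsOpen V) (h : U ∪ V = Set.univ)
    (sq : CommSq (Subcomplex.homOfLE (singularIn_mono (T := T) (Set.inter_subset_left (s := U) (t := V))))
      (Subcomplex.homOfLE (singularIn_mono (T := T) Set.inter_subset_right))
      (singularIn T U).ι (singularIn T V).ι) : Excisive sq := by
  have hsq : Subcomplex.BicartSq (singularIn T (U ∩ V)) (singularIn T U) (singularIn T V)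
      (singularIn T U ⊔ singularIn T V) :=
    { sup_eq := rfl
      inf_eq := by
        ext n s
        exact forall_and.symm }
  -- The union of the two subcomplexes is their pushout over the intersection; the theorem of small
  -- simplices then replaces this union by all singular simplices.
  let sq' : CommSq (𝟙 _) (Subcomplex.homOfLE (hsq.le₂₄)) (singularIn T U).ι
      (singularIn T U ⊔ singularIn T V).ι := ⟨rfl⟩
  have h₁ := excisive_of_isPushout hsq.isPushout
  have h₂ : Excisive sq' := excisive_of_homologyIso _ (homologyIso_of_isIso _)
    (homologyIso_singularIn_sup hU hV h)
  exact (excisive_comp h₁ h₂).congr _ (Category.comp_id _) rfl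

end singularIn

/-- A closed embedding with a neighbourhood that deforms to its image, by a deformation of the
whole space. -/
structure Collar {A B : TopCat.{u}} (i : A ⟶ B) where
  isClosedEmbedding : IsClosedEmbedding i
  /-- The neighbourhood. -/
  nhd : Set B
  isOpen : IsOpen nhd
  subset : ∀ a, i a ∈ nhd
  /-- The deformation. -/
  H : C(unitInterval × B, B)
  zero : ∀ b, H (0, b) = b
  rel : ∀ s a, H (s, i a) = i a
  mapsTo : ∀ s, ∀ b ∈ nhd, H (s, b) ∈ nhd
  one : ∀ b ∈ nhd, H (1, b) ∈ Set.range i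

lemma homologyIso_of_homotopyEquiv {A B : TopCat.{u}} {f : A ⟶ B} {g : B ⟶ A}
    (h : TopCat.Homotopy (f ≫ g) (𝟙 A)) (h' : TopCat.Homotopy (g ≫ f) (𝟙 B)) :
    homologyIso (toSSet.map f) := by
  refine homologyIso_of_homotopy (g := toSSet.map g) ?_ ?_
  · rw [← Functor.map_comp, ← toSSet.map_id]
    exact h.toSSet
  · rw [← Functor.map_comp, ← toSSet.map_id]
    exact h'.toSSet

instance {A B : TopCat.{u}} (i : A ⟶ B) [Mono i] : Mono (toSSet.map i) := inferInstance

namespace Collar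

variable {A B : TopCat.{u}} {i : A ⟶ B} (h : Collar i)

lemma mono (h : Collar i) : Mono i := (TopCat.mono_iff_injective _).2 h.isClosedEmbedding.injective

/-- The end of the deformation retracts the neighbourhood onto `A`, and the deformation itself,
which preserves the neighbourhood, makes the inclusion of `A` a homotopy equivalence. -/
lemma homologyIso_singularLift : homologyIso (singularLift i h.subset) := by
  let j : C(A, h.nhd) := ⟨fun a => ⟨i a, h.subset a⟩, by fun_prop⟩
  let ρ : C(h.nhd, A) := ⟨fun x =>
    h.isClosedEmbedding.toHomeomorph.symm ⟨h.H (1, x.1), h.one x.1 x.2⟩, by fun_prop⟩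
  have hρ (x : h.nhd) : i (ρ x) = h.H (1, x.1) := congrArg Subtype.val
    (h.isClosedEmbedding.toHomeomorph.apply_symm_apply ⟨h.H (1, x.1), h.one x.1 x.2⟩)
  have hjρ : ρ.comp j = ContinuousMap.id A := by
    ext a
    exact h.isClosedEmbedding.injective ((hρ _).trans (h.rel 1 a))
  let K : (ContinuousMap.id h.nhd).Homotopy (j.comp ρ) :=
    { toFun := fun p => ⟨h.H (p.1, p.2.1), h.mapsTo _ _ p.2.2⟩
      continuous_toFun := by fun_prop
      map_zero_left := fun x => Subtype.ext (h.zero _)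
      map_one_left := fun x => Subtype.ext (hρ x).symm }
  let K₀ : (ρ.comp j).Homotopy (ContinuousMap.id A) := hjρ ▸ ContinuousMap.Homotopy.refl _
  have hj : homologyIso (toSSet.map (TopCat.ofHom j)) :=
    homologyIso_of_homotopyEquiv (A := A) (B := TopCat.of h.nhd) (f := TopCat.ofHom j)
      (g := TopCat.ofHom ρ) K₀ K.symm
  have := isIso_singularLift_inclusion h.nhd
  have e : singularLift i h.subset = toSSet.map (TopCat.ofHom j) ≫
      singularLift (inclusion h.nhd) (inclusion_mem h.nhd) := by
    rw [← cancel_mono (singularIn B h.nhd).ι, Category.assoc, singularLift_ι, singularLift_ι,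
      ← Functor.map_comp]
    rfl
  rw [e]
  exact homologyIso.comp_mem _ _ hj (homologyIso_of_isIso _)

end Collar

/-! ### Pushouts of spaces along closed embeddings. -/

section pushout

variable {A B X Y : TopCat.{u}} {f : A ⟶ X} {i : A ⟶ B} {r : X ⟶ Y} {b : B ⟶ Y}

lemma isPushout_cases (hp : IsPushout f i r b) (y : Y) : (∃ x, r x = y) ∨ ∃ z, b z = y :=
  Types.eq_or_eq_of_isPushout (hp.map (forget TopCat)) y

lemma isPushout_w (hp : IsPushout f i r b) (a : A) : r (f a) = b (i a) := ConcreteCategory.congr_hom hp.w a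

lemma isPushout_isOpen_iff (hp : IsPushout f i r b) (U : Set Y) : IsOpen U ↔ IsOpen (r ⁻¹' U) ∧ IsOpen (b ⁻¹' U) := by
  refine ⟨fun h => ⟨h.preimage r.hom.continuous, h.preimage b.hom.continuous⟩, fun h => ?_⟩
  refine (isOpen_iff_of_isColimit _ hp.isColimit U).2 fun j => ?_
  obtain (_ | _ | _) := j
  · have : IsOpen (f ⁻¹' (r ⁻¹' U)) := h.1.preimage f.hom.continuous
    exact this
  · exact h.1
  · exact h.2

/-- The predicate "equal to `z`" on `B` and the false predicate on `X` agree on `A`, so they descend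
to a predicate on `Y` that separates `b z` from the images of all other points of `B`. -/
lemma isPushout_eq_of_notMem (hp : IsPushout f i r b) {z z' : B} (hz : z ∉ Set.range i) (h : b z' = b z) : z' = z := by
  classical
  have h' := hp.map (forget TopCat)
  let χ : (forget TopCat).obj B ⟶ ULift.{u} Prop := ↾fun z' => ULift.up (z' = z)
  let ψ : (forget TopCat).obj X ⟶ ULift.{u} Prop := ↾fun _ => ULift.up False
  have hw : (forget TopCat).map f ≫ ψ = (forget TopCat).map i ≫ χ := by
    ext a
    exact (iff_false_intro fun h => hz ⟨a, h⟩).symm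
  have hd (x : B) : h'.desc ψ χ hw (b x) = ULift.up (x = z) :=
    ConcreteCategory.congr_hom (h'.inr_desc ψ χ hw) x
  have := congrArg ULift.down ((hd z').symm.trans ((congrArg _ h).trans (hd z)))
  exact this.mpr rfl

lemma isPushout_eq_iff (hp : IsPushout f i r b)
    (hi : IsClosedEmbedding i) (x : X) (z : B) : r x = b z ↔ ∃ a, f a = x ∧ i a = z := by
  have h := Types.pushoutCocone_inl_eq_inr_iff_of_isColimit
    (hp.map (forget TopCat)).flip.isColimit hi.injective z x
  refine eq_comm.trans (h.trans (exists_congr fun a => and_comm))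

lemma isPushout_injective (hp : IsPushout f i r b)
    (hi : IsClosedEmbedding i) : Function.Injective r :=
  Types.pushoutCocone_inr_injective_of_isColimit
    (hp.map (forget TopCat)).flip.isColimit hi.injective

lemma isPushout_mem_range_iff (hp : IsPushout f i r b)
    (hi : IsClosedEmbedding i) (z : B) : b z ∈ Set.range r ↔ z ∈ Set.range i := by
  constructor
  · rintro ⟨x, hx⟩
    obtain ⟨a, -, ha⟩ := (isPushout_eq_iff hp hi x z).1 hx
    exact ⟨a, ha⟩
  · rintro ⟨a, rfl⟩
    exact ⟨f a, isPushout_w hp a⟩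

lemma isPushout_isClosedEmbedding (hp : IsPushout f i r b)
    (hi : IsClosedEmbedding i) : IsClosedEmbedding r := by
  refine .of_continuous_injective_isClosedMap r.hom.continuous (isPushout_injective hp hi)
    fun C hC => ?_
  rw [← isOpen_compl_iff, isPushout_isOpen_iff hp]
  have h₁ : r ⁻¹' (r '' C) = C := Set.preimage_image_eq _ (isPushout_injective hp hi)
  have h₂ : b ⁻¹' (r '' C) = i '' (f ⁻¹' C) := by
    ext z
    constructor
    · rintro ⟨x, hx, hxz⟩
      obtain ⟨a, rfl, rfl⟩ := (isPushout_eq_iff hp hi x z).1 hxz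
      exact ⟨a, hx, rfl⟩
    · rintro ⟨a, ha, rfl⟩
      exact ⟨f a, ha, isPushout_w hp a⟩
  rw [Set.preimage_compl, Set.preimage_compl]
  constructor
  · rw [isOpen_compl_iff]
    exact h₁.symm ▸ hC
  · rw [isOpen_compl_iff]
    exact h₂.symm ▸ hi.isClosedMap _ (hC.preimage f.hom.continuous)

lemma isPushout_isOpen_image (hp : IsPushout f i r b)
    (hi : IsClosedEmbedding i) {O : Set B} (hO : IsOpen O) (h : Disjoint O (Set.range i)) :
    IsOpen (b '' O) := by
  rw [isPushout_isOpen_iff hp]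
  have h₁ : r ⁻¹' (b '' O) = ∅ := by
    rw [Set.eq_empty_iff_forall_notMem]
    rintro x ⟨z, hz, hzx⟩
    exact Set.disjoint_left.1 h hz ((isPushout_mem_range_iff hp hi z).1 ⟨x, hzx.symm⟩)
  have h₂ : b ⁻¹' (b '' O) = O := by
    refine Set.Subset.antisymm ?_ (Set.subset_preimage_image _ _)
    rintro z ⟨z', hz', hzz⟩
    rwa [isPushout_eq_of_notMem hp (Set.disjoint_left.1 h hz') hzz.symm]
  exact ⟨h₁.symm ▸ isOpen_empty, h₂.symm ▸ hO⟩

/-- Away from `A` nothing is glued: an open set there is the full preimage of its image, which is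
therefore open in `Y`. -/
lemma isPushout_isEmbedding (hp : IsPushout f i r b)
    (hi : IsClosedEmbedding i) {P : Set B} (hP : IsOpen P) (h : Disjoint P (Set.range i)) :
    IsEmbedding fun x : P => b x := by
  refine (IsOpenEmbedding.of_continuous_injective_isOpenMap
    (b.hom.continuous.comp continuous_subtype_val) ?_ ?_).isEmbedding
  · intro x y hxy
    exact Subtype.ext (isPushout_eq_of_notMem hp (Set.disjoint_left.1 h y.2) hxy)
  · intro O hO
    refine (Set.image_comp b Subtype.val O).symm ▸ isPushout_isOpen_image hp hi (hP.isOpenMap_subtype_val _ hO)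
      (h.mono_left (Subtype.coe_image_subset _ _))

end pushout

end TopCat

/-! ### Collars of pushouts and excision for cell attachments. -/

namespace TopCat

open SSet Topology

namespace Collar

variable {A B X Y : TopCat.{u}} {f : A ⟶ X} {i : A ⟶ B} {r : X ⟶ Y} {b : B ⟶ Y}
  (h : Collar i) (hp : IsPushout f i r b)

/-- The deformation of a pushout, as a map to the path space. -/
noncomputable def pushoutPath : Y ⟶ TopCat.of C(unitInterval, Y) :=
  hp.desc (TopCat.ofHom ((ContinuousMap.const' (X := unitInterval)).comp r.hom))
    (TopCat.ofHom (b.hom.comp (h.H.comp .prodSwap)).curry) (by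
      ext a : 1
      refine ContinuousMap.ext fun s => ?_
      change r (f a) = b (h.H (s, i a))
      rw [h.rel, isPushout_w hp])

lemma pushoutPath_left (x : X) (s : unitInterval) :
    (show C(unitInterval, Y) from h.pushoutPath hp (r x)) s = r x :=
  DFunLike.congr_fun (ConcreteCategory.congr_hom (hp.inl_desc
    (TopCat.ofHom ((ContinuousMap.const' (X := unitInterval)).comp r.hom)) _ _) x) s

lemma pushoutPath_right (z : B) (s : unitInterval) :
    (show C(unitInterval, Y) from h.pushoutPath hp (b z)) s = b (h.H (s, z)) :=
  DFunLike.congr_fun (ConcreteCategory.congr_hom (hp.inr_desc _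
    (TopCat.ofHom (b.hom.comp (h.H.comp .prodSwap)).curry) _) z) s

/-- Collars are stable under pushouts. -/
noncomputable def pushout : Collar r where
  isClosedEmbedding := isPushout_isClosedEmbedding hp h.isClosedEmbedding
  nhd := Set.range r ∪ b '' h.nhd
  isOpen := by
    rw [isPushout_isOpen_iff hp]
    constructor
    · convert isOpen_univ
      exact Set.eq_univ_of_forall fun x => Or.inl ⟨x, rfl⟩
    · convert h.isOpen
      ext z
      constructor
      · rintro (hz | ⟨z', hz', hz⟩)
        · obtain ⟨a, rfl⟩ := (isPushout_mem_range_iff hp h.isClosedEmbedding z).1 hz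
          exact h.subset a
        · by_cases hzi : z ∈ Set.range i
          · obtain ⟨a, rfl⟩ := hzi
            exact h.subset a
          · rwa [← isPushout_eq_of_notMem hp hzi hz]
      · exact fun hz => Or.inr ⟨z, hz, rfl⟩
  subset x := Or.inl ⟨x, rfl⟩
  -- The path space lets the universal property of `Y` itself produce the homotopy, without a
  -- pushout description of `unitInterval × Y`; uncurrying is continuous because the interval is
  -- locally compact.
  H := (ContinuousMap.uncurry (h.pushoutPath hp).hom).comp .prodSwap
  zero y := by
    obtain ⟨x, rfl⟩ | ⟨z, rfl⟩ := isPushout_cases hp y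
    · exact h.pushoutPath_left hp x 0
    · exact (h.pushoutPath_right hp z 0).trans (congrArg b (h.zero z))
  rel s x := h.pushoutPath_left hp x s
  mapsTo := by
    rintro s _ (⟨x, rfl⟩ | ⟨z, hz, rfl⟩)
    · exact Or.inl ⟨x, (h.pushoutPath_left hp x s).symm⟩
    · exact Or.inr ⟨_, h.mapsTo s z hz, (h.pushoutPath_right hp z s).symm⟩
  one := by
    rintro _ (⟨x, rfl⟩ | ⟨z, hz, rfl⟩)
    · exact ⟨x, (h.pushoutPath_left hp x 1).symm⟩
    · obtain ⟨a, ha⟩ := h.one z hz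
      refine ⟨f a, (isPushout_w hp a).trans ?_⟩
      rw [ha]
      exact (h.pushoutPath_right hp z 1).symm

/-- Pushouts along collared maps are excisive. -/
theorem excisive (h : Collar i) (hp : IsPushout f i r b)
    (sq : CommSq (toSSet.map f) (toSSet.map i) (toSSet.map r) (toSSet.map b)) :
    Excisive sq := by
  let h' := h.pushout hp
  have hi := h.isClosedEmbedding
  have hr := h'.isClosedEmbedding
  have := h.mono
  have := h'.mono
  have hUV {S T : TopCat.{u}} {j : S ⟶ T} (k : Collar j) :
      k.nhd ∪ (Set.range j)ᶜ = Set.univ := by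
    refine Set.eq_univ_of_forall fun x => ?_
    by_cases hx : x ∈ Set.range j
    · obtain ⟨a, rfl⟩ := hx
      exact Or.inl (k.subset a)
    · exact Or.inr hx
  have hN : ∀ z ∈ h.nhd, b z ∈ h'.nhd := fun z hz => Or.inr ⟨z, hz, rfl⟩
  have hV : ∀ z ∈ (Set.range i)ᶜ, b z ∈ (Set.range r)ᶜ := fun z hz hbz =>
    hz ((isPushout_mem_range_iff hp hi z).1 hbz)
  have hNV : ∀ z ∈ h.nhd ∩ (Set.range i)ᶜ, b z ∈ h'.nhd ∩ (Set.range r)ᶜ := fun z hz =>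
    ⟨hN z hz.1, hV z hz.2⟩
  have hemb {P : Set B} (hP : IsOpen P) (hPi : P ⊆ (Set.range i)ᶜ) :=
    isPushout_isEmbedding hp hi hP (Set.disjoint_left.2 hPi)
  -- Off the images of `A` and `X`, the map `b` is a homeomorphism, also after restriction to the
  -- collar neighbourhoods.
  have i₁ : IsIso (singularInMap b hV) := by
    refine isIso_singularInMap b hV (hemb hi.isClosed_range.isOpen_compl subset_rfl) fun y hy => ?_
    obtain ⟨x, rfl⟩ | ⟨z, rfl⟩ := isPushout_cases hp y
    · exact absurd ⟨x, rfl⟩ hy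
    · exact ⟨z, fun hz => hy ((isPushout_mem_range_iff hp hi z).2 hz), rfl⟩
  have i₂ : IsIso (singularInMap b hNV) := by
    refine isIso_singularInMap b hNV
      (hemb (h.isOpen.inter hi.isClosed_range.isOpen_compl) Set.inter_subset_right) ?_
    rintro _ ⟨⟨x, rfl⟩ | ⟨z, hz, rfl⟩, hy⟩
    · exact absurd ⟨x, rfl⟩ hy
    · exact ⟨z, ⟨hz, fun hz => hy ((isPushout_mem_range_iff hp hi z).2 hz)⟩, rfl⟩
  have eB := excisive_of_isOpen h.isOpen hi.isClosed_range.isOpen_compl (hUV h) ⟨rfl⟩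
  have eY := excisive_of_isOpen h'.isOpen hr.isClosed_range.isOpen_compl (hUV h') ⟨rfl⟩
  have sq₂ : CommSq (singularInMap b hN) (singularIn B h.nhd).ι (singularIn Y h'.nhd).ι
      (toSSet.map b) := ⟨rfl⟩
  have e₅ : Excisive (CommSq.mk rfl : CommSq (singularInMap b hNV)
      (Subcomplex.homOfLE (singularIn_mono (T := B) Set.inter_subset_right))
      (Subcomplex.homOfLE (singularIn_mono (T := Y) Set.inter_subset_right))
      (singularInMap b hV)) :=
    excisive_of_homologyIso _ (homologyIso_of_isIso _) (homologyIso_of_isIso _)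
  -- Removing the closed images turns `(B, h.nhd)` and `(Y, h'.nhd)` into pairs that `b` identifies.
  -- It remains to shrink the neighbourhoods to `A` and `X` by `e₁` and `e₃`.
  have e₂ : Excisive sq₂ := excisive_of_comp_left eB
    ((excisive_comp e₅ eY).congr _ rfl rfl)
  have e₁ : Excisive (CommSq.mk (by simp [singularLift_ι]) : CommSq (singularLift i h.subset)
      (toSSet.map i) (singularIn B h.nhd).ι (𝟙 _)) :=
    excisive_of_homologyIso _ h.homologyIso_singularLift (homologyIso_of_isIso _)
  have e₃ : Excisive (CommSq.mk (by simp [singularLift_ι]) : CommSq (singularLift r h'.subset)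
      (toSSet.map r) (singularIn Y h'.nhd).ι (𝟙 _)) :=
    excisive_of_homologyIso _ h'.homologyIso_singularLift (homologyIso_of_isIso _)
  refine excisive_of_comp_right e₃ ((excisive_comp e₁ e₂).congr _ ?_ ?_)
  · rw [← cancel_mono (singularIn Y h'.nhd).ι, Category.assoc, Category.assoc, singularInMap_ι,
      singularLift_ι, singularLift_ι_assoc, ← Functor.map_comp, ← Functor.map_comp, hp.w]
  · rw [Category.id_comp, Category.comp_id]

end Collar

end TopCat

/-! ### Sequential colimits and coproducts of spaces. -/

namespace TopCat

open SSet Topology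

section sequence

variable {F : ℕ ⥤ TopCat.{u}} {c : Cocone F}

lemma isClosedEmbedding_of_sequence 
    (hF : ∀ n, IsClosedEmbedding (F.map (homOfLE (Nat.le_succ n)))) {m n : ℕ} (f : m ⟶ n) : IsClosedEmbedding (F.map f) := by
  obtain ⟨k, rfl⟩ := Nat.exists_eq_add_of_le f.le
  induction k with
  | zero =>
    have : F.map f = 𝟙 _ := F.map_id m
    rw [this]
    exact IsClosedEmbedding.id
  | succ k ih =>
    have : F.map f = F.map (homOfLE (Nat.le_add_right m k)) ≫ F.map (homOfLE (Nat.le_succ _)) := by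
      rw [← F.map_comp]
      rfl
    rw [this]
    exact (hF (m + k)).comp (ih _)

lemma exists_of_sequence (hc : IsColimit c) (y : c.pt) : ∃ n x, c.ι.app n x = y :=
  Types.jointly_surjective_of_isColimit (isColimitOfPreserves (forget TopCat) hc) y

lemma eq_iff_of_sequence (hc : IsColimit c) {m n : ℕ} (x : F.obj m) (y : F.obj n) : c.ι.app m x = c.ι.app n y ↔
    ∃ (k : ℕ) (f : m ⟶ k) (g : n ⟶ k), F.map f x = F.map g y :=
  Types.FilteredColimit.isColimit_eq_iff _ (isColimitOfPreserves (forget TopCat) hc)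

lemma ι_map_of_sequence (c : Cocone F) {m n : ℕ} (f : m ⟶ n) (x : F.obj m) :
    c.ι.app n (F.map f x) = c.ι.app m x :=
  ConcreteCategory.congr_hom (c.w f) x

lemma ι_injective_of_sequence (hc : IsColimit c)
    (hF : ∀ n, IsClosedEmbedding (F.map (homOfLE (Nat.le_succ n)))) (n : ℕ) : Function.Injective (c.ι.app n) := by
  intro x y h
  obtain ⟨k, f, g, h⟩ := (eq_iff_of_sequence hc x y).1 h
  obtain rfl := Subsingleton.elim f g
  exact (isClosedEmbedding_of_sequence hF f).injective h

lemma ι_isClosedEmbedding_of_sequence (hc : IsColimit c)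
    (hF : ∀ n, IsClosedEmbedding (F.map (homOfLE (Nat.le_succ n)))) (n : ℕ) : IsClosedEmbedding (c.ι.app n) := by
  refine .of_continuous_injective_isClosedMap (c.ι.app n).hom.continuous
    (ι_injective_of_sequence hc hF n) fun C hC => ?_
  refine (isClosed_iff_of_isColimit c hc _).2 fun m => ?_
  have hm : m ≤ max m n := le_max_left _ _
  have hn : n ≤ max m n := le_max_right _ _
  have : c.ι.app m ⁻¹' (c.ι.app n '' C) =
      F.map (homOfLE hm) ⁻¹' (F.map (homOfLE hn) '' C) := by
    ext x
    constructor
    · rintro ⟨y, hy, hxy⟩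
      refine ⟨y, hy, ι_injective_of_sequence hc hF (max m n) ?_⟩
      rwa [ι_map_of_sequence, ι_map_of_sequence]
    · rintro ⟨y, hy, hxy⟩
      refine ⟨y, hy, ?_⟩
      rw [← ι_map_of_sequence c (homOfLE hn), hxy, ι_map_of_sequence]
  rw [this]
  exact ((isClosedEmbedding_of_sequence hF _).isClosedMap _ hC).preimage
    (F.map (homOfLE hm)).hom.continuous

/-- Otherwise choose `y n` in `K` outside stage `n`. Each stage contains only finitely many of these
points, so by `T₁` every set of them is closed. They form a closed discrete subset of a compact set,
hence a finite one, which lies in a single stage `N`, contrary to the choice of `y N`. -/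
lemma exists_subset_range_of_isCompact (hc : IsColimit c)
    (hF : ∀ n, IsClosedEmbedding (F.map (homOfLE (Nat.le_succ n)))) [∀ n, T1Space (F.obj n)] {K : Set c.pt} (hK : IsCompact K) :
    ∃ n, K ⊆ Set.range (c.ι.app n) := by
  by_contra! h
  have h' (n : ℕ) : ∃ y ∈ K, y ∉ Set.range (c.ι.app n) := Set.not_subset.1 (h n)
  choose y hy hy' using h'
  have hle {m n : ℕ} (hmn : m ≤ n) {z : c.pt} (hz : z ∈ Set.range (c.ι.app m)) :
      z ∈ Set.range (c.ι.app n) := by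
    obtain ⟨x, rfl⟩ := hz
    exact ⟨F.map (homOfLE hmn) x, ι_map_of_sequence _ _ _⟩
  have hfin (m : ℕ) : {z | z ∈ Set.range (c.ι.app m) ∧ z ∈ Set.range y}.Finite := by
    refine ((Set.finite_lt_nat m).image y).subset ?_
    rintro _ ⟨hz, n, rfl⟩
    exact ⟨n, not_le.1 fun hmn => hy' n (hle hmn hz), rfl⟩
  have hclosed (D : Set c.pt) (hD : D ⊆ Set.range y) : IsClosed D := by
    refine (isClosed_iff_of_isColimit c hc _).2 fun m => Set.Finite.isClosed ?_
    refine Set.Finite.preimage (ι_injective_of_sequence hc hF m).injOn ?_ |>.subset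
      (s := c.ι.app m ⁻¹' {z | z ∈ Set.range (c.ι.app m) ∧ z ∈ Set.range y}) ?_
    · exact hfin m
    · exact fun x hx => ⟨⟨x, rfl⟩, hD hx⟩
  have hdisc : DiscreteTopology (Set.range y) := by
    refine discreteTopology_iff_forall_isClosed.2 fun D => ?_
    refine isClosed_induced_iff.2 ⟨Subtype.val '' D, hclosed _ (Subtype.coe_image_subset _ _),
      Set.preimage_image_eq _ Subtype.val_injective⟩
  have hrange : (Set.range y).Finite := by
    have hc : IsCompact (Set.range y) := hK.of_isClosed_subset (hclosed _ subset_rfl)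
      (Set.range_subset_iff.2 hy)
    have := isCompact_iff_compactSpace.1 hc
    exact finite_of_compact_of_discrete (X := Set.range y)
  obtain ⟨N, hN⟩ : ∃ N, Set.range y ⊆ Set.range (c.ι.app N) := by
    choose m x hx using exists_of_sequence hc
    obtain ⟨N, hN⟩ := (hrange.image m).bddAbove
    refine ⟨N, fun z hz => hle (hN ⟨z, hz, rfl⟩) ⟨x z, hx z⟩⟩
  exact hy' N (hN ⟨N, rfl⟩)

end sequence

section coproduct

/-- Geometric realization is compatible with coproducts. -/
noncomputable def sigmaIsoToTop {I : Type u} (F : I → SSet.{u}) :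
    TopCat.of (Σ a, (SSet.toTop.obj (F a) : TopCat.{u})) ≅ SSet.toTop.obj (∐ F) :=
  (sigmaIsoSigma.{u, u} fun a => SSet.toTop.obj (F a)).symm ≪≫
    (PreservesCoproduct.iso SSet.toTop F).symm

lemma sigmaIsoToTop_hom_apply {I : Type u} (F : I → SSet.{u}) (a : I) (x : SSet.toTop.obj (F a)) :
    (sigmaIsoToTop F).hom ⟨a, x⟩ = SSet.toTop.map (Sigma.ι F a) x := by
  have h : Sigma.ι (fun a => SSet.toTop.obj (F a)) a ≫ (PreservesCoproduct.iso SSet.toTop F).inv =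
      SSet.toTop.map (Sigma.ι F a) := by
    simp
  have h' : (sigmaIsoSigma.{u, u} fun a => SSet.toTop.obj (F a)).inv ⟨a, x⟩ =
      Sigma.ι (fun a => SSet.toTop.obj (F a)) a x := sigmaIsoSigma_inv_apply _ _ _
  exact (congrArg (PreservesCoproduct.iso SSet.toTop F).inv h').trans
    (ConcreteCategory.congr_hom h x)

end coproduct

end TopCat

/-! ### Points of realizations and subcomplexes of a simplex. -/

namespace SSet

open Topology

section realize

variable {X Y : SSet.{u}} {m n : ℕ}

/-- The characteristic map of a simplex. -/
noncomputable def realize (s : X _⦋m⦌) : C(TopSimplex m, (SSet.toTop.obj X : TopCat.{u})) :=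
  TopCat.simplexEquiv _ m ((sSetTopAdj.unit.app X).app _ s)

lemma simplexEquiv_app_map {T : TopCat.{u}} (φ : X ⟶ TopCat.toSSet.obj T) (s : X _⦋n⦌)
    (f : ⦋m⦌ ⟶ ⦋n⦌) : TopCat.simplexEquiv T m (φ.app _ (X.map f.op s)) =
      (TopCat.simplexEquiv T n (φ.app _ s)).comp ⟨_, stdSimplex.continuous_map f⟩ := by
  rw [NatTrans.naturality_apply φ f.op s, TopCat.simplexEquiv_map]

lemma realize_map (s : X _⦋n⦌) (f : ⦋m⦌ ⟶ ⦋n⦌) :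
    realize (X.map f.op s) = (realize s).comp ⟨_, stdSimplex.continuous_map f⟩ :=
  simplexEquiv_app_map _ s f

lemma realize_map_apply (s : X _⦋n⦌) (f : ⦋m⦌ ⟶ ⦋n⦌) (t : TopSimplex m) :
    realize (X.map f.op s) t = realize s (stdSimplex.map f t) := by
  rw [realize_map]
  rfl

lemma toTop_map_realize (g : X ⟶ Y) (s : X _⦋m⦌) (t : TopSimplex m) :
    SSet.toTop.map g (realize s t) = realize (g.app _ s) t := by
  have h' : sSetTopAdj.unit.app X ≫ TopCat.toSSet.map (SSet.toTop.map g) =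
      g ≫ sSetTopAdj.unit.app Y := (sSetTopAdj.unit.naturality g).symm
  have h : (TopCat.toSSet.map (SSet.toTop.map g)).app (op ⦋m⦌) ((sSetTopAdj.unit.app X).app _ s) =
      (sSetTopAdj.unit.app Y).app _ (g.app _ s) :=
    congrArg (fun φ : X ⟶ TopCat.toSSet.obj (SSet.toTop.obj Y) => φ.app (op ⦋m⦌) s) h'
  rw [realize, realize, ← h, TopCat.simplexEquiv_toSSet_map]
  rfl

lemma toTop_hom_ext {T : TopCat.{u}} {a b : SSet.toTop.obj X ⟶ T}
    (h : ∀ (m : ℕ) (s : X _⦋m⦌) (t : TopSimplex m), a (realize s t) = b (realize s t)) : a = b := by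
  apply (sSetTopAdj.homEquiv X T).injective
  rw [Adjunction.homEquiv_unit, Adjunction.homEquiv_unit]
  refine NatTrans.ext (funext fun ⟨k⟩ => ?_)
  ext s
  exact (TopCat.simplexEquiv T k.len).injective (ContinuousMap.ext fun t => h k.len s t)

/-- Every function to an indiscrete space is continuous, so the predicate "is realized" and the true
predicate are two maps out of `|X|` that agree on all realized points; hence they are equal. -/
lemma exists_realize (y : SSet.toTop.obj X) : ∃ (m : ℕ) (s : X _⦋m⦌) (t : TopSimplex m),
    realize s t = y := by
  let P : Type u := ULift.{u} Prop
  let : TopologicalSpace P := ⊤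
  let a : SSet.toTop.obj X ⟶ TopCat.of P := TopCat.ofHom ⟨fun _ => ULift.up True, continuous_top⟩
  let b : SSet.toTop.obj X ⟶ TopCat.of P := TopCat.ofHom ⟨fun y => ULift.up (∃ (m : ℕ) (s : X _⦋m⦌)
    (t : TopSimplex m), realize s t = y), continuous_top⟩
  have hab : a = b := toTop_hom_ext fun m s t =>
    congrArg ULift.up (eq_true ⟨m, s, t, rfl⟩).symm
  exact of_eq_true (congrArg ULift.down (ConcreteCategory.congr_hom hab y)).symm

instance (X : SSet.{u}) [X.Finite] : CompactSpace (SSet.toTop.obj X : TopCat.{u}) := by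
  let f : (Σ x : X.N, TopSimplex x.dim) → (SSet.toTop.obj X : TopCat.{u}) :=
    fun p => realize p.1.simplex p.2
  have hf : Continuous f := continuous_sigma fun x => (realize x.simplex).continuous
  refine isCompact_univ_iff.1 (Set.image_univ_of_surjective (f := f) (fun y => ?_) ▸
    isCompact_univ.image hf)
  obtain ⟨m, s, t, rfl⟩ := exists_realize y
  obtain ⟨k, g, _, ⟨x, hx⟩, rfl⟩ := X.exists_nonDegenerate s
  exact ⟨⟨N.mk x hx, stdSimplex.map g t⟩, (realize_map_apply x g t).symm⟩

lemma toTopHomeo_realize {d : ℕ} (s : (Δ[d] : SSet.{u}) _⦋m⦌) (t : TopSimplex m) :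
    SimplexCategory.toTopHomeo ⦋d⦌ (realize s t) =
      stdSimplex.map (stdSimplex.objEquiv s) t := by
  have h : realize s t = SSet.toTop.map (SSet.stdSimplex.map (stdSimplex.objEquiv s))
      ((SimplexCategory.toTopHomeo ⦋m⦌).symm t) :=
    congrArg (fun g : SimplexCategory.toTop.obj ⦋m⦌ ⟶ SSet.toTop.obj (Δ[d] : SSet.{u}) =>
      g (ULift.up t)) (sSetTopAdj_unit_app_app_down _ _ s)
  rw [h, SimplexCategory.toTopHomeo_naturality_apply]
  exact congrArg _ ((SimplexCategory.toTopHomeo ⦋m⦌).apply_symm_apply t)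

end realize

end SSet

namespace TopSimplex

open SSet

variable {m n : ℕ}

lemma map_apply (f : Fin (m + 1) → Fin (n + 1)) (t : TopSimplex m) (j : Fin (n + 1)) :
    (stdSimplex.map f t : TopSimplex n) j = ∑ i with f i = j, t i :=
  FunOnFinite.linearMap_apply_apply _ _ _ _ _

lemma map_apply_of_injective {f : Fin (m + 1) → Fin (n + 1)} (hf : Function.Injective f)
    (t : TopSimplex m) (i : Fin (m + 1)) : (stdSimplex.map f t : TopSimplex n) (f i) = t i := by
  rw [map_apply, Finset.sum_eq_single_of_mem i (by simp)]
  intro j hj hji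
  exact absurd (hf (Finset.mem_filter.1 hj).2) hji

lemma map_injective {f : Fin (m + 1) → Fin (n + 1)} (hf : Function.Injective f) :
    Function.Injective (stdSimplex.map (S := ℝ) f) := by
  intro t t' h
  ext i
  rw [← map_apply_of_injective hf, h, map_apply_of_injective hf]

lemma map_apply_pos_iff (f : Fin (m + 1) → Fin (n + 1)) {t : TopSimplex m} (ht : ∀ i, 0 < t i)
    (j : Fin (n + 1)) : 0 < (stdSimplex.map f t : TopSimplex n) j ↔ j ∈ Set.range f := by
  rw [map_apply]
  constructor
  · intro h
    obtain ⟨i, hi, -⟩ := Finset.exists_ne_zero_of_sum_ne_zero h.ne'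
    exact ⟨i, (Finset.mem_filter.1 hi).2⟩
  · rintro ⟨i, rfl⟩
    exact Finset.sum_pos (fun i _ => ht i) ⟨i, by simp⟩

/-- Every point lies in the interior of a face. -/
lemma exists_interior (t : TopSimplex m) : ∃ (k : ℕ) (f : ⦋k⦌ ⟶ ⦋m⦌) (t' : TopSimplex k),
    Function.Injective f.toOrderHom ∧ (∀ i, 0 < t' i) ∧ stdSimplex.map f.toOrderHom t' = t := by
  classical
  let S : Finset (Fin (m + 1)) := {i | 0 < t i}
  have hne : S.Nonempty := by
    by_contra h
    have h0 : ∑ i, t i = 0 := Finset.sum_eq_zero fun i _ =>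
      le_antisymm (not_lt.1 fun hi => h ⟨i, by simpa [S] using hi⟩) (t.2.1 i)
    exact zero_ne_one (h0.symm.trans t.2.2)
  obtain ⟨k, hk⟩ : ∃ k, S.card = k + 1 := ⟨_, (Nat.succ_pred_eq_of_pos hne.card_pos).symm⟩
  let e := S.orderEmbOfFin hk
  have he (i) : 0 < t (e i) := (Finset.mem_filter.1 (S.orderEmbOfFin_mem hk i)).2
  have hr (j : Fin (m + 1)) (hj : j ∉ Set.range e) : t j = 0 := by
    rw [Finset.range_orderEmbOfFin] at hj
    exact le_antisymm (not_lt.1 fun h => hj (by simpa [S] using h)) (t.2.1 j)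
  let t' : TopSimplex k := ⟨fun i => t (e i), fun i => (he i).le, by
    rw [← t.2.2]
    exact Fintype.sum_of_injective e e.injective _ _ hr fun _ => rfl⟩
  refine ⟨k, SimplexCategory.mkHom e.toOrderHom, t', e.injective, he, ?_⟩
  ext j
  by_cases hj : j ∈ Set.range e
  · obtain ⟨i, rfl⟩ := hj
    exact map_apply_of_injective e.injective t' i
  · rw [hr j hj]
    refine le_antisymm (not_lt.1 fun h => hj ?_) (Subtype.prop (stdSimplex.map e t' : TopSimplex m)|>.1 j)
    exact (map_apply_pos_iff e (t := t') he j).1 h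

end TopSimplex

namespace SSet

open Topology

section subcomplex

variable {d : ℕ} (A : (Δ[d] : SSet.{u}).Subcomplex)

/-- A point of `|A|` over the interior of the face `g` is realized on `g` itself. In any
representation by a simplex `s` of `A` and an interior point of a face `f`, the vertices hit by `f ≫
s` are those of `g`. Hence `g` factors through `s`, so it belongs to `A`, and `f ≫ s` factors
through `g`. -/
lemma exists_realize_of_range (y : SSet.toTop.obj (A : SSet.{u})) {k : ℕ} (g : ⦋k⦌ ⟶ ⦋d⦌)
    (hg : Function.Injective g.toOrderHom)
    (hr : ∀ j, 0 < SimplexCategory.toTopHomeo ⦋d⦌ (SSet.toTop.map A.ι y) j ↔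
      j ∈ Set.range g.toOrderHom) :
    ∃ (s : (A : SSet.{u}) _⦋k⦌) (t : TopSimplex k), stdSimplex.objEquiv s.1 = g ∧
      realize s t = y := by
  obtain ⟨m, s, t, rfl⟩ := exists_realize y
  obtain ⟨m', f, t, hf, ht, rfl⟩ := TopSimplex.exists_interior t
  have hgm : StrictMono g.toOrderHom := g.toOrderHom.monotone.strictMono_of_injective hg
  have hs : SimplexCategory.toTopHomeo ⦋d⦌ (SSet.toTop.map A.ι (realize s
      (stdSimplex.map f.toOrderHom t))) =
      stdSimplex.map (f ≫ stdSimplex.objEquiv s.1).toOrderHom t := by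
    rw [toTop_map_realize, toTopHomeo_realize]
    exact (stdSimplex.map_comp_apply _ _ _)
  have hr' (j) : j ∈ Set.range (f ≫ stdSimplex.objEquiv s.1).toOrderHom ↔
      j ∈ Set.range g.toOrderHom := by
    rw [← hr, hs]
    exact (TopSimplex.map_apply_pos_iff _ ht j).symm
  choose q hq using fun i => (hr' _).2 ⟨i, rfl⟩
  -- The chosen preimages are automatically increasing, because `g` is strictly increasing and a
  -- monotone map reflects strict inequalities.
  have hqm : Monotone fun i => f.toOrderHom (q i) := by
    refine StrictMono.monotone fun i j hij => ?_
    refine (stdSimplex.objEquiv s.1).toOrderHom.monotone.reflect_lt ?_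
    exact (hq i).trans_lt ((hgm hij).trans_eq (hq j).symm)
  choose e he using fun i => (hr' _).1 ⟨i, rfl⟩
  have hem : Monotone e := fun i j hij => by
    refine hgm.le_iff_le.1 ((he i).trans_le (le_trans ?_ (he j).ge))
    exact (f ≫ stdSimplex.objEquiv s.1).toOrderHom.monotone hij
  let q' : ⦋k⦌ ⟶ ⦋m⦌ := SimplexCategory.mkHom ⟨_, hqm⟩
  let e' : ⦋m'⦌ ⟶ ⦋k⦌ := SimplexCategory.mkHom ⟨_, hem⟩
  have hq' : q' ≫ stdSimplex.objEquiv s.1 = g := by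
    ext i : 3
    exact hq i
  have he' : e' ≫ g = f ≫ stdSimplex.objEquiv s.1 := by
    ext i : 3
    exact he i
  have hfe : (A : SSet.{u}).map e'.op ((A : SSet.{u}).map q'.op s) =
      (A : SSet.{u}).map f.op s := by
    refine Subtype.ext (stdSimplex.objEquiv.injective ?_)
    change e' ≫ q' ≫ stdSimplex.objEquiv s.1 = f ≫ stdSimplex.objEquiv s.1
    rw [hq', he']
  refine ⟨(A : SSet.{u}).map q'.op s, stdSimplex.map e'.toOrderHom t, hq', ?_⟩
  refine (realize_map_apply _ e' t).symm.trans ?_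
  rw [hfe]
  exact realize_map_apply s f t

/-- The common image lies in the interior of one face `g`. Both points are then realized on the same
simplex `g` of `A`, and the affine map of an injective `g` is injective. -/
lemma toTop_map_ι_injective : Function.Injective (SSet.toTop.map A.ι) := by
  intro y y' h
  obtain ⟨k, g, t, hg, ht, hgt⟩ :=
    TopSimplex.exists_interior (SimplexCategory.toTopHomeo ⦋d⦌ (SSet.toTop.map A.ι y))
  have hr (j) : 0 < SimplexCategory.toTopHomeo ⦋d⦌ (SSet.toTop.map A.ι y) j ↔
      j ∈ Set.range g.toOrderHom := by
    rw [← hgt]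
    exact TopSimplex.map_apply_pos_iff _ ht j
  obtain ⟨s, x, hs, rfl⟩ := exists_realize_of_range A y g hg hr
  obtain ⟨s', x', hs', rfl⟩ := exists_realize_of_range A y' g hg (by rwa [← h])
  obtain rfl : s = s' := Subtype.ext (stdSimplex.objEquiv.injective (hs.trans hs'.symm))
  congr 1
  rw [toTop_map_realize, toTop_map_realize] at h
  have h' := (toTopHomeo_realize _ x).symm.trans ((congrArg _ h).trans (toTopHomeo_realize _ x'))
  refine TopSimplex.map_injective ?_ h'
  exact hs.symm ▸ hg

instance : T2Space (SSet.toTop.obj (Δ[d] : SSet.{u}) : TopCat.{u}) :=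
  (SimplexCategory.toTopHomeo ⦋d⦌).symm.t2Space

lemma toTop_map_ι_isClosedEmbedding : IsClosedEmbedding (SSet.toTop.map A.ι) :=
  (SSet.toTop.map A.ι).hom.continuous.isClosedEmbedding (toTop_map_ι_injective A)

lemma range_toTop_map_boundary_ι (x : SSet.toTop.obj (Δ[d] : SSet.{u})) :
    x ∈ Set.range (SSet.toTop.map (∂Δ[d] : (Δ[d] : SSet.{u}).Subcomplex).ι) ↔
      ∃ i, SimplexCategory.toTopHomeo ⦋d⦌ x i = 0 := by
  constructor
  · rintro ⟨y, rfl⟩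
    obtain ⟨m, s, t, rfl⟩ := exists_realize y
    obtain ⟨m', f, t, hf, ht, rfl⟩ := TopSimplex.exists_interior t
    have hs : ¬ Function.Surjective (stdSimplex.objEquiv s.1).toOrderHom := s.2
    rw [Function.Surjective, not_forall] at hs
    obtain ⟨i, hi⟩ := hs
    refine ⟨i, ?_⟩
    rw [toTop_map_realize, toTopHomeo_realize]
    refine (TopSimplex.map_apply _ _ _).trans (Finset.sum_eq_zero fun j hj => ?_)
    exact absurd ⟨j, (Finset.mem_filter.1 hj).2⟩ hi
  · rintro ⟨i, hi⟩
    obtain ⟨k, g, t, hg, ht, hgt⟩ :=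
      TopSimplex.exists_interior (SimplexCategory.toTopHomeo ⦋d⦌ x)
    have hmem : stdSimplex.objEquiv.symm g ∈
        (∂Δ[d] : (Δ[d] : SSet.{u}).Subcomplex).obj (op ⦋k⦌) := by
      intro hsurj
      refine ((TopSimplex.map_apply_pos_iff g.toOrderHom ht i).2 (hsurj i)).ne' ?_
      exact (congrArg (fun u : TopSimplex d => u i) hgt).trans hi
    refine ⟨realize (X := (∂Δ[d] : SSet.{u})) (m := k) ⟨_, hmem⟩ t, ?_⟩
    apply (SimplexCategory.toTopHomeo ⦋d⦌).injective
    refine Eq.trans ?_ hgt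
    exact (congrArg _ (toTop_map_realize _ _ _)).trans (toTopHomeo_realize _ _)

end subcomplex

end SSet

/-! ### The collar of the boundary of a simplex. -/

namespace TopSimplex

variable {d : ℕ}

/-- The least barycentric coordinate, cut off. -/
noncomputable def level (t : TopSimplex d) : ℝ :=
  -- The cutoff is half the coordinates of the barycenter; it keeps the denominator in `pushOut` at
  -- least `1 / 2`.
  min (Finset.univ.inf' Finset.univ_nonempty fun i => t i) (1 / (2 * (d + 1)))

lemma continuous_level : Continuous (level (d := d)) := by
  refine Continuous.min (Continuous.finset_inf'_apply _ fun i _ => ?_) continuous_const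
  exact (continuous_apply i).comp continuous_subtype_val

lemma level_nonneg (t : TopSimplex d) : 0 ≤ level t :=
  le_min (Finset.le_inf' _ _ fun i _ => t.2.1 i) (by positivity)

lemma level_le (t : TopSimplex d) (i : Fin (d + 1)) : level t ≤ t i :=
  (min_le_left _ _).trans (Finset.inf'_le _ (Finset.mem_univ i))

lemma level_mul_le (t : TopSimplex d) : (d + 1) * level t ≤ 1 / 2 := by
  have h : level t ≤ 1 / (2 * (d + 1)) := min_le_right _ _
  refine (mul_le_mul_of_nonneg_left h (by positivity)).trans_eq ?_
  field_simp

lemma mul_level_le (s : unitInterval) (t : TopSimplex d) : (s : ℝ) * level t ≤ level t :=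
  mul_le_of_le_one_left (level_nonneg t) s.2.2

lemma one_sub_pos (s : unitInterval) (t : TopSimplex d) :
    0 < 1 - (d + 1) * ((s : ℝ) * level t) := by
  have h := mul_le_mul_of_nonneg_left (mul_level_le s t) (by positivity : (0 : ℝ) ≤ d + 1)
  linarith [level_mul_le t]

lemma exists_eq_level {t : TopSimplex d} (h : ∃ i, t i < 1 / (2 * (d + 1))) :
    ∃ i, t i = level t := by
  obtain ⟨i, -, hi⟩ := Finset.exists_mem_eq_inf' (Finset.univ_nonempty (α := Fin (d + 1)))
    fun i => t i
  refine ⟨i, ?_⟩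
  rw [level, hi, min_eq_left]
  obtain ⟨j, hj⟩ := h
  exact hi.symm.trans_le ((Finset.inf'_le _ (Finset.mem_univ j)).trans hj.le)

/-- The deformation that pushes points near the boundary to the boundary. -/
noncomputable def pushOut : C(unitInterval × TopSimplex d, TopSimplex d) where
  -- Subtracting the same amount from all coordinates and rescaling moves the point away from the
  -- barycenter along a ray. At time `1` a least coordinate below the cutoff becomes zero.
  toFun p := ⟨fun i => (p.2 i - p.1 * level p.2) / (1 - (d + 1) * (p.1 * level p.2)), by
    refine ⟨fun i => div_nonneg
      (sub_nonneg.2 ((mul_level_le _ _).trans (level_le _ i))) (one_sub_pos _ _).le, ?_⟩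
    rw [← Finset.sum_div, Finset.sum_sub_distrib, div_eq_one_iff_eq (one_sub_pos _ _).ne']
    have : ∑ i, p.2 i = 1 := p.2.2.2
    rw [this]
    simp⟩
  continuous_toFun := by
    refine Continuous.subtype_mk (continuous_pi fun i => Continuous.div ?_ ?_ fun p => ?_) _
    · have := continuous_level (d := d)
      have h : Continuous fun p : unitInterval × TopSimplex d => p.2 i :=
        (continuous_apply i).comp (continuous_subtype_val.comp continuous_snd)
      fun_prop
    · have := continuous_level (d := d)
      fun_prop
    · exact (one_sub_pos _ _).ne'

lemma pushOut_apply (s : unitInterval) (t : TopSimplex d) (i : Fin (d + 1)) :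
    pushOut (s, t) i = (t i - s * level t) / (1 - (d + 1) * (s * level t)) := rfl

lemma pushOut_of_mul_eq_zero {s : unitInterval} {t : TopSimplex d} (h : s * level t = 0) :
    pushOut (s, t) = t := by
  ext i
  rw [pushOut_apply, h, mul_zero, sub_zero, sub_zero, div_one]

/-- Coordinates below those of the barycenter do not increase when a point moves away from the
barycenter. -/
lemma pushOut_lt (s : unitInterval) {t : TopSimplex d} {i : Fin (d + 1)}
    (h : t i < 1 / (2 * (d + 1))) : pushOut (s, t) i < 1 / (2 * (d + 1)) := by
  have h₄ : 0 ≤ (s : ℝ) * level t := mul_nonneg s.2.1 (level_nonneg t)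
  rw [pushOut_apply, div_lt_iff₀ (one_sub_pos s t)]
  have h₅ : (1 : ℝ) / (2 * (d + 1)) * (1 - (d + 1) * (s * level t)) =
      1 / (2 * (d + 1)) - s * level t / 2 := by
    field_simp
  rw [h₅]
  linarith

end TopSimplex

namespace SSet

/-- The boundary of a simplex has a collar. -/
noncomputable def boundaryCollar (d : ℕ) :
    TopCat.Collar (SSet.toTop.map (∂Δ[d] : (Δ[d] : SSet.{u}).Subcomplex).ι) where
  isClosedEmbedding := toTop_map_ι_isClosedEmbedding _
  nhd := {x | ∃ i, SimplexCategory.toTopHomeo ⦋d⦌ x i < 1 / (2 * (d + 1))}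
  isOpen := by
    rw [Set.ofPred_exists]
    refine isOpen_iUnion fun i => isOpen_lt ?_ continuous_const
    exact (continuous_apply i).comp
      (continuous_subtype_val.comp (SimplexCategory.toTopHomeo ⦋d⦌).continuous)
  subset a := by
    obtain ⟨i, hi⟩ := (range_toTop_map_boundary_ι _).1 ⟨a, rfl⟩
    exact ⟨i, hi.trans_lt (by positivity)⟩
  H := ⟨fun p => (SimplexCategory.toTopHomeo ⦋d⦌).symm
    (TopSimplex.pushOut (p.1, SimplexCategory.toTopHomeo ⦋d⦌ p.2)), by fun_prop⟩
  zero b := by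
    refine (Homeomorph.symm_apply_eq _).2 (TopSimplex.pushOut_of_mul_eq_zero ?_)
    exact zero_mul _
  rel s a := by
    refine (Homeomorph.symm_apply_eq _).2 (TopSimplex.pushOut_of_mul_eq_zero ?_)
    obtain ⟨i, hi⟩ := (range_toTop_map_boundary_ι _).1 ⟨a, rfl⟩
    rw [le_antisymm ((TopSimplex.level_le _ i).trans_eq hi) (TopSimplex.level_nonneg _), mul_zero]
  mapsTo s b := by
    rintro ⟨i, hi⟩
    refine ⟨i, ?_⟩
    change SimplexCategory.toTopHomeo ⦋d⦌ ((SimplexCategory.toTopHomeo ⦋d⦌).symm _) i < _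
    rw [Homeomorph.apply_symm_apply]
    exact TopSimplex.pushOut_lt s hi
  one b hb := by
    rw [range_toTop_map_boundary_ι]
    obtain ⟨i, hi⟩ := TopSimplex.exists_eq_level hb
    refine ⟨i, ?_⟩
    change SimplexCategory.toTopHomeo ⦋d⦌ ((SimplexCategory.toTopHomeo ⦋d⦌).symm _) i = _
    rw [Homeomorph.apply_symm_apply]
    refine (TopSimplex.pushOut_apply _ _ _).trans ?_
    rw [Set.Icc.coe_one, one_mul, hi, sub_self, zero_div]

end SSet

/-! ### Geometric realization followed by singular simplices is cellular. -/

namespace TopCat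

open SSet Topology

/-- The disjoint union of a family of maps. -/
def sigmaMap {I : Type u} {A B : I → TopCat.{u}} (i : ∀ a, A a ⟶ B a) :
    TopCat.of (Σ a, A a) ⟶ TopCat.of (Σ a, B a) :=
  TopCat.ofHom ⟨Sigma.map id fun a => i a, Continuous.sigma_map fun a => (i a).hom.continuous⟩

lemma isClosedEmbedding_sigmaMap {I : Type u} {A B : I → TopCat.{u}} {i : ∀ a, A a ⟶ B a}
    (h : ∀ a, IsClosedEmbedding (i a)) : IsClosedEmbedding (sigmaMap i) := by
  refine .of_continuous_injective_isClosedMap (sigmaMap i).hom.continuous ?_ fun C hC => ?_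
  · rintro ⟨a, x⟩ ⟨b, y⟩ hxy
    obtain rfl : a = b := congrArg Sigma.fst hxy
    exact congrArg (Sigma.mk a) ((h a).injective (eq_of_heq (Sigma.mk.inj hxy).2))
  · refine isClosed_sigma_iff.2 fun a => ?_
    have : (fun y : B a => (⟨a, y⟩ : Σ a, B a)) ⁻¹' (sigmaMap i '' C) =
        i a '' ((fun x : A a => (⟨a, x⟩ : Σ a, A a)) ⁻¹' C) := by
      ext y
      constructor
      · rintro ⟨⟨a', x⟩, hx, hxy⟩
        obtain rfl : a' = a := congrArg Sigma.fst hxy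
        exact ⟨x, hx, eq_of_heq (Sigma.mk.inj hxy).2⟩
      · rintro ⟨x, hx, rfl⟩
        exact ⟨⟨a, x⟩, hx, rfl⟩
    exact this.symm ▸ (h a).isClosedMap _ (isClosed_sigma_iff.1 hC a)

/-- Collars of disjoint unions. -/
noncomputable def Collar.sigma {I : Type u} {A B : I → TopCat.{u}} {i : ∀ a, A a ⟶ B a}
    (h : ∀ a, Collar (i a)) : Collar (sigmaMap i) where
  isClosedEmbedding := isClosedEmbedding_sigmaMap fun a => (h a).isClosedEmbedding
  nhd := {p | p.2 ∈ (h p.1).nhd}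
  isOpen := isOpen_sigma_iff.2 fun a => (h a).isOpen
  subset p := (h p.1).subset p.2
  H := ⟨fun p => ⟨p.2.1, (h p.2.1).H (p.1, p.2.2)⟩, by
      let f : (Σ a, B a × unitInterval) → Σ a, B a := Sigma.map id fun a p => (h a).H (p.2, p.1)
      have hf : Continuous f := Continuous.sigma_map fun a => by fun_prop
      exact hf.comp (Homeomorph.sigmaProdDistrib.continuous.comp continuous_swap)⟩
  zero p := congrArg (Sigma.mk p.1) ((h p.1).zero p.2)
  rel s p := congrArg (Sigma.mk p.1) ((h p.1).rel s p.2)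
  mapsTo s p hp := (h p.1).mapsTo s p.2 hp
  one p hp := by
    obtain ⟨x, hx⟩ := (h p.1).one p.2 hp
    exact ⟨⟨p.1, x⟩, congrArg (Sigma.mk p.1) hx⟩

/-- A topological simplex is connected, so a singular simplex of a disjoint union lies in one
summand; it is nonempty, so in only one. -/
lemma isDisjointUnion_toTop {I : Type u} (F : I → SSet.{u}) :
    IsDisjointUnion fun a => toSSet.map (SSet.toTop.map (Sigma.ι F a)) := by
  intro n
  let e := homeoOfIso (sigmaIsoToTop F)
  have he (a : I) (s : (toSSet.obj (SSet.toTop.obj (F a))) _⦋n⦌) (t : TopSimplex n) :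
      simplexEquiv _ n ((toSSet.map (SSet.toTop.map (Sigma.ι F a))).app _ s) t =
        e ⟨a, simplexEquiv _ n s t⟩ := (sigmaIsoToTop_hom_apply F a _).symm
  constructor
  · rintro ⟨a, s⟩ ⟨b, s'⟩ h
    have h' (t : TopSimplex n) : (⟨a, simplexEquiv _ n s t⟩ : Σ a, SSet.toTop.obj (F a)) =
        ⟨b, simplexEquiv _ n s' t⟩ := e.injective <|
      (he a s t).symm.trans ((congrArg (fun s => simplexEquiv _ n s t) h).trans (he b s' t))
    obtain rfl := congrArg Sigma.fst (h' (Classical.arbitrary _))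
    congr 1
    exact (simplexEquiv _ n).injective (ContinuousMap.ext fun t => eq_of_heq (Sigma.mk.inj (h' t)).2)
  · intro s
    obtain ⟨a, g, hg⟩ := ContinuousMap.exists_lift_sigma
      ((⟨e.symm, e.symm.continuous⟩ : C(_, _)).comp (simplexEquiv _ n s))
    refine ⟨⟨a, (simplexEquiv _ n).symm g⟩, (simplexEquiv _ n).injective (ContinuousMap.ext fun t => ?_)⟩
    refine (he a _ t).trans ?_
    rw [Equiv.apply_symm_apply]
    exact (e.symm_apply_eq.1 (ContinuousMap.congr_fun hg t)).symm

open relativeCellComplexOfMono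

/-- The collar of the boundaries of the cells of a given dimension. -/
noncomputable def cellCollar (Y : SSet.{u}) (d : ℕ) :
    Collar (SSet.toTop.map (l (⊥ : Y.Subcomplex).ι d)) :=
  (Collar.sigma fun _ : Cell (⊥ : Y.Subcomplex).ι d => boundaryCollar d).pushout
    (f := (sigmaIsoToTop fun _ => (∂Δ[d] : SSet.{u})).hom) (b := (sigmaIsoToTop fun _ => Δ[d]).hom)
    -- A commutative square with invertible horizontal maps is a pushout, so the collar passes from
    -- a disjoint union of realizations to the realization of the coproduct.
    (IsPushout.of_horiz_isIso ⟨by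
      ext ⟨a, x⟩
      refine (congrArg _ (sigmaIsoToTop_hom_apply (fun _ => (∂Δ[d] : SSet.{u})) a x)).trans
        (Eq.trans ?_ (sigmaIsoToTop_hom_apply _ a _).symm)
      have h := congrArg (fun g => SSet.toTop.map g) (Cell.ι_l a)
      simp only [Functor.map_comp] at h
      exact ConcreteCategory.congr_hom h x⟩)

lemma isPushout_skeleton (Y : SSet.{u}) (d : ℕ) :
    IsPushout (SSet.toTop.map (t (⊥ : Y.Subcomplex).ι d)) (SSet.toTop.map (l _ d))
      (SSet.toTop.map (r _ d)) (SSet.toTop.map (b _ d)) :=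
  (isPushout _ d).map SSet.toTop

/-- The collar of a skeleton in the next skeleton. -/
noncomputable def skeletonCollar (Y : SSet.{u}) (d : ℕ) :
    Collar (SSet.toTop.map (r (⊥ : Y.Subcomplex).ι d)) :=
  (cellCollar Y d).pushout (isPushout_skeleton Y d)

end TopCat

namespace TopCat

open SSet Topology

open relativeCellComplexOfMono

/-- An old point stays closed because the previous stage is closed. A new point has empty preimage
in the previous stage and a single preimage among the cells, which form a Hausdorff space. -/
lemma t1Space_toTop_skeleton (Y : SSet.{u}) (d : ℕ) :
    T1Space (SSet.toTop.obj (skeletonOfMono (⊥ : Y.Subcomplex).ι d : SSet.{u}) : TopCat.{u}) := by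
  induction d with
  | zero =>
    have : IsEmpty (SSet.toTop.obj (skeletonOfMono (⊥ : Y.Subcomplex).ι 0 : SSet.{u}) : TopCat.{u}) := by
      refine ⟨fun y => ?_⟩
      obtain ⟨m, s, t, rfl⟩ := exists_realize y
      have : s.1 ∈ (⊥ : Y.Subcomplex).obj _ := by
        have e : skeletonOfMono (⊥ : Y.Subcomplex).ι 0 ≤ ⊥ := by simp
        exact e _ s.2
      exact this
    exact ⟨fun y => this.elim y⟩
  | succ d ih =>
    have hp := isPushout_skeleton Y d
    have hi := (cellCollar Y d).isClosedEmbedding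
    have hS : T2Space (SSet.toTop.obj (sigmaStdSimplex (⊥ : Y.Subcomplex).ι d) : TopCat.{u}) :=
      have : T2Space (TopCat.of (Σ _ : Cell (⊥ : Y.Subcomplex).ι d, (SSet.toTop.obj Δ[d] : TopCat.{u}))) :=
        inferInstanceAs (T2Space (Σ _ : Cell (⊥ : Y.Subcomplex).ι d, (SSet.toTop.obj Δ[d] : TopCat.{u})))
      (homeoOfIso (sigmaIsoToTop fun _ : Cell (⊥ : Y.Subcomplex).ι d => Δ[d])).t2Space
    refine ⟨fun y => ?_⟩
    by_cases hy : y ∈ Set.range (SSet.toTop.map (r (⊥ : Y.Subcomplex).ι d))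
    · obtain ⟨x, rfl⟩ := hy
      rw [← Set.image_singleton]
      exact (isPushout_isClosedEmbedding hp hi).isClosedMap _ isClosed_singleton
    · obtain ⟨z, rfl⟩ := (isPushout_cases hp y).resolve_left hy
      have hz := (isPushout_mem_range_iff hp hi z).not.1 hy
      rw [← isOpen_compl_iff, isPushout_isOpen_iff hp]
      refine ⟨?_, ?_⟩
      · convert isOpen_univ
        exact Set.eq_univ_of_forall fun x hx => hy ⟨x, hx⟩
      · convert (isClosed_singleton (x := z)).isOpen_compl
        ext z'
        exact not_congr ⟨isPushout_eq_of_notMem hp hz, congrArg _⟩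

/-- The image of a singular simplex is compact, hence inside a finite stage, and it lifts there
continuously because the stages are closed embeddings. -/
lemma isFiltration_toTop (Y : SSet.{u}) :
    IsFiltration fun d => toSSet.map (SSet.toTop.map (skeletonOfMono (⊥ : Y.Subcomplex).ι d).ι) := by
  let c := relativeCellComplexOfMono (⊥ : Y.Subcomplex).ι
  have hc : IsColimit (SSet.toTop.mapCocone (Cocone.mk Y c.incl)) :=
    isColimitOfPreserves SSet.toTop c.isColimit
  have hF (n : ℕ) : IsClosedEmbedding ((c.F ⋙ SSet.toTop).map (homOfLE (Nat.le_succ n))) :=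
    (skeletonCollar Y n).isClosedEmbedding
  have hcl (n : ℕ) :
      IsClosedEmbedding (SSet.toTop.map (skeletonOfMono (⊥ : Y.Subcomplex).ι n).ι) :=
    ι_isClosedEmbedding_of_sequence hc hF n
  have hT (n : ℕ) : T1Space ((c.F ⋙ SSet.toTop).obj n) := t1Space_toTop_skeleton Y n
  exact
    { mono := fun d => by
        have := (TopCat.mono_iff_injective _).2 (hcl d).injective
        infer_instance
      succ := fun d => ⟨toSSet.map (SSet.toTop.map (r _ d)), by
        rw [← Functor.map_comp, ← Functor.map_comp]
        rfl⟩
      exists_simplex := fun n s => by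
        obtain ⟨d, hd⟩ := exists_subset_range_of_isCompact hc hF
          (isCompact_range (simplexEquiv _ n s).continuous)
        have hd' (t) : simplexEquiv _ n s t ∈
            Set.range (SSet.toTop.map (skeletonOfMono (⊥ : Y.Subcomplex).ι d).ι) := hd ⟨t, rfl⟩
        refine ⟨d, (simplexEquiv _ n).symm ⟨fun t => (hcl d).toHomeomorph.symm ⟨_, hd' t⟩, by
          fun_prop⟩, (simplexEquiv _ n).injective (ContinuousMap.ext fun t => ?_)⟩
        exact congrArg Subtype.val ((hcl d).toHomeomorph.apply_symm_apply ⟨_, hd' t⟩) }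

lemma isCellular_toTop : IsCellular (SSet.toTop.{u} ⋙ toSSet) where
  isDisjointUnion F := isDisjointUnion_toTop F
  mono_l Y d := by
    have := (cellCollar Y d).mono
    exact inferInstanceAs (Mono (toSSet.map _))
  mono_r Y d := by
    have := (skeletonCollar Y d).mono
    exact inferInstanceAs (Mono (toSSet.map _))
  excisive Y d := (cellCollar Y d).excisive (isPushout_skeleton Y d) _
  isFiltration Y := isFiltration_toTop Y

end TopCat

/-! ### The unit of realization and singular simplices. -/

namespace SSet

open MonoidalCategory CartesianMonoidalCategory

lemma subsingleton_toTop (X : SSet.{u}) [∀ n : ℕ, Unique (X _⦋n⦌)] :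
    Subsingleton (SSet.toTop.obj X : TopCat.{u}) := by
  have h (y : SSet.toTop.obj X) : y = realize (default : X _⦋0⦌) default := by
    obtain ⟨m, s, t, rfl⟩ := exists_realize y
    rw [Subsingleton.elim s (X.map (SimplexCategory.const ⦋m⦌ ⦋0⦌ 0).op (default : X _⦋0⦌)),
      realize_map_apply]
    exact congrArg _ (Subsingleton.elim (α := TopSimplex 0) _ _)
  exact ⟨fun y y' => (h y).trans (h y').symm⟩

lemma isIso_unit_of_unique (X : SSet.{u}) [∀ n : ℕ, Unique (X _⦋n⦌)] :
    IsIso (sSetTopAdj.unit.app X) := by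
  refine TopCat.isIso_of_bijective _ fun n => ?_
  have := subsingleton_toTop X
  have : Subsingleton ((TopCat.toSSet.obj (SSet.toTop.obj X)) _⦋n⦌) :=
    ⟨fun s s' => (TopCat.simplexEquiv _ n).injective
      (ContinuousMap.ext fun t => Subsingleton.elim _ _)⟩
  exact ⟨fun _ _ _ => Subsingleton.elim (α := X _⦋n⦌) _ _, fun s =>
    ⟨(default : X _⦋n⦌), this.elim _ _⟩⟩

instance (n : ℕ) : Unique ((Δ[0] : SSet.{u}) _⦋n⦌) where
  default := stdSimplex.const 0 0 _
  uniq s := stdSimplex.objEquiv.injective (by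
    ext i : 3
    exact Subsingleton.elim (α := Fin 1) _ _)

lemma homologyIso_toUnit_stdSimplex (d : ℕ) : homologyIso (toUnit (Δ[d] : SSet.{u})) := by
  have : toUnit (Δ[d] : SSet.{u}) = (λ_ Δ[d]).inv ≫ fst _ _ := toUnit_unique _ _
  rw [this]
  exact homologyIso.comp_mem _ _ (homologyIso_of_isIso _) (homologyIso_fst_stdSimplex _ d)

/-- The projection `Δ[d] ⟶ Δ[0]` is a homology isomorphism before and after applying `Sing |-|`, by
contractibility. On `Δ[0]` the unit is an isomorphism, so naturality and two out of three finish the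
argument. -/
lemma homologyIso_unit_stdSimplex (d : ℕ) : homologyIso (sSetTopAdj.unit.app (Δ[d] : SSet.{u})) := by
  let p : (Δ[d] : SSet.{u}) ⟶ Δ[0] := SSet.stdSimplex.map (SimplexCategory.const _ ⦋0⦌ 0)
  have hp : homologyIso p := by
    refine homologyIso.of_postcomp _ (toUnit Δ[0]) (homologyIso_toUnit_stdSimplex 0) ?_
    rw [toUnit_unique (p ≫ toUnit _) (toUnit _)]
    exact homologyIso_toUnit_stdSimplex d
  have : ContractibleSpace (SSet.toTop.obj (Δ[d] : SSet.{u}) : TopCat.{u}) := by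
    have : ContractibleSpace (TopSimplex d) :=
      (convex_stdSimplex ℝ (Fin (d + 1))).contractibleSpace ⟨_, (Classical.arbitrary (TopSimplex d)).2⟩
    exact (SimplexCategory.toTopHomeo ⦋d⦌).contractibleSpace
  have hp' : homologyIso (TopCat.toSSet.map (SSet.toTop.map p)) := by
    obtain ⟨x, ⟨h⟩⟩ := id_nullhomotopic (SSet.toTop.obj (Δ[d] : SSet.{u}) : TopCat.{u})
    let q : SSet.toTop.obj (Δ[0] : SSet.{u}) ⟶ SSet.toTop.obj Δ[d] :=
      TopCat.ofHom (ContinuousMap.const _ x)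
    have hq : q ≫ SSet.toTop.map p = 𝟙 _ := by
      ext x
      exact Subsingleton.elim _ _
    exact TopCat.homologyIso_of_homotopyEquiv (g := q) h.symm
      (hq ▸ ContinuousMap.Homotopy.refl _)
  have h0 : homologyIso (sSetTopAdj.unit.app (Δ[0] : SSet.{u})) :=
    have := isIso_unit_of_unique (Δ[0] : SSet.{u})
    homologyIso_of_isIso _
  refine homologyIso.of_postcomp _ _ hp' ?_
  have h : sSetTopAdj.unit.app Δ[d] ≫ TopCat.toSSet.map (SSet.toTop.map p) =
      p ≫ sSetTopAdj.unit.app Δ[0] := (sSetTopAdj.unit.naturality p).symm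
  rw [h]
  exact homologyIso.comp_mem _ _ hp h0

/-- The unit of the adjunction between geometric realization and singular simplices is a homology
isomorphism. -/
theorem homologyIso_unit (X : SSet.{u}) : homologyIso (sSetTopAdj.unit.app X) :=
  homologyIso_app_of_stdSimplex sSetTopAdj.unit isCellular_id TopCat.isCellular_toTop
    homologyIso_unit_stdSimplex X

end SSet

/-! ### From homology isomorphisms to cohomology. -/

section dual

variable (M : Type v) [AddCommGroup M]

/-- The contravariant functor of additive maps to `M`. -/
noncomputable def dualFunctor : ModuleCat.{u} ℤ ⥤ AddCommGrpCat.{max u v}ᵒᵖ where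
  obj P := op (AddCommGrpCat.of (P →+ M))
  map f := (AddCommGrpCat.ofHom (f.hom.toAddMonoidHom.compHom' : _ →+ _)).op

instance : (dualFunctor.{u} M).Additive where
  map_add {P Q f g} := by
    apply Quiver.Hom.unop_inj
    ext φ
    exact AddMonoidHom.ext fun x => map_add (show Q →+ M from φ) _ _

/-- The cochain complex of additive maps to `M`. -/
noncomputable def dualComplex (K : ChainComplex (ModuleCat.{u} ℤ) ℕ) :
    CochainComplex AddCommGrpCat.{max u v} ℕ :=
  (((dualFunctor M).mapHomologicalComplex _).obj K).unop

/-- An additive functor preserves homotopy equivalences, whereas it need not preserve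
quasi-isomorphisms. -/
lemma nonempty_homology_dualComplex_iso {K L : ChainComplex (ModuleCat.{u} ℤ) ℕ}
    (e : HomotopyEquiv K L) (n : ℕ) :
    Nonempty ((dualComplex M K).homology n ≅ (dualComplex M L).homology n) := by
  have h : QuasiIso ((dualFunctor M).mapHomotopyEquiv e).hom := HomotopyEquiv.quasiIso_hom _
  let g : dualComplex M L ⟶ dualComplex M K :=
    (HomologicalComplex.unopFunctor _ _).map ((dualFunctor M).mapHomotopyEquiv e).hom.op
  have hg : QuasiIso g :=
    inferInstanceAs (QuasiIso ((HomologicalComplex.unopFunctor _ _).map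
      ((dualFunctor M).mapHomotopyEquiv e).hom.op))
  exact ⟨(isoOfQuasiIsoAt g n).symm⟩

lemma Finsupp.addMonoidHom_eq_of_single_one {X : Type*} {φ ψ : (X →₀ ℤ) →+ M}
    (h : ∀ x, φ (Finsupp.single x 1) = ψ (Finsupp.single x 1)) : φ = ψ := by
  ext x
  exact h x

/-- Additive maps out of a free abelian group. -/
noncomputable def dualFreeEquiv (X : Type u) : ((X →₀ ℤ) →+ M) ≃+ (X → M) where
  toFun φ x := φ (Finsupp.single x 1)
  invFun c := (Finsupp.lift M ℤ X c).toAddMonoidHom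
  left_inv _ := Finsupp.addMonoidHom_eq_of_single_one M fun x => Finsupp.lift_single_one _ x
  right_inv _ := funext fun x => Finsupp.lift_single_one _ x
  map_add' _ _ := rfl

lemma functionCochainComplex_d {X : ℕ → Type u} (d : ∀ n, Fin (n + 2) → X (n + 1) → X n)
    (hd : ∀ n (i j : Fin (n + 2)), i ≤ j → ∀ x : X (n + 2),
      d n i (d (n + 1) j.succ x) = d n j (d (n + 1) i.castSucc x)) (n : ℕ) :
    (functionCochainComplex d M hd).d n (n + 1) = AddCommGrpCat.ofHom (altCoboundary d M n) :=
  CochainComplex.of_d (fun n => AddCommGrpCat.of (X n → M))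
    (fun n => AddCommGrpCat.ofHom (altCoboundary d M n)) n

/-- Isomorphic sequences of sets with face maps have isomorphic cochain complexes. -/
noncomputable def functionCochainComplexIso {X Y : ℕ → Type u}
    {d : ∀ n, Fin (n + 2) → X (n + 1) → X n} {d' : ∀ n, Fin (n + 2) → Y (n + 1) → Y n}
    (e : ∀ n, X n ≃ Y n) (he : ∀ n j x, e n (d n j x) = d' n j (e (n + 1) x))
    (hd : ∀ n (i j : Fin (n + 2)), i ≤ j → ∀ x : X (n + 2),
      d n i (d (n + 1) j.succ x) = d n j (d (n + 1) i.castSucc x))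
    (hd' : ∀ n (i j : Fin (n + 2)), i ≤ j → ∀ x : Y (n + 2),
      d' n i (d' (n + 1) j.succ x) = d' n j (d' (n + 1) i.castSucc x)) :
    functionCochainComplex d' M hd' ≅ functionCochainComplex d M hd :=
  HomologicalComplex.Hom.isoOfComponents
    (fun n => AddEquiv.toAddCommGrpIso
      (({ Equiv.arrowCongr (e n).symm (Equiv.refl M) with map_add' := fun _ _ => rfl } :
        (Y n → M) ≃+ (X n → M)))) (by
    rintro i _ rfl
    rw [functionCochainComplex_d, functionCochainComplex_d]
    ext c
    refine funext fun x => ?_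
    change ∑ j : Fin (i + 2), (-1 : ℤ) ^ (j : ℕ) • (c : Y i → M) (e i (d i j x)) =
      ∑ j : Fin (i + 2), (-1 : ℤ) ^ (j : ℕ) • (c : Y i → M) (d' i j (e (i + 1) x))
    exact Finset.sum_congr rfl fun j _ =>
      congrArg (fun y => (-1 : ℤ) ^ (j : ℕ) • (c : Y i → M) y) (he i j x))

/-- The cochain complex of `M`-valued functions on the simplices of a simplicial set. -/
noncomputable def SSet.cochains (X : SSet.{u}) : CochainComplex AddCommGrpCat.{max u v} ℕ :=
  functionCochainComplex (X := fun n => X _⦋n⦌) (fun _ j x => X.δ j x) M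
    (fun _ _ _ hij x => ConcreteCategory.congr_hom (X.δ_comp_δ hij) x)

lemma SSet.cochains_d (X : SSet.{u}) (n : ℕ) : (X.cochains M).d n (n + 1) =
    AddCommGrpCat.ofHom (altCoboundary (X := fun n => X _⦋n⦌) (fun _ j x => X.δ j x) M n) :=
  functionCochainComplex_d M _ _ n

/-- Cochains are dual to chains. -/
noncomputable def SSet.dualComplexIso (X : SSet.{u}) :
    dualComplex M (freeChains.obj X) ≅ X.cochains M :=
  HomologicalComplex.Hom.isoOfComponents
    (fun n => AddEquiv.toAddCommGrpIso (dualFreeEquiv M (X _⦋n⦌))) (by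
    rintro i _ rfl
    rw [SSet.cochains_d]
    ext φ
    refine funext fun x => ?_
    let ψ : (X _⦋i⦌ →₀ ℤ) →+ M := φ
    change ∑ j : Fin (i + 2), (-1 : ℤ) ^ (j : ℕ) •
        ψ (Finsupp.single (X.δ j x) (1 : ℤ)) =
      ψ (chainsEquiv X i ((freeChains.obj X).d (i + 1) i
        ((chainsEquiv X (i + 1)).symm (Finsupp.single x (1 : ℤ)))))
    rw [chainsEquiv_d, LinearEquiv.apply_symm_apply, boundaryLin_single, map_sum]
    exact Finset.sum_congr rfl fun j _ => (map_zsmul _ _ _).symm)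

/-- Chains are projective and vanish in negative degrees, so the quasi-isomorphism is a homotopy
equivalence and can be dualized. -/
lemma SSet.nonempty_homology_cochains {X Y : SSet.{u}} {f : X ⟶ Y} (hf : homologyIso f) (n : ℕ) :
    Nonempty ((X.cochains M).homology n ≃+ (Y.cochains M).homology n) := by
  obtain ⟨e, -⟩ := (ChainComplex.quasiIso_iff_of_projective _).1 ((homologyIso_iff f).1 hf)
  obtain ⟨e⟩ := nonempty_homology_dualComplex_iso M e n
  exact ⟨((HomologicalComplex.homologyFunctor _ _ n).mapIso (X.dualComplexIso M).symm ≪≫ e ≪≫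
    (HomologicalComplex.homologyFunctor _ _ n).mapIso (Y.dualComplexIso M)).addCommGroupIsoToAddEquiv⟩

end dual

/-! ### Products of homology isomorphisms; singular simplices of products. -/

namespace SSet

open MonoidalCategory CartesianMonoidalCategory

section pi

/-- The product of a family of simplicial sets. -/
def piObj {I : Type} (F : I → SSet.{u}) : SSet.{u} where
  obj n := ∀ i, (F i).obj n
  map f := ↾fun x i => (F i).map f (x i)
  map_id n := by
    refine ConcreteCategory.hom_ext _ _ fun x => ?_
    exact funext fun i => (F i).map_id_apply n (x i)
  map_comp f g := by
    refine ConcreteCategory.hom_ext _ _ fun x => ?_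
    exact funext fun i => (F i).map_comp_apply f g (x i)

/-- The product of a family of maps of simplicial sets. -/
def piMap {I : Type} {F F' : I → SSet.{u}} (f : ∀ i, F i ⟶ F' i) : piObj F ⟶ piObj F' where
  app n := ↾fun x i => (f i).app n (x i)
  naturality m n g := by
    refine ConcreteCategory.hom_ext _ _ fun x => ?_
    exact funext fun i => NatTrans.naturality_apply (f i) g (x i)

/-- Splitting off a factor. -/
def piSplit {I : Type} (F : I → SSet.{u}) (j : I) :
    piObj F ⟶ F j ⊗ piObj fun i : {i // i ≠ j} => F i where
  app _ := ↾fun x => (x j, fun i => x i)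
  naturality _ _ _ := rfl

instance {I : Type} (F : I → SSet.{u}) (j : I) : IsIso (piSplit F j) := by
  classical
  refine TopCat.isIso_of_bijective _ fun n => ⟨fun x y h => ?_, ?_⟩
  · obtain ⟨h₁, h₂⟩ := Prod.ext_iff.1 h
    refine funext fun i => ?_
    by_cases hi : i = j
    · subst hi
      exact h₁
    · exact congrFun h₂ ⟨i, hi⟩
  · rintro ⟨a, x⟩
    refine ⟨fun i => if h : i = j then h ▸ a else x ⟨i, h⟩, Prod.ext ?_ (funext fun i => ?_)⟩
    · exact dif_pos rfl
    · exact dif_neg i.2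

lemma isIso_piMap {I : Type} {F F' : I → SSet.{u}} (f : ∀ i, F i ⟶ F' i) [∀ i, IsIso (f i)] :
    IsIso (piMap f) := by
  refine TopCat.isIso_of_bijective _ fun n => ?_
  have h (i) : Function.Bijective ((f i).app (op ⦋n⦌)) := (isIso_iff_bijective _).1 inferInstance
  exact ⟨Function.Injective.piMap fun i => (h i).1, Function.Surjective.piMap fun i => (h i).2⟩

lemma homologyIso_whiskerLeft (Z : SSet.{u}) {A B : SSet.{u}} {f : A ⟶ B} (hf : homologyIso f) :
    homologyIso (Z ◁ f) :=
  (homologyIso.arrow_mk_iso_iff (Arrow.isoMk (β_ Z A) (β_ Z B)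
    (BraidedCategory.braiding_naturality_right Z f).symm)).2 (homologyIso_whiskerRight hf Z)

/-- The index set may be infinite; the induction is on the size of `S`. Splitting off a factor `j ∈
S` writes the product map as `f j` times an identity, followed by an identity times the product of
the others. -/
lemma homologyIso_piMap {I : Type} {F F' : I → SSet.{u}} (f : ∀ i, F i ⟶ F' i)
    (hf : ∀ i, homologyIso (f i)) (S : Finset I) (hS : ∀ i, i ∉ S → IsIso (f i)) :
    homologyIso (piMap f) := by
  classical
  induction hn : S.card generalizing I with
  | zero =>
    have (i : I) : IsIso (f i) := hS i (by simp [Finset.card_eq_zero.1 hn])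
    have := isIso_piMap f
    exact homologyIso_of_isIso _
  | succ n ih =>
    obtain ⟨j, hj⟩ := Finset.card_pos.1 (hn ▸ Nat.succ_pos n : 0 < S.card)
    have h := ih (fun i : {i // i ≠ j} => f i) (fun i => hf i) (S.subtype _)
      (fun i hi => hS i fun h => hi (Finset.mem_subtype.2 h)) (by
        rw [Finset.card_subtype, Finset.filter_ne', Finset.card_erase_of_mem hj, hn]
        rfl)
    refine homologyIso.of_postcomp _ (piSplit F' j) (homologyIso_of_isIso _) ?_
    have e : piMap f ≫ piSplit F' j = piSplit F j ≫ (f j ▷ _) ≫ (F' j ◁ piMap fun i => f i) := rfl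
    rw [e]
    exact homologyIso.comp_mem _ _ (homologyIso_of_isIso _) (homologyIso.comp_mem _ _
      (homologyIso_whiskerRight (hf j) _) (homologyIso_whiskerLeft _ h))

/-- Singular simplices of a product. -/
noncomputable def toSSetPi {I : Type} (Y : I → TopCat.{u}) :
    TopCat.toSSet.obj (TopCat.of (∀ i, Y i)) ⟶ piObj fun i => TopCat.toSSet.obj (Y i) where
  app n := ↾fun s i => (TopCat.toSSet.map
    (TopCat.ofHom ⟨fun y : ∀ i, Y i => y i, continuous_apply i⟩ : TopCat.of (∀ i, Y i) ⟶ Y i)).app n s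
  naturality _ _ _ := rfl

/-- This is the universal property of the product topology, applied to maps out of simplices. -/
instance {I : Type} (Y : I → TopCat.{u}) : IsIso (toSSetPi Y) := by
  refine TopCat.isIso_of_bijective _ fun n => ⟨fun s s' h => ?_, fun s => ?_⟩
  · refine (TopCat.simplexEquiv _ n).injective (ContinuousMap.ext fun t => funext fun i => ?_)
    exact congrArg (fun s => TopCat.simplexEquiv (Y i) n s t) (congrFun h i)
  · refine ⟨(TopCat.simplexEquiv (TopCat.of (∀ i, Y i)) n).symm
      (ContinuousMap.pi fun i => TopCat.simplexEquiv (Y i) n (s i)), funext fun i => ?_⟩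
    rfl

end pi

end SSet

/-- For `k > n` the set `[n:k]` is thus empty and `𝒦(G_k, k)` has a single `n`-simplex, so the bound
`k ≤ n` on the arguments of a cochain loses nothing. -/
lemma MultiIndex.le_of_mem {n k : ℕ} (q : MultiIndex n k) : k ≤ n := by
  have h : Function.Injective fun i : Fin k => (⟨q i - 1, by
      have := q.one_le i; have := q.le i; omega⟩ : Fin n) := by
    intro i j hij
    refine q.strictMono.injective ?_
    have := Fin.mk.inj hij
    have := q.one_le i
    have := q.one_le j
    omega
  simpa using Fintype.card_le_of_injective _ h

/-! ### Extended groups and the theorem. -/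

namespace ExtendedGroup

variable (G : ExtendedGroup.{u})

/-- The product of the simplicial sets `𝒦(G_k, k)`. -/
noncomputable def productK : SSet.{u} :=
  SSet.piObj fun k : ℕ+ => simplicialK (G.carrier k) k (G.mul_comm k)

/-- The arguments of cochains are the simplices of the product of the `𝒦(G_k, k)`. -/
noncomputable def argEquiv (n : ℕ) : G.Arg n ≃ G.productK _⦋n⦌ where
  toFun g k := fun q : MultiIndex n k => g k q.le_of_mem q
  invFun x k _ := (x k : MultiIndex n k → G.carrier k)
  left_inv _ := rfl
  right_inv _ := rfl

lemma argEquiv_argFace (n : ℕ) (j : Fin (n + 2)) (g : G.Arg (n + 1)) :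
    G.argEquiv n (G.argFace n j g) = G.productK.δ j (G.argEquiv (n + 1) g) :=
  funext fun k => (simplicialK_δ (G.mul_comm k) j (G.argEquiv (n + 1) g k)).symm

/-- The cochain complex of an extended group is the cochain complex of the product of the
`𝒦(G_k, k)`. -/
noncomputable def cochainComplexIso (M : Type v) [AddCommGroup M] :
    G.cochainComplex M ≅ G.productK.cochains M :=
  (functionCochainComplexIso M (X := G.Arg) (Y := fun n => G.productK _⦋n⦌)
    G.argEquiv G.argEquiv_argFace _ _).symm

/-- A trivial `G_k` gives a simplicial set with one simplex in each degree, whose unit is an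
isomorphism; this leaves finitely many factors. -/
lemma homologyIso_piMap_unit :
    SSet.homologyIso (SSet.piMap fun k : ℕ+ =>
      sSetTopAdj.unit.app (simplicialK (G.carrier k) k (G.mul_comm k))) := by
  obtain ⟨N, hN⟩ := G.bounded
  refine SSet.homologyIso_piMap _ (fun k => SSet.homologyIso_unit _)
    -- The bound `N` may be zero, so `N + 1` serves as the upper end among the positive integers.
    (Finset.Icc 1 ⟨N + 1, N.succ_pos⟩) fun k hk => ?_
  have := hN k (by
    by_contra h
    refine hk (Finset.mem_Icc.2 ⟨one_le, ?_⟩)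
    exact (not_lt.1 h).trans N.le_succ)
  have (n : ℕ) : Unique ((simplicialK (G.carrier k) k (G.mul_comm k)) _⦋n⦌) :=
    { default := fun _ : MultiIndex n k => (1 : G.carrier k)
      uniq := fun _ => Subsingleton.elim (α := MultiIndex n k → G.carrier k) _ _ }
  exact SSet.isIso_unit_of_unique _

end ExtendedGroup

theorem mainTheorem3 (G : ExtendedGroup.{u}) (M : Type v) [AddCommGroup M] (n : ℕ) :
    Nonempty (G.cohomology M n ≃+ singularCohomology G.productSpace M n) := by
  obtain ⟨e⟩ := SSet.nonempty_homology_cochains M G.homologyIso_piMap_unit n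
  obtain ⟨e'⟩ := SSet.nonempty_homology_cochains M
    (SSet.homologyIso_of_isIso (SSet.toSSetPi fun k : ℕ+ =>
      SSet.toTop.obj (simplicialK (G.carrier k) k (G.mul_comm k)))) n
  -- The singular cochain complex is by definition the cochain complex of the singular simplicial
  -- set, so the source of `e'` needs no further identification.
  exact ⟨((HomologicalComplex.homologyFunctor _ _ n).mapIso
    (G.cochainComplexIso M)).addCommGroupIsoToAddEquiv.trans (e.trans e'.symm)⟩
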